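/- **Setting.** Let $d\ge 2$, $\mathbb T=\mathbb R/2\pi\mathbb Z$, and for $u\in L^2(\mathbb T^d,\mathbb R^n)$ let $\|u\|_{H^s}^2=\sum_{\xi\in\mathbb Z^d}\max\{1,|\xi|\}^{2s}|\widehat u(\xi)|^2$, $\widehat u(\xi)=(2\pi)^{-d}\int_{\mathbb T^d}u(x)e^{-i x\cdot\xi}\,dx$; $H^s_0$ is the subspace of $H^s$ of functions with zero average. Consider the forced Navier–Stokes equation $$\partial_t u-\Delta u+u\cdot\nabla u+\nabla p=\varepsilon f(\omega t,x),\qquad \operatorname{div}u=0\qquad\text{on }\mathbb T^d .\tag{NS}$$ Fix $\alpha\in(0,1)$, $s>d/2+1$, an integer $N>\frac{3\nu}2+s+2$, a force $f\in C^N(\mathbb T^\nu\times\mathbb T^d,\mathbb R^d)$ with $\int_{\mathbb T^\nu\times\mathbb T^d}f\,d\varphi\,dx=0$, and a constant $K>0$. **Theorem 1.2 (Stability).** There are $\delta_0\in(0,1)$ and $C>0$, depending only on $d,\nu,\alpha,s,N,f,K$, such that the following holds. Let $\omega\in\mathbb R^\nu$ be Diophantine, i.e. for some $\gamma\in(0,1)$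 one has $|\omega\cdot\ell|\ge\gamma|\ell|^{-\nu}$ for all $\ell\in\mathbb Z^\nu\setminus\{0\}$; or let $\omega\in\mathbb R^\nu$ be arbitrary if $\int_{\mathbb T^d}f(\varphi,x)\,dx=0$ for all $\varphi$. Let $0<\varepsilon\le\delta\le\delta_0$, and let $u_\omega(t,x)=U(\omega t,x)$, $p_\omega(t,x)=P(\omega t,x)$ be a quasi-periodic solution of (NS) for $t\in\mathbb R$ with $$U\in C^1(\mathbb T^\nu,H^s(\mathbb T^d,\mathbb R^d)),\quad P\in C^0(\mathbb T^\nu,H^s(\mathbb T^d,\mathbb R)),\quad \|U\|_{C^1_\varphi H^s_x},\ \|P\|_{C^0_\varphi H^s_x}\le K\varepsilon,$$ $\int_{\mathbb T^\nu\times\mathbb T^d}U\,d\varphi\,dx=0$ and $\int_{\mathbb T^d}P(\varphi,x)\,dx=0$ for all $\varphi$. Let $u_0\in H^s(\mathbb T^d,\mathbb R^d)$ satisfy $$\operatorname{div}u_0=0,\qquad \|u_0-u_\omega(0,\cdot)\|_{H^s}\le\delta,\qquad \int_{\mathbb T^d}\big(u_0(x)-u_\omega(0,x)\big)\,dx=0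 .$$ Then (NS) has a global classical solution $(u,p)$ for $t\ge0$ with $u(0,\cdot)=u_0$, $$u\in C^0_b([0,\infty),H^s)\cap C^1_b([0,\infty),H^{s-2}),\qquad p\in C^0_b([0,\infty),H^s_0),$$ it is unique among all solutions of this regularity with this initial datum, and for all $t\ge0$ $$\int_{\mathbb T^d}\big(u(t,x)-u_\omega(t,x)\big)\,dx=0,$$ $$\|u(t)-u_\omega(t)\|_{H^s},\ \ \|\partial_tu(t)-\partial_tu_\omega(t)\|_{H^{s-2}},\ \ \|p(t)-p_\omega(t)\|_{H^s}\ \le\ C\,\delta\,e^{-\alpha t}.$$ -/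

import Mathlib

open MeasureTheory Filter Topology
open scoped ENNReal NNReal

noncomputable section

namespace NSTorus

/-! ### The torus, Fourier coefficients, Sobolev norms -/

instance instFactTwoPiPos : Fact ((0 : ℝ) < 2 * Real.pi) := ⟨Real.two_pi_pos⟩

/-- The torus `(ℝ / 2πℤ)^d`, with the product of the Haar measures of total mass `2π`. -/
abbrev Torus (d : ℕ) : Type := Fin d → AddCircle (2 * Real.pi)

/-- Real valued square integrable functions on the torus. -/
abbrev L2 (d : ℕ) : Type := Lp ℝ 2 (volume : Measure (Torus d))

/-- Vector fields on the torus with `n` square integrable components. -/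
abbrev L2Vec (d n : ℕ) : Type := Fin n → L2 d

/-- The projection `ℝ^d → 𝕋^d`. -/
def toTorus {d : ℕ} (y : Fin d → ℝ) : Torus d := fun i => (y i : AddCircle (2 * Real.pi))

/-- The character `x ↦ exp (i ξ · x)`. -/
def character {d : ℕ} (ξ : Fin d → ℤ) (x : Torus d) : ℂ := ∏ i, fourier (ξ i) (x i)

/-- `û(ξ) = (2π)^{-d} ∫ u(x) exp (-i ξ · x) dx`. -/
def coeff {d : ℕ} (u : Torus d → ℝ) (ξ : Fin d → ℤ) : ℂ :=
  (1 / (2 * (Real.pi : ℂ)) ^ d) * ∫ x, (u x : ℂ) * character (-ξ) x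

/-- The Euclidean length of an integer vector. -/
def euclLen {d : ℕ} (ξ : Fin d → ℤ) : ℝ := Real.sqrt (∑ i, (ξ i : ℝ) ^ 2)

/-- `⟨ξ⟩ = max {1, |ξ|}`. -/
def bracket {d : ℕ} (ξ : Fin d → ℤ) : ℝ := max 1 (euclLen ξ)

/-- The square `∑ ⟨ξ⟩^{2s} |û(ξ)|²` of the `H^s` norm, with value `∞` outside `H^s`. -/
def sobolevSq {d : ℕ} (s : ℝ) (u : L2 d) : ℝ≥0∞ :=
  ∑' ξ : Fin d → ℤ, ENNReal.ofReal (bracket ξ ^ (2 * s) * ‖coeff u ξ‖ ^ 2)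

/-- The `H^s` norm of a scalar function, with value `∞` outside `H^s`. -/
def sobolevNorm {d : ℕ} (s : ℝ) (u : L2 d) : ℝ≥0∞ := sobolevSq s u ^ (1 / 2 : ℝ)

/-- The `H^s` norm of a vector field, with value `∞` outside `H^s`. -/
def sobolevNormVec {d n : ℕ} (s : ℝ) (u : L2Vec d n) : ℝ≥0∞ :=
  (∑ k, sobolevSq s (u k)) ^ (1 / 2 : ℝ)

/-! ### Continuity and differentiability with respect to an extended norm

Below `N` is an extended norm on `V`; the Banach space meant is `X = {v | N v < ∞}`. -/

/-- Continuity on `I` with respect to the norm `N`. -/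
def ContinuousIn {T V : Type*} [TopologicalSpace T] [AddCommGroup V]
    (N : V → ℝ≥0∞) (I : Set T) (u : T → V) : Prop :=
  ∀ t ∈ I, Tendsto (fun τ => N (u τ - u t)) (𝓝[I] t) (𝓝 0)

/-- `u ∈ C⁰_b(I, X)`: bounded and continuous on `I` with values in `X`. -/
def BoundedContinuousIn {T V : Type*} [TopologicalSpace T] [AddCommGroup V]
    (N : V → ℝ≥0∞) (I : Set T) (u : T → V) : Prop :=
  (∃ M : ℝ≥0, ∀ t ∈ I, N (u t) ≤ M) ∧ ContinuousIn N I u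

/-- `u'` is the derivative of `u` on `I ⊆ ℝ` (one-sided at end points), the difference quotients
converging in the norm `N`. -/
def DerivativeIn {V : Type*} [AddCommGroup V] [Module ℝ V]
    (N : V → ℝ≥0∞) (I : Set ℝ) (u u' : ℝ → V) : Prop :=
  ∀ t ∈ I, Tendsto (fun τ => N ((τ - t)⁻¹ • (u τ - u t) - u' t)) (𝓝[I \ {t}] t) (𝓝 0)

/-- `U ∈ C¹(𝕋^ν, X)` with partial derivatives `dU i = ∂U/∂φ_i`, and with `C¹` norm (the maximum
of the sup-norms of `U` and of its partial derivatives) at most `B`. -/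
structure TorusC1 {ν : ℕ} {V : Type*} [AddCommGroup V] [Module ℝ V]
    (N : V → ℝ≥0∞) (B : ℝ) (U : Torus ν → V) (dU : Fin ν → Torus ν → V) : Prop where
  cont : ContinuousIn N Set.univ U
  bound : ∀ φ, N (U φ) ≤ ENNReal.ofReal B
  deriv : ∀ i φ, Tendsto
    (fun h : ℝ => N (h⁻¹ • (U (φ + toTorus (Pi.single i h)) - U φ) - dU i φ)) (𝓝[≠] 0) (𝓝 0)
  cont_deriv : ∀ i, ContinuousIn N Set.univ (dU i)
  bound_deriv : ∀ i φ, N (dU i φ) ≤ ENNReal.ofReal B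

/-! ### The Navier-Stokes equation -/

/-- `g = ∂u/∂x_j` in the sense of distributions (tested against all characters). -/
def IsPartial {d : ℕ} (j : Fin d) (u g : L2 d) : Prop :=
  ∀ ξ : Fin d → ℤ, coeff g ξ = Complex.I * (ξ j : ℂ) * coeff u ξ

/-- `g = Δu` in the sense of distributions. -/
def IsLaplacian {d : ℕ} (u g : L2 d) : Prop :=
  ∀ ξ : Fin d → ℤ, coeff g ξ = -((euclLen ξ ^ 2 : ℝ) : ℂ) * coeff u ξ

/-- `div u = 0` in the sense of distributions. -/
def DivFree {d : ℕ} (u : L2Vec d d) : Prop :=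
  ∀ ξ : Fin d → ℤ, ∑ j, Complex.I * (ξ j : ℂ) * coeff (u j) ξ = 0

/-- At a fixed time: `u' - Δu + u · ∇u + ∇p = F` almost everywhere on the torus and `div u = 0`,
all the space derivatives that occur being square integrable functions. -/
def NavierStokesAt {d : ℕ} (F : Torus d → EuclideanSpace ℝ (Fin d))
    (u u' : L2Vec d d) (p : L2 d) : Prop :=
  DivFree u ∧
  ∃ (Du : Fin d → Fin d → L2 d) (Lu Dp : Fin d → L2 d),
    (∀ j k, IsPartial j (u k) (Du j k)) ∧
    (∀ k, IsLaplacian (u k) (Lu k)) ∧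
    (∀ k, IsPartial k p (Dp k)) ∧
    ∀ k, ∀ᵐ x : Torus d,
      u' k x - Lu k x + (∑ j, u j x * Du j k x) + Dp k x = F x k

/-- `(u, p)` solves the Navier-Stokes equation with force `F` at every time of `I`, where
`u' = ∂_t u` is the time derivative in `H^{s-2}`. -/
def SolvesNavierStokes {d : ℕ} (s : ℝ) (I : Set ℝ) (F : ℝ → Torus d → EuclideanSpace ℝ (Fin d))
    (u u' : ℝ → L2Vec d d) (p : ℝ → L2 d) : Prop :=
  DerivativeIn (sobolevNormVec (s - 2)) I u u' ∧ ∀ t ∈ I, NavierStokesAt (F t) (u t) (u' t) (p t)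

/-- Global classical solutions of the Cauchy problem:
`u ∈ C⁰_b([0,∞), H^s) ∩ C¹_b([0,∞), H^{s-2})` with `u' = ∂_t u`, `p ∈ C⁰_b([0,∞), H^s_0)`. -/
structure IsGlobalClassicalSolution {d : ℕ} (s : ℝ) (F : ℝ → Torus d → EuclideanSpace ℝ (Fin d))
    (u₀ : L2Vec d d) (u u' : ℝ → L2Vec d d) (p : ℝ → L2 d) : Prop where
  initial : u 0 = u₀
  regular : BoundedContinuousIn (sobolevNormVec s) (Set.Ici 0) u
  regular_low : BoundedContinuousIn (sobolevNormVec (s - 2)) (Set.Ici 0) u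
  regular_deriv : BoundedContinuousIn (sobolevNormVec (s - 2)) (Set.Ici 0) u'
  regular_pressure : BoundedContinuousIn (sobolevNorm s) (Set.Ici 0) p
  mean_pressure : ∀ t ∈ Set.Ici (0 : ℝ), ∫ x, p t x = 0
  solves : SolvesNavierStokes s (Set.Ici 0) F u u' p

/-! ### Quasi-periodic forces and solutions -/

/-- The point `ω t` of the torus. -/
def flow {ν : ℕ} (ω : Fin ν → ℝ) (t : ℝ) : Torus ν := toTorus fun i => ω i * t

/-- The force `ε f(ω t, x)`. -/
def force {ν d : ℕ} (ε : ℝ) (f : Torus ν × Torus d → EuclideanSpace ℝ (Fin d)) (ω : Fin ν → ℝ)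
    (t : ℝ) (x : Torus d) : EuclideanSpace ℝ (Fin d) := ε • f (flow ω t, x)

/-- `f ∈ C^N(𝕋^ν × 𝕋^d, ℝ^d)`: the periodic lift of `f` is of class `C^N`. -/
def IsCN {ν d : ℕ} (N : ℕ) (f : Torus ν × Torus d → EuclideanSpace ℝ (Fin d)) : Prop :=
  ContDiff ℝ N fun y : (Fin ν → ℝ) × (Fin d → ℝ) => f (toTorus y.1, toTorus y.2)

/-- `|ω · ℓ| ≥ γ / |ℓ|^ν` for all nonzero integer vectors `ℓ`, for some `γ ∈ (0,1)`. -/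
def Diophantine {ν : ℕ} (ω : Fin ν → ℝ) : Prop :=
  ∃ γ ∈ Set.Ioo (0 : ℝ) 1, ∀ ℓ : Fin ν → ℤ, ℓ ≠ 0 → γ / euclLen ℓ ^ ν ≤ |∑ i, ω i * (ℓ i : ℝ)|

/-- `u_ω(t) = U(ω t)`, `p_ω(t) = P(ω t)` is a quasi-periodic solution of size `K ε`, and
`uω'` is the time derivative of `u_ω`. -/
structure IsQuasiPeriodicSolution {ν d : ℕ} (s ε K : ℝ)
    (f : Torus ν × Torus d → EuclideanSpace ℝ (Fin d)) (ω : Fin ν → ℝ)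
    (U : Torus ν → L2Vec d d) (P : Torus ν → L2 d) (uω' : ℝ → L2Vec d d) : Prop where
  regular : ∃ dU, TorusC1 (sobolevNormVec s) (K * ε) U dU
  cont_pressure : ContinuousIn (sobolevNorm s) Set.univ P
  bound_pressure : ∀ φ, sobolevNorm s (P φ) ≤ ENNReal.ofReal (K * ε)
  mean : ∀ k, ∫ φ, ∫ x, U φ k x = 0
  mean_pressure : ∀ φ, ∫ x, P φ x = 0
  solves : SolvesNavierStokes s Set.univ (force ε f ω)
    (fun t => U (flow ω t)) uω' (fun t => P (flow ω t))

end NSTorus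

end

/-! Write w for the coefficients of the given solution and v for those of the perturbation u − u_ω.
The force cancels in the equation of v, and the Leray projection Π removes the pressure: v' = Δv −
Π[(w+v)·∇(w+v) − w·∇w], the last term being `pert`. This term has no zero frequency and v starts
with zero mean, so only |ξ| ≥ 1 matters and the heat flow decays like e^{-t}. Every rate α < 1 is
reached by solving for x = e^{αt} v, whose damping |ξ|² − α is still at least (1−α)⟨ξ⟩²
(`damping_bounds`).

Put s = σ + 1 with σ > d/2. Then H^σ is an algebra (`hs_conv_le`), and the nonlinear term maps
H^{σ+1} to H^σ with a Lipschitz constant proportional to the size of w and v (`hsv_pert_sub_le`).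
The lost derivative is recovered by `hsv_duh_le`. For D' = −μD + g at one frequency, Cauchy–Schwarz
in time against the kernel e^{-μ(t−r)}, of mass at most 1/μ, gives |D|² ≤ μ⁻¹ ∫ e^{-μ(t−r)} |g|² dr.
The factor μ⁻¹ absorbs the additional weight ⟨ξ⟩²; the kernel is then bounded by e^{-m(t−r)} with m
independent of ξ, so the sum over ξ passes under the integral and only the supremum in time of ‖g‖
in H^σ remains. The contraction principle in the ball of radius 2δ of bounded continuous curves
(`exists_perturbation`) yields global existence and decay together. The time derivative is read off
the equation, and the pressure is a multiplier of order −1 applied to the nonlinearity.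

Uniqueness requires no smallness. The difference of two bounded solutions is multiplied by e^{-βt};
when 1 + β = m² is large, the smoothing estimate has constant 1/m, so the supremum of the weighted
difference is at most half of itself (`eq_of_projected_equation`).

All estimates concern sequences of Fourier coefficients, with norms in [0,∞]. The bridge to
functions has three pillars: coefficients determine an integrable function, by Stone–Weierstrass
(`ae_eq_zero_of_coeff`); square summable hermitian sequences come from real functions
(`exists_coeff_eq`); products become convolutions, by Parseval (`coeff_mul`). -/

noncomputable section

namespace NSTorus

/-! ### The `ℓ²` norm of sequences of extended nonnegative reals -/

/-- The `ℓ²` norm of a family of extended nonnegative reals. -/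
def ellTwo {κ : Type*} (A : κ → ℝ≥0∞) : ℝ≥0∞ := (∑' i, A i ^ 2) ^ (1 / 2 : ℝ)

lemma sqrt_sq_ennreal (x : ℝ≥0∞) : (x ^ (1 / 2 : ℝ)) ^ 2 = x := by
  rw [← ENNReal.rpow_natCast, ← ENNReal.rpow_mul]; norm_num

lemma sq_sqrt_ennreal (x : ℝ≥0∞) : (x ^ 2) ^ (1 / 2 : ℝ) = x := by
  rw [← ENNReal.rpow_natCast, ← ENNReal.rpow_mul]; norm_num

lemma le_of_sq_le_sq_ennreal {x y : ℝ≥0∞} (h : x ^ 2 ≤ y ^ 2) : x ≤ y := by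
  rw [← sq_sqrt_ennreal x, ← sq_sqrt_ennreal y]
  exact ENNReal.rpow_le_rpow h (by norm_num)

section ellTwo

variable {κ : Type*} {A B : κ → ℝ≥0∞}

lemma ellTwo_sq (A : κ → ℝ≥0∞) : ellTwo A ^ 2 = ∑' i, A i ^ 2 := sqrt_sq_ennreal _

lemma ellTwo_mono (h : ∀ i, A i ≤ B i) : ellTwo A ≤ ellTwo B :=
  ENNReal.rpow_le_rpow (ENNReal.tsum_le_tsum fun i => by gcongr; exact h i) (by norm_num)

lemma le_ellTwo (A : κ → ℝ≥0∞) (i : κ) : A i ≤ ellTwo A := by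
  apply le_of_sq_le_sq_ennreal
  rw [ellTwo_sq]
  exact ENNReal.le_tsum i

lemma ellTwo_const_mul (c : ℝ≥0∞) (A : κ → ℝ≥0∞) :
    ellTwo (fun i => c * A i) = c * ellTwo A := by
  have h : ellTwo (fun i => c * A i) ^ 2 = (c * ellTwo A) ^ 2 := by
    rw [mul_pow, ellTwo_sq, ellTwo_sq, ← ENNReal.tsum_mul_left]
    simp only [mul_pow]
  exact le_antisymm (le_of_sq_le_sq_ennreal h.le) (le_of_sq_le_sq_ennreal h.ge)

lemma ellTwo_zero : ellTwo (fun _ : κ => 0) = 0 := by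
  simpa using ellTwo_const_mul 0 (fun _ : κ => 0)

/-- Against counting measure on the σ-algebra of all subsets every family is measurable, so
Minkowski and Cauchy–Schwarz for integrals apply to sums over any index type. -/
lemma ellTwo_eq_lintegral (A : κ → ℝ≥0∞) :
    ellTwo A = (∫⁻ i, A i ^ (2 : ℝ) ∂(@Measure.count κ ⊤)) ^ (1 / 2 : ℝ) := by
  let _ : MeasurableSpace κ := ⊤
  have _ : MeasurableSingletonClass κ := ⟨fun _ => trivial⟩
  rw [lintegral_count, ellTwo]
  norm_num [ENNReal.rpow_natCast]

lemma ellTwo_add_le (A B : κ → ℝ≥0∞) : ellTwo (fun i => A i + B i) ≤ ellTwo A + ellTwo B := by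
  let _ : MeasurableSpace κ := ⊤
  simp only [ellTwo_eq_lintegral]
  exact ENNReal.lintegral_Lp_add_le (p := 2) (measurable_from_top).aemeasurable
    (measurable_from_top).aemeasurable (by norm_num)

lemma tsum_mul_le_ellTwo (A B : κ → ℝ≥0∞) : ∑' i, A i * B i ≤ ellTwo A * ellTwo B := by
  let _ : MeasurableSpace κ := ⊤
  have _ : MeasurableSingletonClass κ := ⟨fun _ => trivial⟩
  simp only [ellTwo_eq_lintegral]
  rw [← lintegral_count]
  exact ENNReal.lintegral_mul_le_Lp_mul_Lq _ (Real.HolderConjugate.two_two)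
    (measurable_from_top).aemeasurable (measurable_from_top).aemeasurable

lemma ellTwo_sum_le {ι : Type*} (s : Finset ι) (A : ι → κ → ℝ≥0∞) :
    ellTwo (fun i => ∑ j ∈ s, A j i) ≤ ∑ j ∈ s, ellTwo (A j) := by
  classical
  induction s using Finset.induction_on with
  | empty => simp [ellTwo_zero]
  | insert a s ha ih =>
    simp only [Finset.sum_insert ha]
    exact (ellTwo_add_le _ _).trans (by gcongr)

lemma ellTwo_le_sum {n : ℕ} (A : Fin n → ℝ≥0∞) : ellTwo A ≤ ∑ k, A k := by
  apply le_of_sq_le_sq_ennreal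
  rw [ellTwo_sq, tsum_fintype, sq, Finset.sum_mul]
  gcongr with k
  rw [sq]
  gcongr
  exact Finset.single_le_sum (fun _ _ => zero_le) (Finset.mem_univ k)

/-- Young's inequality `ℓ² * ℓ¹ ⊆ ℓ²`. -/
lemma ellTwo_conv_le {G : Type*} [AddCommGroup G] (A B : G → ℝ≥0∞) :
    ellTwo (fun x => ∑' y, A (x - y) * B y) ≤ ellTwo A * ∑' y, B y := by
  apply le_of_sq_le_sq_ennreal
  -- Cauchy–Schwarz after splitting A·B as (A·B^{1/2})·B^{1/2}; the second factor contributes the ℓ¹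
  -- norm of B.
  have h1 : ∀ x, (∑' y, A (x - y) * B y) ^ 2 ≤ (∑' y, A (x - y) ^ 2 * B y) * ∑' y, B y := by
    intro x
    have := tsum_mul_le_ellTwo (fun y => A (x - y) * B y ^ (1 / 2 : ℝ))
      (fun y => B y ^ (1 / 2 : ℝ))
    have h2 : ∀ y, A (x - y) * B y ^ (1 / 2 : ℝ) * B y ^ (1 / 2 : ℝ) = A (x - y) * B y := by
      intro y
      rw [mul_assoc, ← sq, sqrt_sq_ennreal]
    simp only [h2] at this
    calc (∑' y, A (x - y) * B y) ^ 2
        ≤ (ellTwo (fun y => A (x - y) * B y ^ (1 / 2 : ℝ)) *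
            ellTwo (fun y => B y ^ (1 / 2 : ℝ))) ^ 2 := by gcongr
      _ = _ := by rw [mul_pow, ellTwo_sq, ellTwo_sq]; simp only [mul_pow, sqrt_sq_ennreal]
  rw [ellTwo_sq]
  calc ∑' x, (∑' y, A (x - y) * B y) ^ 2
      ≤ ∑' x, (∑' y, A (x - y) ^ 2 * B y) * ∑' y, B y := ENNReal.tsum_le_tsum h1
    _ = (∑' y, (∑' x, A (x - y) ^ 2) * B y) * ∑' y, B y := by
        rw [ENNReal.tsum_mul_right, ENNReal.tsum_comm]
        simp only [ENNReal.tsum_mul_right]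
    _ = (ellTwo A * ∑' y, B y) ^ 2 := by
        have : ∀ y, ∑' x, A (x - y) ^ 2 = ellTwo A ^ 2 := fun y => by
          rw [ellTwo_sq]
          exact (Equiv.subRight y).tsum_eq (fun x => A x ^ 2)
        simp only [this, ENNReal.tsum_mul_left]
        ring

end ellTwo

/-! ### Weighted sequences of Fourier coefficients -/

/-- Frequencies. -/
abbrev Freq (d : ℕ) : Type := Fin d → ℤ

section weights

variable {d : ℕ}

lemma euclLen_eq_norm (ξ : Freq d) :
    euclLen ξ = ‖(WithLp.toLp 2 (fun i => (ξ i : ℝ)) : EuclideanSpace ℝ (Fin d))‖ := by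
  rw [EuclideanSpace.norm_eq, euclLen]
  simp

lemma euclLen_nonneg (ξ : Freq d) : 0 ≤ euclLen ξ := Real.sqrt_nonneg _

lemma euclLen_sq (ξ : Freq d) : euclLen ξ ^ 2 = ∑ i, (ξ i : ℝ) ^ 2 :=
  Real.sq_sqrt (Finset.sum_nonneg fun _ _ => sq_nonneg _)

lemma euclLen_add_le (ξ η : Freq d) : euclLen (ξ + η) ≤ euclLen ξ + euclLen η := by
  simp only [euclLen_eq_norm]
  refine le_trans (le_of_eq ?_) (norm_add_le _ _)
  congr 1
  ext i
  simp

lemma euclLen_neg (ξ : Freq d) : euclLen (-ξ) = euclLen ξ := by simp [euclLen]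

lemma abs_le_euclLen (ξ : Freq d) (i : Fin d) : |(ξ i : ℝ)| ≤ euclLen ξ := by
  rw [← Real.sqrt_sq_eq_abs]
  exact Real.sqrt_le_sqrt (Finset.single_le_sum (f := fun i => (ξ i : ℝ) ^ 2)
    (fun _ _ => sq_nonneg _) (Finset.mem_univ i))

lemma one_le_bracket (ξ : Freq d) : 1 ≤ bracket ξ := le_max_left _ _

lemma bracket_pos (ξ : Freq d) : 0 < bracket ξ := one_pos.trans_le (one_le_bracket ξ)

lemma euclLen_le_bracket (ξ : Freq d) : euclLen ξ ≤ bracket ξ := le_max_right _ _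

lemma bracket_eq_euclLen {ξ : Freq d} (h : ξ ≠ 0) : bracket ξ = euclLen ξ := by
  refine max_eq_right ?_
  obtain ⟨i, hi⟩ := Function.ne_iff.mp h
  refine le_trans ?_ (abs_le_euclLen ξ i)
  have : (1 : ℤ) ≤ |ξ i| := Int.one_le_abs hi
  exact_mod_cast this

lemma bracket_add_le (ξ η : Freq d) : bracket (ξ + η) ≤ bracket ξ + bracket η := by
  refine max_le ?_ ((euclLen_add_le ξ η).trans
    (add_le_add (euclLen_le_bracket _) (euclLen_le_bracket _)))
  linarith [one_le_bracket ξ, one_le_bracket η]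

/-- The larger of ⟨ξ−η⟩ and ⟨η⟩ is at least ⟨ξ⟩/2. In a convolution the weight can therefore be
charged to one of the two factors. -/
lemma bracket_rpow_sub_le {σ : ℝ} (hσ : 0 ≤ σ) (ξ η : Freq d) :
    bracket ξ ^ σ ≤ 2 ^ σ * (bracket (ξ - η) ^ σ + bracket η ^ σ) := by
  have h1 : bracket ξ ≤ 2 * max (bracket (ξ - η)) (bracket η) := by
    have := bracket_add_le (ξ - η) η
    rw [sub_add_cancel] at this
    linarith [le_max_left (bracket (ξ - η)) (bracket η), le_max_right (bracket (ξ - η)) (bracket η)]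
  have p1 := Real.rpow_nonneg (bracket_pos (ξ - η)).le σ
  have p2 := Real.rpow_nonneg (bracket_pos η).le σ
  calc bracket ξ ^ σ ≤ (2 * max (bracket (ξ - η)) (bracket η)) ^ σ :=
        Real.rpow_le_rpow (bracket_pos ξ).le h1 hσ
    _ = 2 ^ σ * (max (bracket (ξ - η)) (bracket η)) ^ σ :=
        Real.mul_rpow (by norm_num) (le_max_of_le_left (bracket_pos _).le)
    _ ≤ _ := by
        gcongr
        rcases max_choice (bracket (ξ - η)) (bracket η) with h | h <;> rw [h] <;> linarith

/-- The weight `⟨ξ⟩^σ`. -/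
def wt (σ : ℝ) (ξ : Freq d) : ℝ≥0∞ := ENNReal.ofReal (bracket ξ ^ σ)

lemma wt_ne_top (σ : ℝ) (ξ : Freq d) : wt σ ξ ≠ ⊤ := ENNReal.ofReal_ne_top

lemma wt_add (σ τ : ℝ) (ξ : Freq d) : wt (σ + τ) ξ = wt σ ξ * wt τ ξ := by
  rw [wt, Real.rpow_add (bracket_pos ξ), ENNReal.ofReal_mul (Real.rpow_nonneg (bracket_pos ξ).le _)]
  rfl

lemma wt_zero (ξ : Freq d) : wt 0 ξ = 1 := by simp [wt]

lemma wt_mono {σ τ : ℝ} (h : σ ≤ τ) (ξ : Freq d) : wt σ ξ ≤ wt τ ξ :=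
  ENNReal.ofReal_le_ofReal (Real.rpow_le_rpow_of_exponent_le (one_le_bracket ξ) h)

lemma wt_sub_le {σ : ℝ} (hσ : 0 ≤ σ) (ξ η : Freq d) :
    wt σ ξ ≤ ENNReal.ofReal (2 ^ σ) * (wt σ (ξ - η) + wt σ η) := by
  have p1 := Real.rpow_nonneg (bracket_pos (ξ - η)).le σ
  have p2 := Real.rpow_nonneg (bracket_pos η).le σ
  rw [wt, wt, wt, ← ENNReal.ofReal_add p1 p2, ← ENNReal.ofReal_mul (by positivity)]
  exact ENNReal.ofReal_le_ofReal (bracket_rpow_sub_le hσ ξ η)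

lemma wt_neg_mul (σ : ℝ) (ξ : Freq d) : wt (-σ) ξ * wt σ ξ = 1 := by
  rw [← wt_add, neg_add_cancel, wt_zero]

lemma enorm_coord_le (ξ : Freq d) (j : Fin d) : ‖((ξ j : ℤ) : ℂ)‖ₑ ≤ wt 1 ξ := by
  rw [wt, Real.rpow_one, ← ofReal_norm, Complex.norm_intCast]
  exact ENNReal.ofReal_le_ofReal ((abs_le_euclLen ξ j).trans (euclLen_le_bracket ξ))

/-- The weights `⟨ξ⟩^{-σ}` are square summable for `σ > d / 2`. -/
lemma ellTwo_wt_lt_top {σ : ℝ} (hσ : (d : ℝ) / 2 < σ) :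
    ellTwo (fun ξ : Freq d => wt (-σ) ξ) < ⊤ := by
  refine ENNReal.rpow_lt_top_of_nonneg (by norm_num) (ne_of_lt ?_)
  have key : Summable fun ξ : Freq d => bracket ξ ^ (-(2 * σ)) := by
    -- Comparison with the lattice ℤ^d in ℝ^d, where powers of the norm below minus the rank are
    -- summable; the sup norm of ξ is at most ⟨ξ⟩.
    let b := (Pi.basisFun ℝ (Fin d))
    let L : Submodule ℤ (Fin d → ℝ) := Submodule.span ℤ (Set.range b)
    have hr : -(2 * σ) < -(Module.finrank ℤ L : ℝ) := by
      have : Module.finrank ℤ L = d := by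
        rw [ZLattice.rank ℝ L]; simp
      rw [this]; linarith
    have h1 := ZLattice.summable_norm_rpow L (-(2 * σ)) hr
    let φ : Freq d → L := fun ξ => ⟨fun i => (ξ i : ℝ), by
      rw [Module.Basis.mem_span_iff_repr_mem]
      intro i
      simp [b]⟩
    have hφ : Function.Injective φ := by
      intro ξ η h
      ext i
      have : (ξ i : ℝ) = η i := congrFun (congrArg Subtype.val h) i
      exact_mod_cast this
    have h2 := h1.comp_injective hφ
    -- At the origin the norm is zero while the bracket is 1, so the comparison of powers is made on
    -- the complement of this point.
    rw [← Finset.summable_compl_iff {(0 : Freq d)}] at h2 ⊢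
    refine Summable.of_nonneg_of_le (fun _ => Real.rpow_nonneg (bracket_pos _).le _) ?_ h2
    rintro ⟨ξ, hξ⟩
    have hξ0 : ξ ≠ 0 := by simpa using hξ
    have hpos : 0 < ‖φ ξ‖ := by
      rw [norm_pos_iff]
      intro h
      apply hξ0
      apply hφ
      rw [h]
      ext i
      simp [φ]
    refine Real.rpow_le_rpow_of_nonpos hpos ?_ (by have := Nat.cast_nonneg (α := ℝ) d; linarith)
    change ‖(fun i => (ξ i : ℝ))‖ ≤ _
    rw [pi_norm_le_iff_of_nonneg (bracket_pos _).le]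
    exact fun i => (abs_le_euclLen ξ i).trans (euclLen_le_bracket ξ)
  have h3 : ∀ ξ : Freq d, wt (-σ) ξ ^ 2 = ENNReal.ofReal (bracket ξ ^ (-(2 * σ))) := by
    intro ξ
    rw [sq, ← wt_add, wt]
    ring_nf
  simp only [h3]
  rw [← ENNReal.ofReal_tsum_of_nonneg (fun _ => Real.rpow_nonneg (bracket_pos _).le _) key]
  exact ENNReal.ofReal_lt_top

end weights

/-! ### Sobolev norms of sequences of Fourier coefficients -/

section seq

variable {d n : ℕ} {σ τ : ℝ}

/-- The `H^σ` norm of a sequence of Fourier coefficients. -/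
def hs (σ : ℝ) (c : Freq d → ℂ) : ℝ≥0∞ := ellTwo fun ξ => wt σ ξ * ‖c ξ‖ₑ

/-- The `H^σ` norm of a vector of sequences of Fourier coefficients. -/
def hsv (σ : ℝ) (a : Fin n → Freq d → ℂ) : ℝ≥0∞ := ellTwo fun k => hs σ (a k)

lemma wt_mul_enorm_le_hs (σ : ℝ) (c : Freq d → ℂ) (ξ : Freq d) : wt σ ξ * ‖c ξ‖ₑ ≤ hs σ c :=
  le_ellTwo (fun ξ => wt σ ξ * ‖c ξ‖ₑ) ξ

lemma hs_le_hsv (σ : ℝ) (a : Fin n → Freq d → ℂ) (k : Fin n) : hs σ (a k) ≤ hsv σ a :=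
  le_ellTwo (fun k => hs σ (a k)) k

/-- Convergence in H^σ, for σ of any sign, thus implies convergence of every single coefficient;
this is how limits and derivatives in Sobolev norms are identified. -/
lemma enorm_le_hs (σ : ℝ) (c : Freq d → ℂ) (ξ : Freq d) : ‖c ξ‖ₑ ≤ wt (-σ) ξ * hs σ c := by
  rw [← one_mul ‖c ξ‖ₑ, ← wt_neg_mul σ ξ, mul_assoc]
  gcongr
  exact wt_mul_enorm_le_hs σ c ξ

lemma enorm_le_hsv (σ : ℝ) (a : Fin n → Freq d → ℂ) (k : Fin n) (ξ : Freq d) :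
    ‖a k ξ‖ₑ ≤ wt (-σ) ξ * hsv σ a :=
  (enorm_le_hs σ (a k) ξ).trans (by gcongr; exact hs_le_hsv σ a k)

lemma hsv_le_sum (σ : ℝ) (a : Fin n → Freq d → ℂ) : hsv σ a ≤ ∑ k, hs σ (a k) := ellTwo_le_sum _

lemma sum_hs_le (σ : ℝ) (a : Fin n → Freq d → ℂ) : ∑ k, hs σ (a k) ≤ n * hsv σ a := by
  calc ∑ k, hs σ (a k) ≤ ∑ _k : Fin n, hsv σ a := Finset.sum_le_sum fun k _ => hs_le_hsv σ a k
    _ = _ := by simp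

lemma hs_mono (h : σ ≤ τ) (c : Freq d → ℂ) : hs σ c ≤ hs τ c :=
  ellTwo_mono fun ξ => by gcongr; exact wt_mono h ξ

lemma hsv_mono (h : σ ≤ τ) (a : Fin n → Freq d → ℂ) : hsv σ a ≤ hsv τ a :=
  ellTwo_mono fun k => hs_mono h (a k)

lemma hs_add_le (σ : ℝ) (a b : Freq d → ℂ) : hs σ (a + b) ≤ hs σ a + hs σ b := by
  refine le_trans (ellTwo_mono fun ξ => ?_) (ellTwo_add_le _ _)
  rw [← mul_add]
  gcongr
  exact enorm_add_le _ _

lemma hsv_add_le (σ : ℝ) (a b : Fin n → Freq d → ℂ) : hsv σ (a + b) ≤ hsv σ a + hsv σ b :=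
  (ellTwo_mono fun k => hs_add_le σ (a k) (b k)).trans (ellTwo_add_le _ _)

lemma hs_smul (σ : ℝ) (r : ℂ) (a : Freq d → ℂ) : hs σ (r • a) = ‖r‖ₑ * hs σ a := by
  rw [hs, hs, ← ellTwo_const_mul]
  congr 1
  ext ξ
  rw [Pi.smul_apply, smul_eq_mul, enorm_mul, mul_left_comm]

lemma hsv_smul (σ : ℝ) (r : ℂ) (a : Fin n → Freq d → ℂ) : hsv σ (r • a) = ‖r‖ₑ * hsv σ a := by
  rw [hsv, hsv, ← ellTwo_const_mul]
  congr 1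
  ext k
  exact hs_smul σ r (a k)

lemma hsv_neg (σ : ℝ) (a : Fin n → Freq d → ℂ) : hsv σ (-a) = hsv σ a := by
  rw [← neg_one_smul ℂ, hsv_smul]; simp

lemma hsv_sub_le (σ : ℝ) (a b : Fin n → Freq d → ℂ) : hsv σ (a - b) ≤ hsv σ a + hsv σ b := by
  rw [sub_eq_add_neg, ← hsv_neg σ b]; exact hsv_add_le σ a (-b)

lemma hsv_sub_comm (σ : ℝ) (a b : Fin n → Freq d → ℂ) : hsv σ (a - b) = hsv σ (b - a) := by
  rw [← hsv_neg, neg_sub]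

lemma hsv_zero (σ : ℝ) : hsv σ (0 : Fin n → Freq d → ℂ) = 0 := by
  simpa using hsv_smul σ 0 (0 : Fin n → Freq d → ℂ)

lemma eq_zero_of_hsv_eq_zero {a : Fin n → Freq d → ℂ} (h : hsv σ a = 0) : a = 0 := by
  ext k ξ
  have := enorm_le_hsv σ a k ξ
  rw [h, mul_zero] at this
  simpa using this

lemma hs_le_of_pointwise {m : ℕ} {c : Freq d → ℂ} {a : Fin m → Freq d → ℂ} (A : ℝ≥0∞)
    (h : ∀ ξ, wt σ ξ * ‖c ξ‖ₑ ≤ A * ∑ j, wt τ ξ * ‖a j ξ‖ₑ) :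
    hs σ c ≤ A * (m * hsv τ a) := by
  calc hs σ c ≤ ellTwo (fun ξ => A * ∑ j, wt τ ξ * ‖a j ξ‖ₑ) := ellTwo_mono h
    _ = A * ellTwo (fun ξ => ∑ j, wt τ ξ * ‖a j ξ‖ₑ) := ellTwo_const_mul _ _
    _ ≤ A * ∑ j, hs τ (a j) := by gcongr; exact ellTwo_sum_le _ fun j ξ => wt τ ξ * ‖a j ξ‖ₑ
    _ ≤ _ := by gcongr; exact sum_hs_le τ a

lemma hsv_le_of_pointwise {m : ℕ} {c : Fin n → Freq d → ℂ} {a : Fin m → Freq d → ℂ} (A : ℝ≥0∞)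
    (h : ∀ k ξ, wt σ ξ * ‖c k ξ‖ₑ ≤ A * ∑ j, wt τ ξ * ‖a j ξ‖ₑ) :
    hsv σ c ≤ n * (A * (m * hsv τ a)) := by
  calc hsv σ c ≤ ∑ k, hs σ (c k) := hsv_le_sum σ c
    _ ≤ ∑ _k : Fin n, A * (m * hsv τ a) :=
        Finset.sum_le_sum fun k _ => hs_le_of_pointwise A (h k)
    _ = _ := by simp

/-! ### Convolutions and the advection term -/

/-- Convolution of sequences of Fourier coefficients. -/
def conv (a b : Freq d → ℂ) (ξ : Freq d) : ℂ := ∑' η, a (ξ - η) * b η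

/-- The constant of the algebra property of `H^σ`. -/
def algConst (d : ℕ) (σ : ℝ) : ℝ≥0∞ :=
  ENNReal.ofReal (2 ^ σ) * (2 * ellTwo (fun ξ : Freq d => wt (-σ) ξ))

lemma algConst_lt_top (hσ : (d : ℝ) / 2 < σ) : algConst d σ < ⊤ :=
  ENNReal.mul_lt_top ENNReal.ofReal_lt_top
    (ENNReal.mul_lt_top (by simp) (ellTwo_wt_lt_top hσ))

lemma tsum_enorm_le (σ : ℝ) (c : Freq d → ℂ) :
    ∑' ξ, ‖c ξ‖ₑ ≤ ellTwo (fun ξ : Freq d => wt (-σ) ξ) * hs σ c := by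
  refine le_trans (le_of_eq ?_) (tsum_mul_le_ellTwo _ _)
  congr 1
  ext ξ
  rw [← mul_assoc, wt_neg_mul, one_mul]

/-- The weight falls on either factor, Young's inequality puts the other one in ℓ¹, and
`tsum_enorm_le` bounds that ℓ¹ norm by the H^σ norm. The condition σ > d/2 serves only to make the
constant finite. -/
lemma hs_conv_le (hσ : 0 ≤ σ) (a b : Freq d → ℂ) :
    hs σ (conv a b) ≤ algConst d σ * (hs σ a * hs σ b) := by
  set K := ENNReal.ofReal (2 ^ σ) with hK
  set E := ellTwo (fun ξ : Freq d => wt (-σ) ξ) with hE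
  have h1 : ∀ ξ, wt σ ξ * ‖conv a b ξ‖ₑ ≤
      K * ((∑' η, (wt σ (ξ - η) * ‖a (ξ - η)‖ₑ) * ‖b η‖ₑ) +
        ∑' η, (wt σ (ξ - η) * ‖b (ξ - η)‖ₑ) * ‖a η‖ₑ) := by
    intro ξ
    have h2 : ∑' η, (wt σ (ξ - η) * ‖b (ξ - η)‖ₑ) * ‖a η‖ₑ =
        ∑' η, ‖a (ξ - η)‖ₑ * (wt σ η * ‖b η‖ₑ) := by
      rw [← (Equiv.subLeft ξ).tsum_eq]
      simp [mul_comm]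
    rw [h2, ← ENNReal.tsum_add, ← ENNReal.tsum_mul_left]
    calc wt σ ξ * ‖conv a b ξ‖ₑ ≤ wt σ ξ * ∑' η, ‖a (ξ - η) * b η‖ₑ := by
          gcongr
          exact enorm_tsum_le_tsum_enorm
      _ = ∑' η, wt σ ξ * (‖a (ξ - η)‖ₑ * ‖b η‖ₑ) := by
          rw [← ENNReal.tsum_mul_left]; simp only [enorm_mul]
      _ ≤ _ := by
          refine ENNReal.tsum_le_tsum fun η => ?_
          calc wt σ ξ * (‖a (ξ - η)‖ₑ * ‖b η‖ₑ)
              ≤ (K * (wt σ (ξ - η) + wt σ η)) * (‖a (ξ - η)‖ₑ * ‖b η‖ₑ) := by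
                gcongr; exact wt_sub_le hσ ξ η
            _ = _ := by ring
  calc hs σ (conv a b) ≤ _ := ellTwo_mono h1
    _ ≤ K * (hs σ a * (E * hs σ b) + hs σ b * (E * hs σ a)) := by
        rw [ellTwo_const_mul]
        gcongr
        refine (ellTwo_add_le _ _).trans ?_
        gcongr
        · refine (ellTwo_conv_le (fun ξ => wt σ ξ * ‖a ξ‖ₑ) (fun ξ => ‖b ξ‖ₑ)).trans ?_
          gcongr
          · exact le_rfl
          · exact tsum_enorm_le σ b
        · refine (ellTwo_conv_le (fun ξ => wt σ ξ * ‖b ξ‖ₑ) (fun ξ => ‖a ξ‖ₑ)).trans ?_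
          gcongr
          · exact le_rfl
          · exact tsum_enorm_le σ a
    _ = algConst d σ * (hs σ a * hs σ b) := by rw [algConst]; ring

/-- A divergent `tsum` has the default value 0, so `conv` is additive only where its series
converge. Cauchy–Schwarz provides this for square summable factors. -/
lemma summable_conv {a b : Freq d → ℂ} (ha : hs 0 a < ⊤) (hb : hs 0 b < ⊤) (ξ : Freq d) :
    Summable fun η => a (ξ - η) * b η := by
  refine Summable.of_enorm ?_
  have h := tsum_mul_le_ellTwo (fun η => ‖a (ξ - η)‖ₑ) (fun η => ‖b η‖ₑ)
  have h1 : ellTwo (fun η => ‖a (ξ - η)‖ₑ) = hs 0 a := by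
    simp only [hs, ellTwo, wt_zero, one_mul]
    exact congrArg (· ^ (1 / 2 : ℝ)) ((Equiv.subLeft ξ).tsum_eq (fun η => ‖a η‖ₑ ^ 2))
  have h2 : ellTwo (fun η => ‖b η‖ₑ) = hs 0 b := by simp only [hs, wt_zero, one_mul]
  rw [h1, h2] at h
  simp only [enorm_mul]
  exact (h.trans_lt (ENNReal.mul_lt_top ha hb)).ne

/-- The Fourier coefficients of `∂u/∂x_j`. -/
def dcoef (j : Fin d) (c : Freq d → ℂ) (ξ : Freq d) : ℂ := Complex.I * (ξ j : ℂ) * c ξ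

lemma hs_dcoef_le (σ : ℝ) (j : Fin d) (c : Freq d → ℂ) : hs σ (dcoef j c) ≤ hs (σ + 1) c := by
  refine ellTwo_mono fun ξ => ?_
  have hI : ‖Complex.I‖ₑ = 1 := by rw [← ofReal_norm, Complex.norm_I, ENNReal.ofReal_one]
  rw [dcoef, enorm_mul, enorm_mul, hI, one_mul, wt_add, mul_assoc]
  gcongr
  exact enorm_coord_le ξ j

lemma dcoef_sub (j : Fin d) (a b : Freq d → ℂ) : dcoef j (a - b) = dcoef j a - dcoef j b := by
  ext ξ; simp only [dcoef, Pi.sub_apply]; ring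

/-- The Fourier coefficients of `a · ∇b`. -/
def adv (a : Fin d → Freq d → ℂ) (b : Fin n → Freq d → ℂ) (k : Fin n) (ξ : Freq d) : ℂ :=
  ∑ j, conv (a j) (dcoef j (b k)) ξ

/-- The constant of the estimate of the advection term. -/
def advConst (d n : ℕ) (σ : ℝ) : ℝ≥0∞ := n * (d * algConst d σ)

lemma advConst_lt_top (hσ : (d : ℝ) / 2 < σ) : advConst d n σ < ⊤ :=
  ENNReal.mul_lt_top (by simp) (ENNReal.mul_lt_top (by simp) (algConst_lt_top hσ))

/-- Algebra property of H^σ; one derivative is lost, on the advected field alone. `hsv_duh_le` gains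
exactly this derivative back. -/
lemma hsv_adv_le (hσ : 0 ≤ σ) (a : Fin d → Freq d → ℂ) (b : Fin n → Freq d → ℂ) :
    hsv σ (adv a b) ≤ advConst d n σ * (hsv σ a * hsv (σ + 1) b) := by
  have h1 : ∀ k, hs σ (adv a b k) ≤ d * (algConst d σ * (hsv σ a * hsv (σ + 1) b)) := by
    intro k
    calc hs σ (adv a b k) ≤ ∑ j, hs σ (conv (a j) (dcoef j (b k))) := by
          refine le_trans (ellTwo_mono fun ξ => ?_)
            (ellTwo_sum_le _ fun j ξ => wt σ ξ * ‖conv (a j) (dcoef j (b k)) ξ‖ₑ)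
          rw [← Finset.mul_sum]
          gcongr
          exact enorm_sum_le _ _
      _ ≤ ∑ _j : Fin d, algConst d σ * (hsv σ a * hsv (σ + 1) b) := by
          refine Finset.sum_le_sum fun j _ => (hs_conv_le hσ _ _).trans ?_
          gcongr
          · exact hs_le_hsv σ a j
          · exact (hs_dcoef_le σ j _).trans (hs_le_hsv _ b k)
      _ = _ := by simp
  calc hsv σ (adv a b) ≤ ∑ k, hs σ (adv a b k) := hsv_le_sum _ _
    _ ≤ ∑ _k : Fin n, d * (algConst d σ * (hsv σ a * hsv (σ + 1) b)) :=
        Finset.sum_le_sum fun k _ => h1 k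
    _ = _ := by simp [advConst, mul_assoc]

lemma hs_zero_dcoef_lt_top {c : Freq d → ℂ} (h : hs 1 c < ⊤) (j : Fin d) :
    hs 0 (dcoef j c) < ⊤ :=
  (hs_dcoef_le 0 j c).trans_lt (by rwa [zero_add])

lemma adv_self_sub_adv_self {a b : Fin d → Freq d → ℂ} (ha : hsv 1 a < ⊤) (hb : hsv 1 b < ⊤) :
    adv a a - adv b b = adv a (a - b) + adv (a - b) b := by
  have h0 : ∀ {c : Fin d → Freq d → ℂ} (_ : hsv 1 c < ⊤) j, hs 0 (c j) < ⊤ := fun h j =>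
    ((hs_mono zero_le_one _).trans (hs_le_hsv 1 _ j)).trans_lt h
  have h1 : ∀ {c : Fin d → Freq d → ℂ} (_ : hsv 1 c < ⊤) k j, hs 0 (dcoef j (c k)) < ⊤ :=
    fun h k j => hs_zero_dcoef_lt_top ((hs_le_hsv 1 _ k).trans_lt h) j
  ext k ξ
  simp only [Pi.sub_apply, Pi.add_apply, adv, ← Finset.sum_sub_distrib, ← Finset.sum_add_distrib]
  refine Finset.sum_congr rfl fun j _ => ?_
  have s1 := summable_conv (h0 ha j) (h1 ha k j) ξ
  have s2 := summable_conv (h0 ha j) (h1 hb k j) ξ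
  have s3 := summable_conv (h0 hb j) (h1 hb k j) ξ
  rw [dcoef_sub]
  simp only [conv, Pi.sub_apply, mul_sub, sub_mul]
  rw [s1.tsum_sub s2, s2.tsum_sub s3]
  ring

lemma hsv_adv_self_sub_le (hσ : 0 ≤ σ) {a b : Fin d → Freq d → ℂ}
    (ha : hsv (σ + 1) a < ⊤) (hb : hsv (σ + 1) b < ⊤) :
    hsv σ (adv a a - adv b b) ≤
      advConst d d σ * ((hsv (σ + 1) a + hsv (σ + 1) b) * hsv (σ + 1) (a - b)) := by
  rw [adv_self_sub_adv_self ((hsv_mono (by linarith) a).trans_lt ha)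
    ((hsv_mono (by linarith) b).trans_lt hb)]
  refine (hsv_add_le _ _ _).trans ?_
  have e1 := hsv_adv_le hσ a (a - b)
  have e2 := hsv_adv_le hσ (a - b) b
  have m1 : hsv σ a ≤ hsv (σ + 1) a := hsv_mono (by linarith) a
  have m2 : hsv σ (a - b) ≤ hsv (σ + 1) (a - b) := hsv_mono (by linarith) _
  calc _ ≤ advConst d d σ * (hsv (σ + 1) a * hsv (σ + 1) (a - b)) +
        advConst d d σ * (hsv (σ + 1) (a - b) * hsv (σ + 1) b) := by
        refine add_le_add (e1.trans ?_) (e2.trans ?_) <;> gcongr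
    _ = _ := by ring

/-- The mean of `a · ∇b` vanishes when `a` is divergence free. -/
lemma adv_zero_freq {a : Fin d → Freq d → ℂ} {b : Fin n → Freq d → ℂ}
    (ha : hsv 0 a < ⊤) (hb : hsv 1 b < ⊤)
    (hdiv : ∀ ξ : Freq d, ∑ j, Complex.I * (ξ j : ℂ) * a j ξ = 0) (k : Fin n) :
    adv a b k 0 = 0 := by
  have s : ∀ j, Summable fun η => a j (0 - η) * dcoef j (b k) η := fun j =>
    summable_conv ((hs_le_hsv 0 _ j).trans_lt ha)
      (hs_zero_dcoef_lt_top ((hs_le_hsv 1 _ k).trans_lt hb) j) 0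
  simp only [adv, conv]
  rw [← Summable.tsum_finsetSum fun j _ => s j]
  convert tsum_zero with η
  have h := hdiv (0 - η)
  -- The two frequencies add up to zero, so the factor η_j of the derivative equals minus the
  -- frequency of a: integration by parts moves the derivative onto a, where it forms the
  -- divergence.
  calc ∑ j, a j (0 - η) * dcoef j (b k) η
      = -(∑ j, Complex.I * ((0 - η) j : ℂ) * a j (0 - η)) * b k η := by
        rw [← Finset.sum_neg_distrib, Finset.sum_mul]
        refine Finset.sum_congr rfl fun j _ => ?_
        simp only [dcoef, Pi.sub_apply, Pi.zero_apply]
        push_cast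
        ring
    _ = 0 := by rw [h]; simp

/-! ### The Leray projection and the pressure -/

/-- The Leray projection on divergence free fields of zero average. -/
def leray (a : Fin d → Freq d → ℂ) (k : Fin d) (ξ : Freq d) : ℂ :=
  if ξ = 0 then 0
  else a k ξ - (ξ k : ℂ) * (∑ j, (ξ j : ℂ) * a j ξ) / ((euclLen ξ ^ 2 : ℝ) : ℂ)

/-- The pressure which balances the field `a` in the Navier-Stokes equation. -/
def pres (a : Fin d → Freq d → ℂ) (ξ : Freq d) : ℂ :=
  if ξ = 0 then 0 else Complex.I * (∑ j, (ξ j : ℂ) * a j ξ) / ((euclLen ξ ^ 2 : ℝ) : ℂ)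

lemma norm_coord_le_euclLen (ξ : Freq d) (j : Fin d) : ‖((ξ j : ℤ) : ℂ)‖ ≤ euclLen ξ := by
  rw [Complex.norm_intCast]; exact abs_le_euclLen ξ j

lemma euclLen_pos {ξ : Freq d} (h : ξ ≠ 0) : 0 < euclLen ξ := by
  rw [← bracket_eq_euclLen h]; exact bracket_pos ξ

lemma norm_sum_coord_mul_le (a : Fin d → Freq d → ℂ) (ξ : Freq d) :
    ‖∑ j, (ξ j : ℂ) * a j ξ‖ ≤ euclLen ξ * ∑ j, ‖a j ξ‖ := by
  rw [Finset.mul_sum]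
  refine norm_sum_le_of_le _ fun j _ => ?_
  rw [norm_mul]
  gcongr
  exact norm_coord_le_euclLen ξ j

lemma norm_leray_le (a : Fin d → Freq d → ℂ) (k : Fin d) (ξ : Freq d) :
    ‖leray a k ξ‖ ≤ 2 * ∑ j, ‖a j ξ‖ := by
  have h0 : 0 ≤ ∑ j, ‖a j ξ‖ := Finset.sum_nonneg fun _ _ => norm_nonneg _
  rw [leray]
  split_ifs with h
  · simpa using h0
  have hp := euclLen_pos h
  have h1 : ‖a k ξ‖ ≤ ∑ j, ‖a j ξ‖ :=
    Finset.single_le_sum (f := fun j => ‖a j ξ‖) (fun _ _ => norm_nonneg _) (Finset.mem_univ k)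
  have h2 : ‖(ξ k : ℂ) * (∑ j, (ξ j : ℂ) * a j ξ) / ((euclLen ξ ^ 2 : ℝ) : ℂ)‖
      ≤ ∑ j, ‖a j ξ‖ := by
    rw [norm_div, norm_mul, Complex.norm_real, Real.norm_of_nonneg (by positivity),
      div_le_iff₀ (by positivity)]
    calc _ ≤ euclLen ξ * (euclLen ξ * ∑ j, ‖a j ξ‖) := by
          gcongr
          · exact norm_coord_le_euclLen ξ k
          · exact norm_sum_coord_mul_le a ξ
      _ = _ := by ring
  linarith [norm_sub_le (a k ξ) ((ξ k : ℂ) * (∑ j, (ξ j : ℂ) * a j ξ) / ((euclLen ξ ^ 2 : ℝ) : ℂ))]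

/-- The multiplier ξ/|ξ|² has size 1/|ξ|, and |ξ| = ⟨ξ⟩ off the origin. Hence the pressure is one
derivative better than the field it balances. -/
lemma norm_pres_le (a : Fin d → Freq d → ℂ) (ξ : Freq d) :
    bracket ξ * ‖pres a ξ‖ ≤ ∑ j, ‖a j ξ‖ := by
  have h0 : 0 ≤ ∑ j, ‖a j ξ‖ := Finset.sum_nonneg fun _ _ => norm_nonneg _
  rw [pres]
  split_ifs with h
  · simpa using h0
  have hp := euclLen_pos h
  rw [bracket_eq_euclLen h, norm_div, norm_mul, Complex.norm_I, one_mul, Complex.norm_real,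
    Real.norm_of_nonneg (by positivity), ← mul_div_assoc, div_le_iff₀ (by positivity)]
  calc _ ≤ euclLen ξ * (euclLen ξ * ∑ j, ‖a j ξ‖) := by
        gcongr
        exact norm_sum_coord_mul_le a ξ
    _ = _ := by ring

lemma ofReal_sum_norm (a : Fin n → Freq d → ℂ) (ξ : Freq d) :
    ENNReal.ofReal (∑ j, ‖a j ξ‖) = ∑ j, ‖a j ξ‖ₑ := by
  rw [ENNReal.ofReal_sum_of_nonneg fun _ _ => norm_nonneg _]
  simp only [ofReal_norm]

/-- The constant of the estimate of the Leray projection. -/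
def lerayConst (d : ℕ) : ℝ≥0∞ := d * (2 * d)

lemma lerayConst_lt_top : lerayConst d < ⊤ :=
  ENNReal.mul_lt_top (by simp) (ENNReal.mul_lt_top (by simp) (by simp))

lemma hsv_leray_le (σ : ℝ) (a : Fin d → Freq d → ℂ) :
    hsv σ (leray a) ≤ lerayConst d * hsv σ a := by
  refine (hsv_le_of_pointwise (τ := σ) (a := a) 2 fun k ξ => ?_).trans_eq
    (by rw [lerayConst]; ring)
  rw [← Finset.mul_sum, ← ofReal_sum_norm, mul_left_comm]
  gcongr
  rw [← ofReal_norm]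
  refine (ENNReal.ofReal_le_ofReal (norm_leray_le a k ξ)).trans_eq ?_
  rw [ENNReal.ofReal_mul (by norm_num)]
  simp

lemma hs_pres_le (σ : ℝ) (a : Fin d → Freq d → ℂ) :
    hs (σ + 1) (pres a) ≤ d * hsv σ a := by
  refine (hs_le_of_pointwise (τ := σ) (a := a) 1 fun ξ => ?_).trans_eq (one_mul _)
  rw [one_mul, ← Finset.mul_sum, ← ofReal_sum_norm, wt_add, mul_assoc]
  gcongr
  rw [wt, Real.rpow_one, ← ofReal_norm, ← ENNReal.ofReal_mul (bracket_pos ξ).le]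
  exact ENNReal.ofReal_le_ofReal (norm_pres_le a ξ)

lemma leray_sub (a b : Fin d → Freq d → ℂ) : leray (a - b) = leray a - leray b := by
  ext k ξ
  simp only [leray, Pi.sub_apply]
  split_ifs
  · simp
  · simp only [mul_sub, Finset.sum_sub_distrib]
    ring

lemma leray_smul (r : ℂ) (a : Fin d → Freq d → ℂ) : leray (r • a) = r • leray a := by
  ext k ξ
  simp only [leray, Pi.smul_apply, smul_eq_mul]
  split_ifs
  · simp
  · simp only [mul_left_comm _ r, ← Finset.mul_sum]
    ring

lemma pres_sub (a b : Fin d → Freq d → ℂ) : pres (a - b) = pres a - pres b := by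
  ext ξ
  simp only [pres, Pi.sub_apply]
  split_ifs
  · simp
  · simp only [mul_sub, Finset.sum_sub_distrib]
    ring

lemma leray_zero_freq (a : Fin d → Freq d → ℂ) (k : Fin d) : leray a k 0 = 0 := if_pos rfl

lemma sum_coord_mul_coord (ξ : Freq d) :
    ∑ j, (ξ j : ℂ) * (ξ j : ℂ) = ((euclLen ξ ^ 2 : ℝ) : ℂ) := by
  rw [euclLen_sq]; push_cast; simp only [sq]

lemma sum_coord_mul_leray (a : Fin d → Freq d → ℂ) (ξ : Freq d) :
    ∑ j, (ξ j : ℂ) * leray a j ξ = 0 := by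
  simp only [leray]
  split_ifs with h
  · simp
  have hp : ((euclLen ξ ^ 2 : ℝ) : ℂ) ≠ 0 := by
    have := euclLen_pos h
    exact_mod_cast (by positivity : euclLen ξ ^ 2 ≠ 0)
  simp only [mul_sub, Finset.sum_sub_distrib]
  have : ∀ i, (ξ i : ℂ) * ((ξ i : ℂ) * (∑ j, (ξ j : ℂ) * a j ξ) / ((euclLen ξ ^ 2 : ℝ) : ℂ)) =
      ((ξ i : ℂ) * (ξ i : ℂ)) * ((∑ j, (ξ j : ℂ) * a j ξ) / ((euclLen ξ ^ 2 : ℝ) : ℂ)) := by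
    intro i; ring
  simp only [this]
  rw [← Finset.sum_mul, sum_coord_mul_coord, mul_div_cancel₀ _ hp, sub_self]

/-- The Fourier coefficients of `-Δu`. -/
def negLap (a : Fin n → Freq d → ℂ) (k : Fin n) (ξ : Freq d) : ℂ :=
  ((euclLen ξ ^ 2 : ℝ) : ℂ) * a k ξ

lemma negLap_sub (a b : Fin n → Freq d → ℂ) : negLap (a - b) = negLap a - negLap b := by
  ext k ξ; simp only [negLap, Pi.sub_apply]; ring

lemma hsv_negLap_le (σ : ℝ) (a : Fin n → Freq d → ℂ) : hsv σ (negLap a) ≤ hsv (σ + 2) a := by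
  refine ellTwo_mono fun k => ellTwo_mono fun ξ => ?_
  rw [negLap, enorm_mul, wt_add, mul_assoc]
  gcongr
  rw [wt, ← ofReal_norm, Complex.norm_real, Real.norm_of_nonneg (by positivity), Real.rpow_two]
  gcongr
  · exact euclLen_nonneg ξ
  · exact euclLen_le_bracket ξ

/-! ### Hermitian symmetry -/

/-- The coefficients of a real valued function. -/
def Herm (c : Freq d → ℂ) : Prop := ∀ ξ, c (-ξ) = star (c ξ)

lemma Herm.sub {a b : Freq d → ℂ} (ha : Herm a) (hb : Herm b) : Herm (a - b) := fun ξ => by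
  simp [ha ξ, hb ξ]

lemma Herm.add {a b : Freq d → ℂ} (ha : Herm a) (hb : Herm b) : Herm (a + b) := fun ξ => by
  simp [ha ξ, hb ξ]

lemma Herm.conv {a b : Freq d → ℂ} (ha : Herm a) (hb : Herm b) : Herm (conv a b) := fun ξ => by
  simp only [NSTorus.conv]
  rw [tsum_star, ← (Equiv.neg (Freq d)).tsum_eq]
  congr 1
  ext η
  rw [Equiv.neg_apply, star_mul', ← ha, ← hb]
  congr 2
  abel

lemma Herm.dcoef {a : Freq d → ℂ} (ha : Herm a) (j : Fin d) : Herm (dcoef j a) := fun ξ => by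
  simp [NSTorus.dcoef, ha ξ]

lemma Herm.adv {a : Fin d → Freq d → ℂ} {b : Fin n → Freq d → ℂ} (ha : ∀ j, Herm (a j))
    (hb : ∀ k, Herm (b k)) (k : Fin n) : Herm (adv a b k) := fun ξ => by
  simp only [NSTorus.adv, star_sum]
  exact Finset.sum_congr rfl fun j _ => ((ha j).conv ((hb k).dcoef j)) ξ

lemma Herm.leray {a : Fin d → Freq d → ℂ} (ha : ∀ j, Herm (a j)) (k : Fin d) :
    Herm (leray a k) := fun ξ => by
  simp only [NSTorus.leray, neg_eq_zero]
  split_ifs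
  · simp
  · simp [ha _ ξ, euclLen_neg]

lemma Herm.pres {a : Fin d → Freq d → ℂ} (ha : ∀ j, Herm (a j)) : Herm (pres a) := fun ξ => by
  simp only [NSTorus.pres, neg_eq_zero]
  split_ifs
  · simp
  · simp [ha _ ξ, euclLen_neg]

lemma Herm.negLap {a : Fin n → Freq d → ℂ} (ha : ∀ j, Herm (a j)) (k : Fin n) :
    Herm (negLap a k) := fun ξ => by
  simp [NSTorus.negLap, ha _ ξ, euclLen_neg]

lemma Herm.ofReal_smul {a : Freq d → ℂ} (ha : Herm a) (r : ℝ) : Herm ((r : ℂ) • a) := fun ξ => by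
  simp [ha ξ]

end seq

section duhamel

variable {d n : ℕ} {σ τ : ℝ}

lemma hsv_sq (σ : ℝ) (a : Fin n → Freq d → ℂ) :
    hsv σ a ^ 2 = ∑ k, ∑' ξ, (wt σ ξ * ‖a k ξ‖ₑ) ^ 2 := by
  rw [hsv, ellTwo_sq, tsum_fintype]
  simp only [hs, ellTwo_sq]

/-! ### Integrals depending on a parameter -/

/-- Tonelli: since the weight W does not depend on the frequency, the squared bounds can be summed
under the integral. Serves both the Duhamel estimate (σ one above τ) and the difference quotients (σ
= τ). -/
lemma hsv_sq_le_lintegral {ρ : Measure ℝ} {a : Fin n → Freq d → ℂ}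
    {g : ℝ → Fin n → Freq d → ℂ} (hg : ∀ k ξ, Continuous fun r => g r k ξ)
    {W : ℝ → ℝ≥0∞} (hW : Measurable W)
    (h : ∀ k ξ, (wt σ ξ * ‖a k ξ‖ₑ) ^ 2 ≤ ∫⁻ r, W r * (wt τ ξ * ‖g r k ξ‖ₑ) ^ 2 ∂ρ) :
    hsv σ a ^ 2 ≤ ∫⁻ r, W r * hsv τ (g r) ^ 2 ∂ρ := by
  have hm : ∀ k ξ, Measurable fun r => W r * (wt τ ξ * ‖g r k ξ‖ₑ) ^ 2 := fun k ξ =>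
    hW.mul (((hg k ξ).measurable.enorm.const_mul _).pow_const 2)
  have hsum : ∀ k, Measurable fun r => ∑' ξ, W r * (wt τ ξ * ‖g r k ξ‖ₑ) ^ 2 := fun k =>
    Measurable.tsum (hm k)
  calc hsv σ a ^ 2 ≤ ∑ k, ∑' ξ, ∫⁻ r, W r * (wt τ ξ * ‖g r k ξ‖ₑ) ^ 2 ∂ρ := by
        rw [hsv_sq]
        exact Finset.sum_le_sum fun k _ => ENNReal.tsum_le_tsum fun ξ => h k ξ
    _ = ∫⁻ r, ∑ k, ∑' ξ, W r * (wt τ ξ * ‖g r k ξ‖ₑ) ^ 2 ∂ρ := by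
        rw [lintegral_finsetSum _ fun k _ => hsum k]
        exact Finset.sum_congr rfl fun k _ =>
          (lintegral_tsum fun ξ => (hm k ξ).aemeasurable).symm
    _ = _ := by simp only [hsv_sq, Finset.mul_sum, ENNReal.tsum_mul_left]

/-- Cauchy–Schwarz for the functions 1 and G with respect to the measure W dρ. -/
lemma sq_lintegral_mul_le {ρ : Measure ℝ} {W G : ℝ → ℝ≥0∞} (hW : Measurable W)
    (hG : Measurable G) :
    (∫⁻ r, W r * G r ∂ρ) ^ 2 ≤ (∫⁻ r, W r ∂ρ) * ∫⁻ r, W r * G r ^ 2 ∂ρ := by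
  have h := ENNReal.lintegral_mul_le_Lp_mul_Lq ρ Real.HolderConjugate.two_two
    (f := fun r => W r ^ (1 / 2 : ℝ)) (g := fun r => W r ^ (1 / 2 : ℝ) * G r)
    (hW.pow_const _).aemeasurable ((hW.pow_const _).mul hG).aemeasurable
  have e : ∀ r, W r ^ (1 / 2 : ℝ) * (W r ^ (1 / 2 : ℝ) * G r) = W r * G r := fun r => by
    rw [← mul_assoc, ← sq, sqrt_sq_ennreal]
  simp only [Pi.mul_apply, e, ENNReal.rpow_two, mul_pow, sqrt_sq_ennreal] at h
  calc _ ≤ _ := pow_le_pow_left' h 2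
    _ = _ := by rw [mul_pow, sqrt_sq_ennreal, sqrt_sq_ennreal]

lemma lintegral_exp_kernel_le {m : ℝ} (hm : 0 < m) {t : ℝ} (ht : 0 ≤ t) :
    ∫⁻ r in Set.Ioc 0 t, ENNReal.ofReal (Real.exp (-(m * (t - r)))) ≤ ENNReal.ofReal (1 / m) := by
  have hc : Continuous fun r => Real.exp (-(m * (t - r))) := by fun_prop
  rw [← ofReal_integral_eq_lintegral_ofReal (hc.integrableOn_Ioc)
    (Eventually.of_forall fun r => (Real.exp_pos _).le)]
  apply ENNReal.ofReal_le_ofReal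
  rw [← intervalIntegral.integral_of_le ht]
  have hd : ∀ r ∈ Set.uIcc 0 t, HasDerivAt (fun r => Real.exp (-(m * (t - r))) / m)
      (Real.exp (-(m * (t - r)))) r := by
    intro r _
    have : HasDerivAt (fun r : ℝ => -(m * (t - r))) m r := by
      have := (((hasDerivAt_id' r).const_sub t).const_mul m).neg
      rwa [mul_neg_one, neg_neg] at this
    have := this.exp.div_const m
    rwa [mul_div_cancel_right₀ _ hm.ne'] at this
  rw [intervalIntegral.integral_eq_sub_of_hasDerivAt hd (hc.intervalIntegrable _ _)]
  have : 0 < Real.exp (-(m * (t - 0))) / m := by positivity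
  simp only [sub_self, mul_zero, neg_zero, Real.exp_zero]
  linarith

lemma measurable_exp_kernel (m t : ℝ) :
    Measurable fun r => ENNReal.ofReal (Real.exp (-(m * (t - r)))) :=
  (Continuous.measurable (by fun_prop)).ennreal_ofReal

/-! ### The Duhamel integral -/

/-- The solution of `D_ξ' = -μ_ξ D_ξ + g_ξ`, `D_ξ(0) = 0`. -/
def duh (μ : Freq d → ℝ) (g : ℝ → Fin n → Freq d → ℂ) (t : ℝ) (k : Fin n) (ξ : Freq d) : ℂ :=
  ∫ r in (0 : ℝ)..t, (Real.exp (-(μ ξ * (t - r))) : ℂ) * g r k ξ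

variable {μ : Freq d → ℝ} {g : ℝ → Fin n → Freq d → ℂ}

lemma continuous_duh_integrand (hg : ∀ k ξ, Continuous fun r => g r k ξ) (t : ℝ) (k : Fin n)
    (ξ : Freq d) : Continuous fun r => (Real.exp (-(μ ξ * (t - r))) : ℂ) * g r k ξ := by
  have := hg k ξ
  fun_prop

/-- The exponential kernel has mass at most 1/μ. Keeping one copy of it under the integral, instead
of bounding |g| by its supremum at each frequency, is what later permits summation over ξ. -/
lemma enorm_duh_sq_le (hg : ∀ k ξ, Continuous fun r => g r k ξ) {t : ℝ} (ht : 0 ≤ t) (k : Fin n)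
    {ξ : Freq d} (hμ : 0 < μ ξ) :
    ‖duh μ g t k ξ‖ₑ ^ 2 ≤ ENNReal.ofReal (1 / μ ξ) *
      ∫⁻ r in Set.Ioc 0 t, ENNReal.ofReal (Real.exp (-(μ ξ * (t - r)))) * ‖g r k ξ‖ₑ ^ 2 := by
  have h1 : ‖duh μ g t k ξ‖ₑ ≤
      ∫⁻ r in Set.Ioc 0 t, ENNReal.ofReal (Real.exp (-(μ ξ * (t - r)))) * ‖g r k ξ‖ₑ := by
    rw [duh, intervalIntegral.integral_of_le ht]
    refine (enorm_integral_le_lintegral_enorm _).trans_eq ?_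
    congr 1
    ext r
    rw [enorm_mul, ← ofReal_norm (Complex.ofReal _), Complex.norm_real,
      Real.norm_of_nonneg (Real.exp_pos _).le]
  refine (pow_le_pow_left' h1 2).trans ((sq_lintegral_mul_le
    (measurable_exp_kernel _ _) (hg k ξ).measurable.enorm).trans ?_)
  gcongr
  exact lintegral_exp_kernel_le hμ ht

lemma duh_zero_freq (h0 : ∀ r k, g r k 0 = 0) (t : ℝ) (k : Fin n) : duh μ g t k 0 = 0 := by
  simp [duh, h0]

lemma wt_sq_mul_ofReal_inv {κ : ℝ} (hκ : 0 < κ) (σ : ℝ) {ξ : Freq d} {x : ℝ}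
    (h : κ * bracket ξ ^ 2 ≤ x) :
    wt (σ + 1) ξ ^ 2 * ENNReal.ofReal (1 / x) ≤ ENNReal.ofReal (1 / κ) * wt σ ξ ^ 2 := by
  have hb := bracket_pos ξ
  have h1 : wt 1 ξ ^ 2 * ENNReal.ofReal (1 / x) ≤ ENNReal.ofReal (1 / κ) := by
    rw [wt, Real.rpow_one, ← ENNReal.ofReal_pow hb.le, ← ENNReal.ofReal_mul (by positivity)]
    apply ENNReal.ofReal_le_ofReal
    have hx : 0 < x := lt_of_lt_of_le (by positivity) h
    rw [mul_one_div, div_le_div_iff₀ hx hκ]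
    linarith
  calc _ = wt σ ξ ^ 2 * (wt 1 ξ ^ 2 * ENNReal.ofReal (1 / x)) := by rw [wt_add]; ring
    _ ≤ wt σ ξ ^ 2 * ENNReal.ofReal (1 / κ) := by gcongr
    _ = _ := mul_comm _ _

/-- The factor 1/μ_ξ pays for the additional weight ⟨ξ⟩², through κ; the kernel that remains is
compared with e^{-m(t−r)}, common to all frequencies. Nothing is assumed on μ at ξ = 0, where g
vanishes. -/
lemma hsv_duh_sq_le_lintegral (hg : ∀ k ξ, Continuous fun r => g r k ξ)
    (h0 : ∀ r k, g r k 0 = 0) {κ m : ℝ} (hκ : 0 < κ)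
    (hμκ : ∀ ξ ≠ 0, κ * bracket ξ ^ 2 ≤ μ ξ) (hμm : ∀ ξ ≠ 0, m ≤ μ ξ) {t : ℝ} (ht : 0 ≤ t) :
    hsv (σ + 1) (duh μ g t) ^ 2 ≤ ENNReal.ofReal (1 / κ) *
      ∫⁻ r in Set.Ioc 0 t, ENNReal.ofReal (Real.exp (-(m * (t - r)))) * hsv σ (g r) ^ 2 := by
  have hW : Measurable fun r => ENNReal.ofReal (Real.exp (-(m * (t - r)))) :=
    measurable_exp_kernel m t
  have key := hsv_sq_le_lintegral (σ := σ + 1) (τ := σ) (ρ := volume.restrict (Set.Ioc 0 t))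
    (a := duh μ g t) hg (hW.const_mul (ENNReal.ofReal (1 / κ))) ?_
  · refine key.trans_eq ?_
    rw [← lintegral_const_mul' _ _ ENNReal.ofReal_ne_top]
    simp only [mul_assoc]
  intro k ξ
  by_cases hξ : ξ = 0
  · subst hξ
    simp [duh_zero_freq h0]
  have hμ : 0 < μ ξ := lt_of_lt_of_le (by have := bracket_pos ξ; positivity) (hμκ ξ hξ)
  rw [mul_pow]
  calc _ ≤ wt (σ + 1) ξ ^ 2 * (ENNReal.ofReal (1 / μ ξ) *
      ∫⁻ r in Set.Ioc 0 t, ENNReal.ofReal (Real.exp (-(μ ξ * (t - r)))) * ‖g r k ξ‖ₑ ^ 2) := by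
        gcongr
        exact enorm_duh_sq_le hg ht k hμ
    _ ≤ (ENNReal.ofReal (1 / κ) * wt σ ξ ^ 2) *
      ∫⁻ r in Set.Ioc 0 t, ENNReal.ofReal (Real.exp (-(m * (t - r)))) * ‖g r k ξ‖ₑ ^ 2 := by
        rw [← mul_assoc]
        refine mul_le_mul' (wt_sq_mul_ofReal_inv hκ σ (hμκ ξ hξ)) ?_
        refine setLIntegral_mono' measurableSet_Ioc fun r hr => ?_
        gcongr
        · linarith [hr.2]
        · exact hμm ξ hξ
    _ = _ := by
        rw [← lintegral_const_mul' _ _ (ENNReal.mul_ne_top ENNReal.ofReal_ne_top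
          (ENNReal.pow_ne_top (wt_ne_top σ ξ)))]
        congr 1
        ext r
        ring

/-- Parabolic smoothing: the Duhamel integral gains one derivative in the supremum norm. -/
lemma hsv_duh_le (hg : ∀ k ξ, Continuous fun r => g r k ξ)
    (h0 : ∀ r k, g r k 0 = 0) {κ m θ : ℝ} (hκ : 0 < κ) (hm : 0 < m) (hθ : 0 ≤ θ)
    (hκm : 1 / κ * (1 / m) ≤ θ ^ 2)
    (hμκ : ∀ ξ ≠ 0, κ * bracket ξ ^ 2 ≤ μ ξ) (hμm : ∀ ξ ≠ 0, m ≤ μ ξ) {t : ℝ} (ht : 0 ≤ t)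
    {M : ℝ≥0∞} (hM : ∀ r, 0 ≤ r → hsv σ (g r) ≤ M) :
    hsv (σ + 1) (duh μ g t) ≤ ENNReal.ofReal θ * M := by
  apply le_of_sq_le_sq_ennreal
  have hW : Measurable fun r => ENNReal.ofReal (Real.exp (-(m * (t - r)))) :=
    measurable_exp_kernel m t
  calc _ ≤ _ := hsv_duh_sq_le_lintegral hg h0 hκ hμκ hμm ht
    _ ≤ ENNReal.ofReal (1 / κ) *
        ∫⁻ r in Set.Ioc 0 t, ENNReal.ofReal (Real.exp (-(m * (t - r)))) * M ^ 2 := by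
        gcongr 1
        refine setLIntegral_mono' measurableSet_Ioc fun r hr => ?_
        gcongr
        exact hM r hr.1.le
    _ ≤ ENNReal.ofReal (1 / κ) * (ENNReal.ofReal (1 / m) * M ^ 2) := by
        rw [lintegral_mul_const _ hW]
        gcongr
        exact lintegral_exp_kernel_le hm ht
    _ ≤ _ := by
        rw [← mul_assoc, ← ENNReal.ofReal_mul (by positivity), mul_pow,
          ← ENNReal.ofReal_pow hθ]
        gcongr

/-! ### Dominated convergence -/

lemma tendsto_ellTwo_zero {T κ : Type*} {l : Filter T} [l.IsCountablyGenerated]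
    {A : T → κ → ℝ≥0∞} {B : κ → ℝ≥0∞} (hB : ∑' i, B i ^ 2 ≠ ⊤)
    (hAB : ∀ᶠ t in l, ∀ i, A t i ≤ B i) (hA : ∀ i, Tendsto (fun t => A t i) l (𝓝 0)) :
    Tendsto (fun t => ellTwo (A t)) l (𝓝 0) := by
  let _ : MeasurableSpace κ := ⊤
  have _ : MeasurableSingletonClass κ := ⟨fun _ => trivial⟩
  have h : Tendsto (fun t => ∑' i, A t i ^ 2) l (𝓝 0) := by
    simp only [← lintegral_count] at hB ⊢
    have := tendsto_lintegral_filter_of_dominated_convergence (μ := (Measure.count : Measure κ))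
      (l := l) (F := fun t i => A t i ^ 2) (f := fun _ => 0) (fun i => B i ^ 2)
      (Eventually.of_forall fun _ => measurable_from_top)
      (hAB.mono fun t ht => Eventually.of_forall fun i => pow_le_pow_left' (ht i) 2) hB
      (Eventually.of_forall fun i => by
        simpa using ENNReal.Tendsto.pow (n := 2) (hA i))
    simpa using this
  have := h.ennrpow_const (1 / 2 : ℝ)
  simpa [ellTwo] using this

lemma tendsto_hsv_sub_of_dominated {T : Type*} {l : Filter T} [l.IsCountablyGenerated]
    {F : T → Fin n → Freq d → ℂ} {a : Fin n → Freq d → ℂ} {B : Fin n → Freq d → ℝ≥0∞}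
    (hB : ∀ k, ∑' ξ, (wt σ ξ * B k ξ) ^ 2 ≠ ⊤)
    (hFB : ∀ᶠ t in l, ∀ k ξ, ‖F t k ξ‖ₑ ≤ B k ξ) (haB : ∀ k ξ, ‖a k ξ‖ₑ ≤ B k ξ)
    (hF : ∀ k ξ, Tendsto (fun t => F t k ξ) l (𝓝 (a k ξ))) :
    Tendsto (fun t => hsv σ (F t - a)) l (𝓝 0) := by
  have h1 : ∀ k, Tendsto (fun t => hs σ ((F t - a) k)) l (𝓝 0) := by
    intro k
    refine tendsto_ellTwo_zero (B := fun ξ => 2 * (wt σ ξ * B k ξ)) ?_ ?_ ?_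
    · simp only [mul_pow, ENNReal.tsum_mul_left] at hB ⊢
      exact ENNReal.mul_ne_top (by simp) (hB k)
    · filter_upwards [hFB] with t ht ξ
      rw [Pi.sub_apply, Pi.sub_apply, mul_left_comm, two_mul]
      gcongr
      exact enorm_sub_le.trans (add_le_add (ht k ξ) (haB k ξ))
    · intro ξ
      have h2 : Tendsto (fun t => ‖F t k ξ - a k ξ‖ₑ) l (𝓝 0) := by
        have := ((hF k ξ).sub_const (a k ξ)).enorm
        simpa using this
      have := ENNReal.Tendsto.const_mul h2 (Or.inr (wt_ne_top σ ξ))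
      simpa using this
  refine tendsto_of_tendsto_of_tendsto_of_le_of_le tendsto_const_nhds ?_ (fun _ => zero_le)
    fun t => hsv_le_sum σ (F t - a)
  simpa using tendsto_finsetSum Finset.univ fun k _ => h1 k

/-- With t taken out of the integrand, continuity and differentiability in t follow from those of a
primitive. -/
lemma duh_eq (t : ℝ) (k : Fin n) (ξ : Freq d) : duh μ g t k ξ = (Real.exp (-(μ ξ * t)) : ℂ) *
    ∫ r in (0 : ℝ)..t, (Real.exp (μ ξ * r) : ℂ) * g r k ξ := by
  rw [duh, ← intervalIntegral.integral_const_mul]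
  congr 1
  ext r
  rw [← mul_assoc, ← Complex.ofReal_mul, ← Real.exp_add]
  ring_nf

lemma continuous_duh (hg : ∀ k ξ, Continuous fun r => g r k ξ) (k : Fin n) (ξ : Freq d) :
    Continuous fun t => duh μ g t k ξ := by
  simp only [duh_eq]
  have h2 : Continuous fun r => (Real.exp (μ ξ * r) : ℂ) * g r k ξ := by
    have := hg k ξ
    fun_prop
  have h3 := intervalIntegral.continuous_primitive (μ := volume)
    (fun a b => h2.intervalIntegrable a b) 0
  fun_prop

/-- Dominated convergence in ξ. Each coefficient is continuous in time, and on [0,T] Cauchy–Schwarz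
with the kernel bounded by 1 gives a majorant whose H^{σ+1} norm is controlled by the integral of
‖g‖² over [0,T]. The maximum with 0 extends the curve to ℝ by its initial value. -/
lemma tendsto_duh (hg : ∀ k ξ, Continuous fun r => g r k ξ)
    (h0 : ∀ r k, g r k 0 = 0) {κ : ℝ} (hκ : 0 < κ)
    (hμκ : ∀ ξ ≠ 0, κ * bracket ξ ^ 2 ≤ μ ξ)
    {M : ℝ≥0∞} (hMt : M ≠ ⊤) (hM : ∀ r, 0 ≤ r → hsv σ (g r) ≤ M) (t : ℝ) :
    Tendsto (fun r => hsv (σ + 1) (duh μ g (max r 0) - duh μ g (max t 0))) (𝓝 t) (𝓝 0) := by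
  set T : ℝ := max t 0 + 1 with hT
  let J : Fin n → Freq d → ℝ≥0∞ := fun k ξ => ∫⁻ r in Set.Ioc 0 T, ‖g r k ξ‖ₑ ^ 2
  -- The case distinction is needed because μ has no prescribed sign at the zero frequency, where
  -- the Duhamel integral vanishes anyway.
  let B : Fin n → Freq d → ℝ≥0∞ := fun k ξ =>
    if ξ = 0 then 0 else (ENNReal.ofReal (1 / μ ξ) * J k ξ) ^ (1 / 2 : ℝ)
  have bound : ∀ r, 0 ≤ r → r ≤ T → ∀ k ξ, ‖duh μ g r k ξ‖ₑ ≤ B k ξ := by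
    intro r hr hrT k ξ
    by_cases hξ : ξ = 0
    · subst hξ; simp [duh_zero_freq h0]
    have hμ : 0 < μ ξ := lt_of_lt_of_le (by have := bracket_pos ξ; positivity) (hμκ ξ hξ)
    simp only [B, if_neg hξ]
    apply le_of_sq_le_sq_ennreal
    rw [sqrt_sq_ennreal]
    refine (enorm_duh_sq_le hg hr k hμ).trans ?_
    gcongr
    calc _ ≤ ∫⁻ r in Set.Ioc 0 r, ‖g r k ξ‖ₑ ^ 2 := by
          refine setLIntegral_mono' measurableSet_Ioc fun q hq => ?_
          refine mul_le_of_le_one_left zero_le ?_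
          rw [← ENNReal.ofReal_one]
          apply ENNReal.ofReal_le_ofReal
          rw [Real.exp_le_one_iff]
          have : 0 ≤ μ ξ * (r - q) := mul_nonneg hμ.le (by linarith [hq.2])
          linarith
      _ ≤ _ := lintegral_mono_set (Set.Ioc_subset_Ioc_right hrT)
  refine tendsto_hsv_sub_of_dominated (B := B) ?_ ?_ ?_ ?_
  · intro k
    have h1 : ∀ ξ, (wt (σ + 1) ξ * B k ξ) ^ 2 ≤
        ENNReal.ofReal (1 / κ) * ∫⁻ r in Set.Ioc 0 T, (wt σ ξ * ‖g r k ξ‖ₑ) ^ 2 := by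
      intro ξ
      by_cases hξ : ξ = 0
      · simp [B, hξ]
      simp only [B, if_neg hξ, J]
      rw [mul_pow, sqrt_sq_ennreal, ← mul_assoc]
      simp only [mul_pow]
      rw [lintegral_const_mul' _ _ (ENNReal.pow_ne_top (wt_ne_top σ ξ)), ← mul_assoc]
      exact mul_le_mul_left (wt_sq_mul_ofReal_inv hκ σ (hμκ ξ hξ)) _
    refine ne_of_lt (lt_of_le_of_lt (ENNReal.tsum_le_tsum h1) ?_)
    rw [ENNReal.tsum_mul_left, ← lintegral_tsum fun ξ =>
      (((hg k ξ).measurable.enorm.const_mul _).pow_const 2).aemeasurable]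
    refine ENNReal.mul_lt_top ENNReal.ofReal_lt_top ?_
    calc ∫⁻ r in Set.Ioc 0 T, ∑' ξ, (wt σ ξ * ‖g r k ξ‖ₑ) ^ 2
        ≤ ∫⁻ _r in Set.Ioc 0 T, M ^ 2 := by
          refine setLIntegral_mono' measurableSet_Ioc fun r hr => ?_
          rw [← ellTwo_sq]
          gcongr
          exact (hs_le_hsv σ (g r) k).trans (hM r hr.1.le)
      _ < ⊤ := by
          rw [lintegral_const]
          exact ENNReal.mul_lt_top (ENNReal.pow_lt_top hMt.lt_top) (by simp)
  · have : ∀ᶠ r in 𝓝 t, max r 0 < T :=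
      (continuous_id.max continuous_const).continuousAt.eventually
        (gt_mem_nhds (by simp [hT] : max (id t) 0 < T))
    filter_upwards [this] with r hr
    exact bound _ (le_max_right _ _) hr.le
  · exact bound _ (le_max_right _ _) (by simp [hT])
  · intro k ξ
    exact ((continuous_duh hg k ξ).comp (continuous_id.max continuous_const)).tendsto t

/-- The heat flow. -/
def heat (μ : Freq d → ℝ) (a : Fin n → Freq d → ℂ) (t : ℝ) (k : Fin n) (ξ : Freq d) : ℂ :=
  (Real.exp (-(μ ξ * t)) : ℂ) * a k ξ

lemma enorm_heat_le {a : Fin n → Freq d → ℂ} (h0 : ∀ k, a k 0 = 0) (hμ : ∀ ξ ≠ 0, 0 ≤ μ ξ)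
    {t : ℝ} (ht : 0 ≤ t) (k : Fin n) (ξ : Freq d) : ‖heat μ a t k ξ‖ₑ ≤ ‖a k ξ‖ₑ := by
  by_cases hξ : ξ = 0
  · simp [heat, hξ, h0]
  rw [heat, enorm_mul]
  refine mul_le_of_le_one_left zero_le ?_
  rw [← ofReal_norm, Complex.norm_real, Real.norm_of_nonneg (Real.exp_pos _).le,
    ← ENNReal.ofReal_one]
  apply ENNReal.ofReal_le_ofReal
  rw [Real.exp_le_one_iff]
  linarith [mul_nonneg (hμ ξ hξ) ht]

lemma hsv_heat_le {a : Fin n → Freq d → ℂ} (h0 : ∀ k, a k 0 = 0) (hμ : ∀ ξ ≠ 0, 0 ≤ μ ξ)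
    {t : ℝ} (ht : 0 ≤ t) : hsv σ (heat μ a t) ≤ hsv σ a :=
  ellTwo_mono fun k => ellTwo_mono fun ξ => by
    gcongr
    exact enorm_heat_le h0 hμ ht k ξ

lemma tendsto_heat {a : Fin n → Freq d → ℂ} (h0 : ∀ k, a k 0 = 0) (hμ : ∀ ξ ≠ 0, 0 ≤ μ ξ)
    (ha : hsv σ a ≠ ⊤) (t : ℝ) :
    Tendsto (fun r => hsv σ (heat μ a (max r 0) - heat μ a (max t 0))) (𝓝 t) (𝓝 0) := by
  refine tendsto_hsv_sub_of_dominated (B := fun k ξ => ‖a k ξ‖ₑ) ?_ ?_ ?_ ?_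
  · intro k
    rw [← ellTwo_sq]
    exact ENNReal.pow_ne_top (ne_top_of_le_ne_top ha (hs_le_hsv σ a k))
  · exact Eventually.of_forall fun r => enorm_heat_le h0 hμ (le_max_right _ _)
  · exact enorm_heat_le h0 hμ (le_max_right _ _)
  · intro k ξ
    have : Continuous fun r => heat μ a (max r 0) k ξ := by
      simp only [heat]
      fun_prop
    exact this.tendsto t

/-! ### Time derivatives -/

/-- A field whose coefficients have derivatives `g_ξ`, with `g` continuous in time with values in
`H^σ`, is differentiable in time with values in `H^σ`. -/
lemma tendsto_difference_quotient {a : ℝ → Fin n → Freq d → ℂ}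
    (hg : ∀ k ξ, Continuous fun r => g r k ξ) {t : ℝ} (ht : 0 ≤ t)
    (ha : ∀ r, 0 ≤ r → ∀ k ξ, a r k ξ - a t k ξ = ∫ q in t..r, g q k ξ)
    (hgt : Tendsto (fun r => hsv σ (g r - g t)) (𝓝[Set.Ici 0] t) (𝓝 0)) :
    Tendsto (fun r => hsv σ ((((r - t)⁻¹ : ℝ) : ℂ) • (a r - a t) - g t))
      (𝓝[Set.Ici 0 \ {t}] t) (𝓝 0) := by
  rw [ENNReal.tendsto_nhds_zero] at hgt ⊢
  intro ε hε
  obtain ⟨η, hη, hball⟩ := Metric.mem_nhdsWithin_iff.mp (hgt ε hε)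
  have hmem : Metric.ball t η ∈ 𝓝[Set.Ici 0 \ {t}] t :=
    mem_nhdsWithin_of_mem_nhds (Metric.ball_mem_nhds t hη)
  filter_upwards [hmem, self_mem_nhdsWithin] with r hr hr0
  have hr0' : (0 : ℝ) ≤ r := hr0.1
  have hrt : r - t ≠ 0 := sub_ne_zero.mpr hr0.2
  have hsub : ∀ q ∈ Set.uIoc t r, hsv σ (g q - g t) ≤ ε := by
    intro q hq
    refine hball ⟨?_, ?_⟩
    · rw [Metric.mem_ball, Real.dist_eq] at hr ⊢
      refine lt_of_le_of_lt ?_ hr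
      have := Set.uIoc_subset_uIcc hq
      exact Set.abs_sub_left_of_mem_uIcc this
    · have := Set.uIoc_subset_uIcc hq
      exact le_trans (le_min ht hr0') this.1
  -- The constant weight w turns Lebesgue measure between t and r into a probability measure. The
  -- error of the difference quotient is the average of g q − g t, and its squared norm is at most
  -- the average of the squared norms.
  set w : ℝ≥0∞ := ENNReal.ofReal |r - t|⁻¹ with hw
  have hvol : volume (Set.uIoc t r) = ENNReal.ofReal |r - t| := by
    rw [Set.uIoc, Real.volume_Ioc, max_sub_min_eq_abs]
  have hwvol : w * volume (Set.uIoc t r) = 1 := by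
    rw [hvol, hw, ← ENNReal.ofReal_mul (by positivity), inv_mul_cancel₀ (abs_ne_zero.mpr hrt),
      ENNReal.ofReal_one]
  have hgsub : ∀ k ξ, Continuous fun q => (g q - g t) k ξ := fun k ξ =>
    (hg k ξ).sub continuous_const
  have key := hsv_sq_le_lintegral (σ := σ) (τ := σ) (ρ := volume.restrict (Set.uIoc t r))
    (a := (((r - t)⁻¹ : ℝ) : ℂ) • (a r - a t) - g t) hgsub (W := fun _ => w) measurable_const ?_
  · apply le_of_sq_le_sq_ennreal
    calc _ ≤ _ := key
      _ ≤ ∫⁻ _q in Set.uIoc t r, w * ε ^ 2 := by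
          refine setLIntegral_mono' measurableSet_uIoc fun q hq => ?_
          gcongr
          exact hsub q hq
      _ = ε ^ 2 := by
          rw [setLIntegral_const, mul_right_comm, hwvol, one_mul]
  intro k ξ
  have e1 : ((((r - t)⁻¹ : ℝ) : ℂ) • (a r - a t) - g t) k ξ =
      (((r - t)⁻¹ : ℝ) : ℂ) * ∫ q in t..r, (g q - g t) k ξ := by
    simp only [Pi.sub_apply, Pi.smul_apply, smul_eq_mul]
    rw [ha r hr0' k ξ, intervalIntegral.integral_sub ((hg k ξ).intervalIntegrable _ _)
      (continuous_const.intervalIntegrable _ _), intervalIntegral.integral_const, mul_sub]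
    congr 1
    have : ((r : ℂ) - t) ≠ 0 := by exact_mod_cast hrt
    rw [Complex.real_smul]
    push_cast
    field_simp
  have e2 : ‖((((r - t)⁻¹ : ℝ) : ℂ) • (a r - a t) - g t) k ξ‖ₑ ≤
      ∫⁻ q in Set.uIoc t r, w * ‖(g q - g t) k ξ‖ₑ := by
    rw [e1, enorm_mul, lintegral_const_mul' _ _ ENNReal.ofReal_ne_top]
    gcongr
    · rw [← ofReal_norm, Complex.norm_real, Real.norm_eq_abs, abs_inv]
    · rw [← ofReal_norm, intervalIntegral.norm_intervalIntegral_eq, ofReal_norm]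
      exact enorm_integral_le_lintegral_enorm _
  have e3 := (pow_le_pow_left' e2 2).trans
    (sq_lintegral_mul_le measurable_const (hgsub k ξ).measurable.enorm)
  rw [setLIntegral_const, hwvol, one_mul] at e3
  rw [mul_pow]
  calc _ ≤ wt σ ξ ^ 2 * ∫⁻ q in Set.uIoc t r, w * ‖(g q - g t) k ξ‖ₑ ^ 2 := by gcongr
    _ = _ := by
        rw [← lintegral_const_mul' _ _ (ENNReal.pow_ne_top (wt_ne_top σ ξ))]
        congr 1
        ext q
        ring

end duhamel

section torus

variable {d : ℕ}

/-! ### Characters of the torus -/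

lemma character_zero (x : Torus d) : character 0 x = 1 := by simp [character]

lemma character_add (ξ η : Freq d) (x : Torus d) :
    character (ξ + η) x = character ξ x * character η x := by
  simp only [character, Pi.add_apply, fourier_add, Finset.prod_mul_distrib]

lemma character_neg (ξ : Freq d) (x : Torus d) : character (-ξ) x = star (character ξ x) := by
  simp only [character, Pi.neg_apply, fourier_neg, RCLike.star_def, map_prod]

lemma continuous_character (ξ : Freq d) : Continuous (character ξ) := by
  unfold character
  fun_prop

lemma norm_character (ξ : Freq d) (x : Torus d) : ‖character ξ x‖ = 1 := by
  simp only [character, norm_prod, fourier_apply, Circle.norm_coe, Finset.prod_const_one]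

/-- The characters as continuous functions. -/
def chi (ξ : Freq d) : C(Torus d, ℂ) := ⟨character ξ, continuous_character ξ⟩

lemma chi_apply (ξ : Freq d) (x : Torus d) : chi ξ x = character ξ x := rfl

/-- The algebra of trigonometric polynomials. -/
def trigAlgebra (d : ℕ) : StarSubalgebra ℂ C(Torus d, ℂ) where
  toSubalgebra := Algebra.adjoin ℂ (Set.range chi)
  star_mem' := by
    change Algebra.adjoin ℂ (Set.range chi) ≤ star (Algebra.adjoin ℂ (Set.range chi))
    refine Algebra.adjoin_le ?_
    rintro _ ⟨ξ, rfl⟩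
    refine Algebra.subset_adjoin ⟨-ξ, ?_⟩
    ext1 x
    simp only [chi_apply, character_neg, ContinuousMap.star_apply]

lemma trigAlgebra_coe :
    (trigAlgebra d).toSubalgebra.toSubmodule = Submodule.span ℂ (Set.range chi) := by
  apply Algebra.adjoin_eq_span_of_subset
  refine .trans (fun x => Submonoid.closure_induction (fun _ => id) ⟨0, ?_⟩ ?_)
    Submodule.subset_span
  · ext x
    rw [chi_apply, character_zero, ContinuousMap.one_apply]
  · rintro _ _ _ _ ⟨ξ, rfl⟩ ⟨η, rfl⟩
    refine ⟨ξ + η, ?_⟩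
    ext x
    simp only [chi_apply, character_add, ContinuousMap.mul_apply]

lemma character_single (i : Fin d) (x : Torus d) :
    character (Pi.single i 1) x = fourier 1 (x i) := by
  rw [character, Finset.prod_eq_single i]
  · rw [Pi.single_eq_same]
  · intro j _ hj
    rw [Pi.single_eq_of_ne hj, fourier_zero]
  · simp

lemma trigAlgebra_separatesPoints : (trigAlgebra d).SeparatesPoints := by
  intro x y hxy
  obtain ⟨i, hi⟩ := Function.ne_iff.mp hxy
  refine ⟨_, ⟨chi (Pi.single i 1), Algebra.subset_adjoin ⟨Pi.single i 1, rfl⟩, rfl⟩, ?_⟩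
  change character (Pi.single i 1) x ≠ character (Pi.single i 1) y
  rw [character_single, character_single, fourier_one, fourier_one]
  intro h
  exact hi (AddCircle.injective_toCircle Real.two_pi_pos.ne' (Circle.ext h))

lemma span_chi_closure_eq_top :
    (Submodule.span ℂ (Set.range (chi (d := d)))).topologicalClosure = ⊤ := by
  rw [← trigAlgebra_coe]
  exact congr_arg (Subalgebra.toSubmodule <| StarSubalgebra.toSubalgebra ·)
    (ContinuousMap.starSubalgebra_topologicalClosure_eq_top_of_separatesPoints _
      trigAlgebra_separatesPoints)

lemma integral_fourier_circle (n : ℤ) :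
    ∫ x : AddCircle (2 * Real.pi), fourier n x = if n = 0 then (2 * Real.pi : ℂ) else 0 := by
  have h := fourierCoeff_fourier (T := 2 * Real.pi) n
  have h0 := congrFun h 0
  simp only [fourierCoeff, neg_zero, fourier_zero, one_smul,
    AddCircle.integral_haarAddCircle] at h0
  have hp : (2 * Real.pi : ℝ) ≠ 0 := Real.two_pi_pos.ne'
  rw [inv_smul_eq_iff₀ hp] at h0
  rw [h0]
  by_cases hn : n = 0
  · subst hn; simp
  · simp [hn]

lemma integral_character (ξ : Freq d) :
    ∫ x, character ξ x = if ξ = 0 then (2 * Real.pi : ℂ) ^ d else 0 := by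
  simp only [character]
  rw [integral_fintype_prod_volume_eq_prod (fun i x => (fourier (ξ i) x : ℂ))]
  simp only [integral_fourier_circle]
  by_cases h : ξ = 0
  · subst h; simp
  · obtain ⟨i, hi⟩ := Function.ne_iff.mp h
    rw [if_neg h]
    exact Finset.prod_eq_zero (Finset.mem_univ i) (if_neg hi)

/-! ### Uniqueness of Fourier coefficients -/

/-- Integration against f is a functional continuous for the sup norm, with norm at most the L¹ norm
of f; it vanishes on characters, whose span is dense. -/
lemma integral_mul_eq_zero_of_characters {f : Torus d → ℂ} (hf : Integrable f)
    (h : ∀ ξ : Freq d, ∫ x, f x * character ξ x = 0) (φ : C(Torus d, ℂ)) :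
    ∫ x, f x * φ x = 0 := by
  have hint : ∀ φ : C(Torus d, ℂ), Integrable fun x => f x * φ x := fun φ =>
    hf.mul_bdd (c := ‖φ‖) φ.continuous.aestronglyMeasurable
      (Eventually.of_forall fun x => φ.norm_coe_le_norm x)
  let T : C(Torus d, ℂ) →ₗ[ℂ] ℂ :=
    { toFun := fun φ => ∫ x, f x * φ x
      map_add' := fun φ ψ => by
        simp only [ContinuousMap.add_apply, mul_add]
        exact integral_add (hint φ) (hint ψ)
      map_smul' := fun c φ => by
        simp only [ContinuousMap.smul_apply, smul_eq_mul, RingHom.id_apply]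
        rw [← integral_const_mul]
        congr 1
        ext x
        ring }
  let T' : C(Torus d, ℂ) →L[ℂ] ℂ := T.mkContinuous (∫ x, ‖f x‖) fun φ => by
    rw [← integral_mul_const]
    refine norm_integral_le_of_norm_le (hf.norm.mul_const _) (Eventually.of_forall fun x => ?_)
    rw [norm_mul]
    gcongr
    exact φ.norm_coe_le_norm x
  have hle : (Submodule.span ℂ (Set.range (chi (d := d)))).topologicalClosure ≤
      LinearMap.ker T'.toLinearMap := by
    refine Submodule.topologicalClosure_minimal _ (Submodule.span_le.mpr ?_) T'.isClosed_ker
    rintro _ ⟨ξ, rfl⟩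
    exact h ξ
  rw [span_chi_closure_eq_top] at hle
  exact hle (Submodule.mem_top (x := φ))

/-- The indicator of a compact set is a bounded pointwise limit of continuous functions, so f has
integral zero over every compact set. -/
lemma ae_eq_zero_of_characters {f : Torus d → ℂ} (hf : Integrable f)
    (h : ∀ ξ : Freq d, ∫ x, f x * character ξ x = 0) : f =ᵐ[volume] 0 := by
  refine ae_eq_zero_of_forall_setIntegral_isCompact_eq_zero' hf.locallyIntegrable fun s hs => ?_
  have hδ : ∀ n : ℕ, (0 : ℝ) < 1 / ((n : ℝ) + 1) := fun n => by positivity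
  let φ : ℕ → C(Torus d, ℂ) := fun n =>
    ⟨fun x => ((thickenedIndicator (hδ n) s x : ℝ) : ℂ), by fun_prop⟩
  have hlim := tendsto_integral_of_dominated_convergence (μ := volume)
    (F := fun n x => f x * φ n x) (f := fun x => s.indicator f x) (fun x => ‖f x‖)
    (fun n => hf.aestronglyMeasurable.mul (φ n).continuous.aestronglyMeasurable) hf.norm
    (fun n => Eventually.of_forall fun x => by
      rw [norm_mul]
      refine mul_le_of_le_one_right (norm_nonneg _) ?_
      simp only [φ, ContinuousMap.coe_mk, Complex.norm_real, NNReal.norm_eq]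
      exact_mod_cast thickenedIndicator_le_one (hδ n) s x)
    (Eventually.of_forall fun x => by
      have h1 := (tendsto_pi_nhds.mp (thickenedIndicator_tendsto_indicator_closure hδ
        tendsto_one_div_add_atTop_nhds_zero_nat s)) x
      rw [hs.isClosed.closure_eq] at h1
      have h2 : Tendsto (fun n => f x * φ n x) atTop
          (𝓝 (f x * (((s.indicator (fun _ => (1 : ℝ≥0)) x : ℝ≥0) : ℝ) : ℂ))) := by
        refine Tendsto.const_mul _ ?_
        exact (Complex.continuous_ofReal.tendsto _).comp
          ((NNReal.continuous_coe.tendsto _).comp h1)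
      convert h2 using 2
      by_cases hx : x ∈ s <;> simp [hx])
  simp only [integral_mul_eq_zero_of_characters hf h] at hlim
  rw [← integral_indicator hs.isClosed.measurableSet]
  exact tendsto_nhds_unique hlim tendsto_const_nhds

/-! ### Fourier coefficients of square integrable functions -/

/-- Fourier coefficients of complex valued functions. -/
def ccoeff (u : Torus d → ℂ) (ξ : Freq d) : ℂ :=
  (1 / (2 * (Real.pi : ℂ)) ^ d) * ∫ x, u x * character (-ξ) x

lemma coeff_eq_ccoeff (u : Torus d → ℝ) : coeff u = ccoeff fun x => (u x : ℂ) := rfl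

lemma two_pi_pow_ne_zero (d : ℕ) : (2 * (Real.pi : ℂ)) ^ d ≠ 0 :=
  pow_ne_zero _ (by exact_mod_cast Real.two_pi_pos.ne')

lemma integral_eq_ccoeff (u : Torus d → ℂ) (ξ : Freq d) :
    ∫ x, u x * character (-ξ) x = (2 * (Real.pi : ℂ)) ^ d * ccoeff u ξ := by
  rw [ccoeff, ← mul_assoc, mul_one_div_cancel (two_pi_pow_ne_zero d), one_mul]

lemma ae_eq_zero_of_ccoeff {f : Torus d → ℂ} (hf : Integrable f)
    (h : ∀ ξ, ccoeff f ξ = 0) : f =ᵐ[volume] 0 :=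
  ae_eq_zero_of_characters hf fun ξ => by
    have := integral_eq_ccoeff f (-ξ)
    rwa [h, mul_zero, neg_neg] at this

/-- An integrable function whose Fourier coefficients vanish is zero. -/
lemma ae_eq_zero_of_coeff {f : Torus d → ℝ} (hf : Integrable f) (h : ∀ ξ, coeff f ξ = 0) :
    f =ᵐ[volume] 0 := by
  filter_upwards [ae_eq_zero_of_ccoeff hf.ofReal fun ξ => h ξ] with x hx
  exact Complex.ofReal_eq_zero.mp hx

/-- The normalising factor of the Fourier basis. -/
def basisFactor (d : ℕ) : ℝ := (Real.sqrt ((2 * Real.pi) ^ d))⁻¹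

lemma basisFactor_pos (d : ℕ) : 0 < basisFactor d := by
  have := Real.pi_pos
  rw [basisFactor]
  positivity

lemma basisFactor_sq (d : ℕ) : (basisFactor d : ℂ) * basisFactor d * (2 * (Real.pi : ℂ)) ^ d = 1 := by
  have h : basisFactor d * basisFactor d * (2 * Real.pi) ^ d = 1 := by
    have hp : 0 < (2 * Real.pi) ^ d := pow_pos Real.two_pi_pos d
    rw [basisFactor, ← mul_inv, Real.mul_self_sqrt hp.le, inv_mul_cancel₀ hp.ne']
  exact_mod_cast h

/-- The normalised characters in `L²`. -/
def basisVec (ξ : Freq d) : Lp ℂ 2 (volume : Measure (Torus d)) :=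
  ContinuousMap.toLp (E := ℂ) 2 volume ℂ ((basisFactor d : ℂ) • chi ξ)

lemma coeFn_basisVec (ξ : Freq d) :
    basisVec ξ =ᵐ[volume] fun x => (basisFactor d : ℂ) * character ξ x :=
  ContinuousMap.coeFn_toLp volume _

lemma inner_basisVec (ξ : Freq d) (y : Lp ℂ 2 (volume : Measure (Torus d))) :
    inner ℂ (basisVec ξ) y = basisFactor d * (2 * (Real.pi : ℂ)) ^ d * ccoeff y ξ := by
  rw [L2.inner_def, mul_assoc, ← integral_eq_ccoeff, ← integral_const_mul]
  refine integral_congr_ae ?_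
  filter_upwards [coeFn_basisVec ξ] with x hx
  rw [hx, RCLike.inner_apply, map_mul, Complex.conj_ofReal, character_neg, RCLike.star_def]
  ring

lemma orthonormal_basisVec : Orthonormal ℂ (basisVec (d := d)) := by
  rw [orthonormal_iff_ite]
  intro ξ η
  rw [inner_basisVec, mul_assoc, ← integral_eq_ccoeff]
  have h1 : ∫ x, basisVec η x * character (-ξ) x =
      basisFactor d * ∫ x, character (η - ξ) x := by
    rw [← integral_const_mul]
    refine integral_congr_ae ?_
    filter_upwards [coeFn_basisVec η] with x hx
    rw [hx, mul_assoc, ← character_add, sub_eq_add_neg]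
  rw [h1, integral_character]
  by_cases h : ξ = η
  · subst h
    simp only [sub_self, if_true]
    rw [← mul_assoc]
    exact basisFactor_sq d
  · rw [if_neg (sub_ne_zero.mpr (Ne.symm h)), if_neg h, mul_zero, mul_zero]

lemma integrable_of_L2 (y : Lp ℂ 2 (volume : Measure (Torus d))) : Integrable y :=
  (Lp.memLp y).integrable (by norm_num)

/-- The Fourier basis of `L²`. -/
def fourierHilbert (d : ℕ) : HilbertBasis (Freq d) ℂ (Lp ℂ 2 (volume : Measure (Torus d))) :=
  HilbertBasis.mkOfOrthogonalEqBot orthonormal_basisVec (by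
    rw [Submodule.eq_bot_iff]
    intro y hy
    rw [Lp.eq_zero_iff_ae_eq_zero]
    refine ae_eq_zero_of_ccoeff (integrable_of_L2 y) fun ξ => ?_
    have h := (Submodule.mem_orthogonal _ _).mp hy (basisVec ξ)
      (Submodule.subset_span ⟨ξ, rfl⟩)
    rw [inner_basisVec] at h
    have := basisFactor_pos d
    refine (mul_eq_zero.mp h).resolve_left (mul_ne_zero ?_ (two_pi_pow_ne_zero d))
    exact_mod_cast this.ne')

lemma coe_fourierHilbert (ξ : Freq d) : fourierHilbert d ξ = basisVec ξ :=
  congrFun (HilbertBasis.coe_mkOfOrthogonalEqBot _ _) ξ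

/-- Riesz–Fischer; the constant c converts Fourier coefficients into coordinates in the orthonormal
basis. -/
lemma exists_ccoeff_eq (a : Freq d → ℂ) (ha : hs 0 a < ⊤) :
    ∃ y : Lp ℂ 2 (volume : Measure (Torus d)), ∀ ξ, ccoeff y ξ = a ξ := by
  set c : ℂ := basisFactor d * (2 * (Real.pi : ℂ)) ^ d with hc
  have hc0 : c ≠ 0 := by
    have := basisFactor_pos d
    refine mul_ne_zero ?_ (two_pi_pow_ne_zero d)
    exact_mod_cast this.ne'
  have hmem : Memℓp (c • a) 2 := by
    apply Memℓp.const_smul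
    rw [memℓp_gen_iff (by norm_num)]
    have h1 : ∑' ξ, ‖a ξ‖ₑ ^ 2 ≠ ⊤ := by
      have := ENNReal.pow_lt_top (n := 2) ha
      rw [hs, ellTwo_sq] at this
      simpa only [wt_zero, one_mul] using this.ne
    have h2 := ENNReal.summable_toReal h1
    simpa using h2
  refine ⟨(fourierHilbert d).repr.symm ⟨c • a, hmem⟩, fun ξ => ?_⟩
  have h := (fourierHilbert d).repr_apply_apply
    ((fourierHilbert d).repr.symm ⟨c • a, hmem⟩) ξ
  rw [LinearIsometryEquiv.apply_symm_apply, coe_fourierHilbert, inner_basisVec] at h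
  exact (mul_left_cancel₀ hc0 h).symm

lemma integrable_L2 (u : L2 d) : Integrable u := (Lp.memLp u).integrable (by norm_num)

lemma memLp_ofReal (u : L2 d) : MemLp (fun x => (u x : ℂ)) 2 (volume : Measure (Torus d)) :=
  (Lp.memLp u).ofReal

lemma integrable_mul_character {f : Torus d → ℂ} (hf : Integrable f) (ξ : Freq d) :
    Integrable fun x => f x * character ξ x :=
  hf.mul_bdd (c := 1) (continuous_character ξ).aestronglyMeasurable
    (Eventually.of_forall fun x => (norm_character ξ x).le)

lemma coeff_congr {f g : Torus d → ℝ} (h : f =ᵐ[volume] g) : coeff f = coeff g := by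
  ext ξ
  rw [coeff, coeff]
  congr 1
  refine integral_congr_ae ?_
  filter_upwards [h] with x hx
  rw [hx]

lemma coeff_add_fun {f g : Torus d → ℝ} (hf : Integrable f) (hg : Integrable g) :
    coeff (fun x => f x + g x) = coeff f + coeff g := by
  ext ξ
  simp only [coeff, Pi.add_apply]
  rw [← mul_add, ← integral_add (integrable_mul_character (f := fun x => (f x : ℂ)) hf.ofReal _)
    (integrable_mul_character (f := fun x => (g x : ℂ)) hg.ofReal _)]
  congr 2
  ext x
  push_cast
  ring

lemma coeff_smul_fun (r : ℝ) (f : Torus d → ℝ) :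
    coeff (fun x => r * f x) = (r : ℂ) • coeff f := by
  ext ξ
  simp only [coeff, Pi.smul_apply, smul_eq_mul]
  have h : ∀ x, ((r * f x : ℝ) : ℂ) * character (-ξ) x = r * ((f x : ℂ) * character (-ξ) x) :=
    fun x => by push_cast; ring
  simp only [h]
  rw [integral_const_mul]
  ring

lemma coeff_sub_fun {f g : Torus d → ℝ} (hf : Integrable f) (hg : Integrable g) :
    coeff (fun x => f x - g x) = coeff f - coeff g := by
  have h1 := coeff_add_fun hf (hg.const_mul (-1))
  rw [coeff_smul_fun] at h1
  have h2 : (fun x => f x - g x) = fun x => f x + -1 * g x := by ext x; ring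
  rw [h2, h1]
  simp [sub_eq_add_neg]

lemma coeff_zero_fun : coeff (fun _ : Torus d => (0 : ℝ)) = 0 := by
  ext ξ; simp [coeff]

lemma coeff_sum_fun {ι : Type*} (s : Finset ι) {f : ι → Torus d → ℝ}
    (hf : ∀ i ∈ s, Integrable (f i)) :
    coeff (fun x => ∑ i ∈ s, f i x) = ∑ i ∈ s, coeff (f i) := by
  classical
  induction s using Finset.induction_on with
  | empty => simpa using coeff_zero_fun
  | insert a s ha ih =>
    simp only [Finset.sum_insert ha]
    rw [coeff_add_fun (hf a (Finset.mem_insert_self a s))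
      (integrable_finsetSum s fun i hi => hf i (Finset.mem_insert_of_mem hi)),
      ih fun i hi => hf i (Finset.mem_insert_of_mem hi)]

lemma coeff_add (u v : L2 d) : coeff ⇑(u + v) = coeff u + coeff v := by
  rw [← coeff_add_fun (integrable_L2 u) (integrable_L2 v)]
  exact coeff_congr (Lp.coeFn_add u v)

lemma coeff_sub (u v : L2 d) : coeff ⇑(u - v) = coeff u - coeff v := by
  rw [← coeff_sub_fun (integrable_L2 u) (integrable_L2 v)]
  exact coeff_congr (Lp.coeFn_sub u v)

lemma coeff_smul (r : ℝ) (u : L2 d) : coeff ⇑(r • u) = (r : ℂ) • coeff u := by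
  rw [← coeff_smul_fun]
  exact coeff_congr (Lp.coeFn_smul r u)

lemma coeff_injective : Function.Injective fun u : L2 d => coeff u := by
  intro u v h
  rw [← sub_eq_zero, Lp.eq_zero_iff_ae_eq_zero]
  refine ae_eq_zero_of_coeff (integrable_L2 _) fun ξ => ?_
  rw [coeff_sub, sub_eq_zero.mpr h, Pi.zero_apply]

lemma herm_coeff (u : Torus d → ℝ) : Herm (coeff u) := fun ξ => by
  rw [coeff, coeff, star_mul', RCLike.star_def, ← integral_conj]
  congr 1
  · have : (starRingEnd ℂ) 2 = 2 := Complex.conj_ofNat 2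
    simp [this]
  · congr 1
    ext x
    rw [map_mul, Complex.conj_ofReal, neg_neg, character_neg, RCLike.star_def, Complex.conj_conj]

lemma coeff_zero_freq (u : Torus d → ℝ) :
    coeff u 0 = (1 / (2 * (Real.pi : ℂ)) ^ d) * ((∫ x, u x : ℝ) : ℂ) := by
  rw [coeff]
  simp only [neg_zero, character_zero, mul_one, integral_complex_ofReal]

lemma coeff_zero_freq_eq_zero_iff (u : Torus d → ℝ) : coeff u 0 = 0 ↔ ∫ x, u x = 0 := by
  rw [coeff_zero_freq, mul_eq_zero, or_iff_right (one_div_ne_zero (two_pi_pow_ne_zero d)),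
    Complex.ofReal_eq_zero]

/-- Every square summable hermitian sequence is the sequence of Fourier coefficients of a real
valued function. -/
lemma exists_coeff_eq {a : Freq d → ℂ} (ha : hs 0 a < ⊤) (hh : Herm a) :
    ∃ u : L2 d, coeff u = a := by
  obtain ⟨y, hy⟩ := exists_ccoeff_eq a ha
  -- By hermitian symmetry y and its conjugate have the same coefficients, hence so does their half
  -- sum, the real part.
  refine ⟨(Lp.memLp y).re.toLp _, ?_⟩
  have hre : (fun x => RCLike.re (y x)) =ᵐ[volume] ((Lp.memLp y).re.toLp _ : L2 d) :=
    (MemLp.coeFn_toLp _).symm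
  rw [← coeff_congr hre]
  ext ξ
  have hyi := integrable_of_L2 y
  have hconj : ∫ x, (starRingEnd ℂ) (y x) * character (-ξ) x =
      (starRingEnd ℂ) (∫ x, y x * character (-(-ξ)) x) := by
    rw [← integral_conj]
    congr 1
    ext x
    rw [map_mul, character_neg (-ξ), RCLike.star_def, Complex.conj_conj]
  have h1 : ∫ x, ((RCLike.re (y x) : ℝ) : ℂ) * character (-ξ) x =
      (1 / 2) * (∫ x, y x * character (-ξ) x) +
        (1 / 2) * ∫ x, (starRingEnd ℂ) (y x) * character (-ξ) x := by
    rw [← integral_const_mul, ← integral_const_mul, ← integral_add]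
    · congr 1
      ext x
      have : ((RCLike.re (y x) : ℝ) : ℂ) = (y x + (starRingEnd ℂ) (y x)) / 2 :=
        RCLike.re_eq_add_conj (y x)
      rw [this]
      ring
    · exact (integrable_mul_character hyi _).const_mul _
    · have hc : Integrable fun x => (starRingEnd ℂ) (y x) :=
        (LinearIsometryEquiv.integrable_comp_iff (Complex.conjLIE)).mpr hyi
      exact (integrable_mul_character hc _).const_mul _
  rw [coeff, h1, hconj, integral_eq_ccoeff, integral_eq_ccoeff, hy, hy, hh, RCLike.star_def,
    map_mul, Complex.conj_conj, map_pow, map_mul, Complex.conj_ofReal]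
  have := two_pi_pow_ne_zero d
  have h2 : (starRingEnd ℂ) 2 = 2 := Complex.conj_ofNat 2
  rw [h2]
  field_simp
  ring

/-- The Fourier coefficients of a product of two square integrable functions. -/
lemma coeff_mul (u g : L2 d) : coeff (fun x => u x * g x) = conv (coeff u) (coeff g) := by
  ext ξ
  have hu := memLp_ofReal u
  -- Up to (2π)^d the coefficient at ξ is the inner product of u·χ_ξ with g, χ_ξ being the
  -- character. Parseval expands it, and the η-th coordinate of u·χ_ξ involves û(ξ−η).
  have hx : MemLp (fun x => (u x : ℂ) * character ξ x) 2 (volume : Measure (Torus d)) := by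
    refine hu.of_le (hu.aestronglyMeasurable.mul (continuous_character ξ).aestronglyMeasurable) ?_
    refine Eventually.of_forall fun x => ?_
    rw [norm_mul, norm_character, mul_one]
  set X := hx.toLp _ with hX
  set Y := (memLp_ofReal g).toLp _ with hY
  have hXae := hx.coeFn_toLp
  have hYae := (memLp_ofReal g).coeFn_toLp
  have hsum := (fourierHilbert d).hasSum_inner_mul_inner X Y
  have hXY : inner ℂ X Y = (2 * (Real.pi : ℂ)) ^ d * coeff (fun x => u x * g x) ξ := by
    rw [coeff_eq_ccoeff, ← integral_eq_ccoeff, L2.inner_def]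
    refine integral_congr_ae ?_
    filter_upwards [hXae, hYae] with x h1 h2
    rw [RCLike.inner_apply, h1, h2, map_mul, Complex.conj_ofReal, character_neg, RCLike.star_def]
    push_cast
    ring
  have hYη : ∀ η, ccoeff Y η = coeff g η := fun η => by
    rw [coeff_eq_ccoeff, ccoeff, ccoeff]
    congr 1
    refine integral_congr_ae ?_
    filter_upwards [hYae] with x h2
    rw [h2]
  have hXη : ∀ η, inner ℂ X (basisVec η) =
      basisFactor d * (2 * (Real.pi : ℂ)) ^ d * coeff u (ξ - η) := fun η => by
    rw [coeff_eq_ccoeff, mul_assoc, ← integral_eq_ccoeff, L2.inner_def, ← integral_const_mul]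
    refine integral_congr_ae ?_
    filter_upwards [hXae, coeFn_basisVec η] with x h1 h2
    rw [RCLike.inner_apply, h1, h2, map_mul, Complex.conj_ofReal, neg_sub, sub_eq_add_neg,
      character_add, character_neg, RCLike.star_def]
    ring
  rw [← hsum.tsum_eq] at hXY
  have hterm : ∀ η, inner ℂ X (fourierHilbert d η) * inner ℂ (fourierHilbert d η) Y =
      (2 * (Real.pi : ℂ)) ^ d * (coeff u (ξ - η) * coeff g η) := fun η => by
    rw [coe_fourierHilbert, hXη, inner_basisVec, hYη]
    linear_combination ((2 * (Real.pi : ℂ)) ^ d * (coeff u (ξ - η) * coeff g η)) *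
      basisFactor_sq d
  simp only [hterm, tsum_mul_left] at hXY
  exact (mul_left_cancel₀ (two_pi_pow_ne_zero d) hXY).symm

lemma integrable_mul_L2 (u g : L2 d) : Integrable fun x => u x * g x :=
  (Lp.memLp u).integrable_mul (Lp.memLp g)

/-! ### Sobolev norms in terms of sequences -/

/-- The Fourier coefficients of a vector field. -/
def co {n : ℕ} (u : L2Vec d n) (k : Fin n) : Freq d → ℂ := coeff (u k)

lemma sobolevSq_eq (σ : ℝ) (u : L2 d) : sobolevSq σ u = hs σ (coeff u) ^ 2 := by
  rw [hs, ellTwo_sq, sobolevSq]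
  congr 1
  ext ξ
  have hb := bracket_pos ξ
  rw [mul_pow, ENNReal.ofReal_mul (Real.rpow_nonneg hb.le _), ENNReal.ofReal_pow (norm_nonneg _),
    ofReal_norm, wt, ← ENNReal.ofReal_pow (Real.rpow_nonneg hb.le _), ← Real.rpow_natCast,
    ← Real.rpow_mul hb.le]
  norm_num [mul_comm]

lemma sobolevNorm_eq (σ : ℝ) (u : L2 d) : sobolevNorm σ u = hs σ (coeff u) := by
  rw [sobolevNorm, sobolevSq_eq, sq_sqrt_ennreal]

lemma sobolevNormVec_eq {n : ℕ} (σ : ℝ) (u : L2Vec d n) : sobolevNormVec σ u = hsv σ (co u) := by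
  rw [sobolevNormVec, hsv, ellTwo, tsum_fintype]
  simp only [sobolevSq_eq, co]

variable {n : ℕ}

lemma co_add (u v : L2Vec d n) : co (u + v) = co u + co v := by
  ext k ξ; exact congrFun (coeff_add (u k) (v k)) ξ

lemma co_sub (u v : L2Vec d n) : co (u - v) = co u - co v := by
  ext k ξ; exact congrFun (coeff_sub (u k) (v k)) ξ

lemma co_smul (r : ℝ) (u : L2Vec d n) : co (r • u) = (r : ℂ) • co u := by
  ext k ξ; exact congrFun (coeff_smul r (u k)) ξ

lemma co_injective : Function.Injective (co : L2Vec d n → _) := fun _ _ h =>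
  funext fun k => coeff_injective (congrFun h k)

lemma exists_co_eq {a : Fin n → Freq d → ℂ} (ha : hsv 0 a < ⊤) (hh : ∀ k, Herm (a k)) :
    ∃ u : L2Vec d n, co u = a := by
  choose u hu using fun k => exists_coeff_eq ((hs_le_hsv 0 a k).trans_lt ha) (hh k)
  exact ⟨u, funext hu⟩

end torus

section quasiperiodic

/-! ### Curves along functions with continuous partial derivatives -/

/-- The factor h cancels in the difference quotient at 0, so Φ need only be continuous there. In
`hasDerivAt_line_of_partial` Φ is an average of a partial derivative. -/
lemma hasDerivAt_mul_of_continuousAt {Φ : ℝ → ℂ} (hΦ : ContinuousAt Φ 0) (w : ℂ) :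
    HasDerivAt (fun h : ℝ => (h : ℂ) * (w * Φ h)) (w * Φ 0) 0 := by
  rw [hasDerivAt_iff_tendsto_slope_zero]
  have h1 : Tendsto (fun h => w * Φ h) (𝓝[≠] 0) (𝓝 (w * Φ 0)) :=
    (hΦ.tendsto.mono_left nhdsWithin_le_nhds).const_mul w
  refine h1.congr' ?_
  filter_upwards [self_mem_nhdsWithin] with h hh
  have hh' : (h : ℂ) ≠ 0 := by exact_mod_cast hh
  rw [zero_add, Complex.ofReal_zero, zero_mul, sub_zero, Complex.real_smul, Complex.ofReal_inv,
    inv_mul_cancel_left₀ hh']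

variable {ν : ℕ}

lemma sub_eq_integral_partial {c D : (Fin ν → ℝ) → ℂ} (i : Fin ν)
    (hc : ∀ y, HasDerivAt (fun h : ℝ => c (y + Pi.single i h)) (D y) 0) (hD : Continuous D)
    (y : Fin ν → ℝ) (k : ℝ) :
    c (y + Pi.single i k) - c y = k * ∫ θ in (0 : ℝ)..1, D (y + Pi.single i (θ * k)) := by
  have hd : ∀ θ : ℝ, HasDerivAt (fun θ : ℝ => c (y + Pi.single i (θ * k)))
      (k * D (y + Pi.single i (θ * k))) θ := by
    intro θ
    have h1 := hc (y + Pi.single i (θ * k))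
    have h2 : HasDerivAt (fun r : ℝ => (r - θ) * k) k θ := by
      simpa using ((hasDerivAt_id' θ).sub_const θ).mul_const k
    have h1' : HasDerivAt (fun h : ℝ => c (y + Pi.single i (θ * k) + Pi.single i h))
        (D (y + Pi.single i (θ * k))) ((θ - θ) * k) := by simpa using h1
    have h3 := h1'.scomp θ h2
    rw [Complex.real_smul] at h3
    refine h3.congr_of_eventuallyEq (Eventually.of_forall fun r => ?_)
    simp only [Function.comp]
    rw [add_assoc, ← Pi.single_add]
    congr 3
    ring
  have hcont : Continuous fun θ : ℝ => (k : ℂ) * D (y + Pi.single i (θ * k)) := by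
    have : Continuous fun θ : ℝ => y + Pi.single i (θ * k) :=
      continuous_const.add ((continuous_single i).comp (by fun_prop))
    exact continuous_const.mul (hD.comp this)
  have h := intervalIntegral.integral_eq_sub_of_hasDerivAt (a := 0) (b := 1)
    (fun θ _ => hd θ) (hcont.intervalIntegrable _ _)
  rw [intervalIntegral.integral_const_mul] at h
  rw [h]
  simp

/-- Coordinates are switched on one at a time. The increment due to a new coordinate is h·w_a times
an average of D_a over a segment, and this average is continuous in h. -/
lemma hasDerivAt_line_of_partial {c : (Fin ν → ℝ) → ℂ} {D : Fin ν → (Fin ν → ℝ) → ℂ}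
    (hc : ∀ i y, HasDerivAt (fun h : ℝ => c (y + Pi.single i h)) (D i y) 0)
    (hD : ∀ i, Continuous (D i)) (w y : Fin ν → ℝ) :
    HasDerivAt (fun h : ℝ => c (y + h • w)) (∑ i, w i * D i y) 0 := by
  have key : ∀ s : Finset (Fin ν),
      HasDerivAt (fun h : ℝ => c (y + h • ∑ i ∈ s, Pi.single i (w i))) (∑ i ∈ s, w i * D i y) 0 := by
    intro s
    induction s using Finset.induction_on with
    | empty => simpa using hasDerivAt_const (0 : ℝ) (c y)
    | insert a s ha ih =>
      set w' : Fin ν → ℝ := ∑ i ∈ s, Pi.single i (w i) with hw'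
      let Φ : ℝ → ℂ := fun h => ∫ θ in (0 : ℝ)..1, D a (y + h • w' + Pi.single a (θ * (h * w a)))
      have hΦ : Continuous Φ := by
        refine intervalIntegral.continuous_parametric_intervalIntegral_of_continuous' ?_ 0 1
        have h1 : Continuous fun p : ℝ × ℝ =>
            y + p.1 • w' + Pi.single a (p.2 * (p.1 * w a)) :=
          (by fun_prop : Continuous fun p : ℝ × ℝ => y + p.1 • w').add
            ((continuous_single a).comp (by fun_prop))
        exact (hD a).comp h1
      have hΦ0 : Φ 0 = D a y := by simp [Φ]
      have h2 := (hasDerivAt_mul_of_continuousAt hΦ.continuousAt (w a)).add ih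
      rw [hΦ0] at h2
      rw [Finset.sum_insert ha, Finset.sum_insert ha]
      refine h2.congr_of_eventuallyEq (Eventually.of_forall fun h => ?_)
      have h3 := sub_eq_integral_partial a (hc a) (hD a) (y + h • w') (h * w a)
      have h4 : y + h • (Pi.single a (w a) + w') = y + h • w' + Pi.single a (h * w a) := by
        rw [smul_add, ← Pi.single_smul, smul_eq_mul]
        abel
      simp only [Pi.add_apply]
      rw [← hw', h4]
      refine (eq_add_of_sub_eq h3).trans ?_
      push_cast
      rw [mul_assoc]
  have := key Finset.univ
  rwa [Finset.univ_sum_single] at this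

/-! ### Coefficients of curves -/

variable {d n : ℕ}

lemma tendsto_coeff_of_hsv {T : Type*} {l : Filter T} {F : T → Fin n → Freq d → ℂ}
    {a : Fin n → Freq d → ℂ} {σ : ℝ} (h : Tendsto (fun t => hsv σ (F t - a)) l (𝓝 0)) (k : Fin n)
    (ξ : Freq d) : Tendsto (fun t => F t k ξ) l (𝓝 (a k ξ)) := by
  rw [tendsto_iff_edist_tendsto_0]
  have h1 : Tendsto (fun t => wt (-σ) ξ * hsv σ (F t - a)) l (𝓝 0) := by
    simpa using ENNReal.Tendsto.const_mul h (Or.inr (wt_ne_top (-σ) ξ))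
  refine tendsto_of_tendsto_of_tendsto_of_le_of_le tendsto_const_nhds h1 (fun _ => zero_le)
    fun t => ?_
  rw [edist_eq_enorm_sub]
  exact enorm_le_hsv σ (F t - a) k ξ

lemma continuousIn_iff {T : Type*} [TopologicalSpace T] {σ : ℝ} {I : Set T} {u : T → L2Vec d n} :
    ContinuousIn (sobolevNormVec σ) I u ↔
      ∀ t ∈ I, Tendsto (fun r => hsv σ (co (u r) - co (u t))) (𝓝[I] t) (𝓝 0) := by
  simp only [ContinuousIn, sobolevNormVec_eq, co_sub]

lemma hasDerivWithinAt_co {σ : ℝ} {I : Set ℝ} {u u' : ℝ → L2Vec d n}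
    (h : DerivativeIn (sobolevNormVec σ) I u u') {t : ℝ} (ht : t ∈ I) (k : Fin n) (ξ : Freq d) :
    HasDerivWithinAt (fun t => co (u t) k ξ) (co (u' t) k ξ) I t := by
  rw [hasDerivWithinAt_iff_tendsto_slope]
  have h1 := h t ht
  simp only [sobolevNormVec_eq, co_sub, co_smul] at h1
  refine (tendsto_coeff_of_hsv h1 k ξ).congr fun r => ?_
  rw [slope_def_module, Complex.real_smul]
  rfl

lemma toTorus_add (y z : Fin d → ℝ) : toTorus (y + z) = toTorus y + toTorus z := by
  ext i
  simp [toTorus]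

lemma continuous_toTorus : Continuous (toTorus (d := d)) :=
  continuous_pi fun i => (AddCircle.continuous_mk' _).comp (continuous_apply i)

lemma continuous_flow (ω : Fin ν → ℝ) : Continuous (flow ω) :=
  continuous_toTorus.comp (by fun_prop)

lemma flow_zero (ω : Fin ν → ℝ) : flow ω 0 = 0 := by
  ext i
  simp [flow, toTorus]

variable {s B : ℝ} {U : Torus ν → L2Vec d n} {dU : Fin ν → Torus ν → L2Vec d n}

lemma tendsto_flow {σ : ℝ} {W : Torus ν → L2Vec d n}
    (hW : ContinuousIn (sobolevNormVec σ) Set.univ W) (ω : Fin ν → ℝ) (t : ℝ) :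
    Tendsto (fun r => hsv σ (co (W (flow ω r)) - co (W (flow ω t)))) (𝓝 t) (𝓝 0) := by
  have h := continuousIn_iff.mp hW (flow ω t) trivial
  rw [nhdsWithin_univ] at h
  exact h.comp (continuous_flow ω).continuousAt

/-- The chain rule for the coefficients of `t ↦ U(ω t)`. -/
lemma hasDerivAt_flow (hU : TorusC1 (sobolevNormVec s) B U dU) (ω : Fin ν → ℝ) (t : ℝ)
    (k : Fin n) (ξ : Freq d) :
    HasDerivAt (fun t => co (U (flow ω t)) k ξ) (∑ i, ω i * co (dU i (flow ω t)) k ξ) t := by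
  have h1 : ∀ i (y : Fin ν → ℝ), HasDerivAt
      (fun h : ℝ => co (U (toTorus (y + Pi.single i h))) k ξ) (co (dU i (toTorus y)) k ξ) 0 := by
    intro i y
    rw [hasDerivAt_iff_tendsto_slope_zero]
    have h2 := hU.deriv i (toTorus y)
    simp only [sobolevNormVec_eq, co_sub, co_smul] at h2
    refine (tendsto_coeff_of_hsv h2 k ξ).congr fun r => ?_
    rw [Complex.real_smul, zero_add, Pi.single_zero, add_zero, toTorus_add]
    rfl
  have h2 : ∀ i, Continuous fun y : Fin ν → ℝ => co (dU i (toTorus y)) k ξ := by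
    intro i
    rw [continuous_iff_continuousAt]
    intro y
    have h := continuousIn_iff.mp (hU.cont_deriv i) (toTorus y) trivial
    rw [nhdsWithin_univ] at h
    exact tendsto_coeff_of_hsv (h.comp continuous_toTorus.continuousAt) k ξ
  have h3 := hasDerivAt_line_of_partial (c := fun y => co (U (toTorus y)) k ξ) h1 h2 ω (fun i => ω i * t)
  have h4 : HasDerivAt (fun r : ℝ => r - t) 1 t := (hasDerivAt_id' t).sub_const t
  have h3' : HasDerivAt (fun h : ℝ => co (U (toTorus ((fun i => ω i * t) + h • ω))) k ξ)
      (∑ i, ω i * co (dU i (flow ω t)) k ξ) (t - t) := by simpa [flow] using h3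
  have h5 := h3'.scomp (h := fun r => r - t) t h4
  rw [one_smul] at h5
  refine h5.congr_of_eventuallyEq (Eventually.of_forall fun r => ?_)
  simp only [Function.comp, flow]
  congr 3
  ext i
  simp
  ring

/-- A derivative taken in a weaker norm is identified coefficient by coefficient. It therefore
inherits from the partial derivatives of U their bounds and their continuity in H^s. -/
lemma co_derivative_flow (hU : TorusC1 (sobolevNormVec s) B U dU) {σ : ℝ} {ω : Fin ν → ℝ}
    {uω' : ℝ → L2Vec d n}
    (hd : DerivativeIn (sobolevNormVec σ) Set.univ (fun t => U (flow ω t)) uω') (t : ℝ) :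
    co (uω' t) = ∑ i, (ω i : ℂ) • co (dU i (flow ω t)) := by
  ext k ξ
  have h1 := (hasDerivWithinAt_co hd (Set.mem_univ t) k ξ).hasDerivAt univ_mem
  rw [h1.unique (hasDerivAt_flow hU ω t k ξ)]
  simp [Finset.sum_apply]

lemma hsv_sum_le {ι : Type*} (S : Finset ι) (σ : ℝ) (a : ι → Fin n → Freq d → ℂ) :
    hsv σ (∑ i ∈ S, a i) ≤ ∑ i ∈ S, hsv σ (a i) := by
  classical
  induction S using Finset.induction_on with
  | empty => simp [hsv_zero]
  | insert a S ha ih =>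
    rw [Finset.sum_insert ha, Finset.sum_insert ha]
    exact (hsv_add_le _ _ _).trans (by gcongr)

lemma hsv_derivative_flow_le (hU : TorusC1 (sobolevNormVec s) B U dU) {σ : ℝ} {ω : Fin ν → ℝ}
    {uω' : ℝ → L2Vec d n}
    (hd : DerivativeIn (sobolevNormVec σ) Set.univ (fun t => U (flow ω t)) uω') (t : ℝ) :
    hsv s (co (uω' t)) ≤ ∑ i, ‖(ω i : ℂ)‖ₑ * ENNReal.ofReal B := by
  rw [co_derivative_flow hU hd]
  refine (hsv_sum_le _ _ _).trans (Finset.sum_le_sum fun i _ => ?_)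
  rw [hsv_smul]
  gcongr
  rw [← sobolevNormVec_eq]
  exact hU.bound_deriv i _

lemma tendsto_derivative_flow (hU : TorusC1 (sobolevNormVec s) B U dU) {σ : ℝ} {ω : Fin ν → ℝ}
    {uω' : ℝ → L2Vec d n}
    (hd : DerivativeIn (sobolevNormVec σ) Set.univ (fun t => U (flow ω t)) uω') (t : ℝ) :
    Tendsto (fun r => hsv s (co (uω' r) - co (uω' t))) (𝓝 t) (𝓝 0) := by
  have h1 : Tendsto (fun r => ∑ i, ‖(ω i : ℂ)‖ₑ *
      hsv s (co (dU i (flow ω r)) - co (dU i (flow ω t)))) (𝓝 t) (𝓝 0) := by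
    have : ∀ i, Tendsto (fun r => ‖(ω i : ℂ)‖ₑ *
        hsv s (co (dU i (flow ω r)) - co (dU i (flow ω t)))) (𝓝 t) (𝓝 0) := fun i => by
      simpa using ENNReal.Tendsto.const_mul (tendsto_flow (hU.cont_deriv i) ω t)
        (Or.inr (enorm_ne_top (x := (ω i : ℂ))))
    simpa using tendsto_finsetSum Finset.univ fun i _ => this i
  refine tendsto_of_tendsto_of_tendsto_of_le_of_le tendsto_const_nhds h1 (fun _ => zero_le)
    fun r => ?_
  simp only [co_derivative_flow hU hd, ← Finset.sum_sub_distrib, ← smul_sub]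
  refine (hsv_sum_le _ _ _).trans (Finset.sum_le_sum fun i _ => ?_)
  rw [hsv_smul]

end quasiperiodic

section curves

variable {d n : ℕ} {σ τ : ℝ}

/-! ### Continuous curves in Sobolev spaces -/

/-- Continuity in time with values in `H^σ`. -/
def HCont (σ : ℝ) (a : ℝ → Fin n → Freq d → ℂ) : Prop :=
  ∀ t, Tendsto (fun r => hsv σ (a r - a t)) (𝓝 t) (𝓝 0)

lemma tendsto_zero_of_le {T : Type*} {l : Filter T} {f g : T → ℝ≥0∞} (h : ∀ r, f r ≤ g r)
    (hg : Tendsto g l (𝓝 0)) : Tendsto f l (𝓝 0) :=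
  tendsto_of_tendsto_of_tendsto_of_le_of_le tendsto_const_nhds hg (fun _ => zero_le) h

lemma tendsto_zero_const_mul {T : Type*} {l : Filter T} {g : T → ℝ≥0∞} {c : ℝ≥0∞} (hc : c ≠ ⊤)
    (hg : Tendsto g l (𝓝 0)) : Tendsto (fun r => c * g r) l (𝓝 0) := by
  simpa using ENNReal.Tendsto.const_mul hg (Or.inr hc)

variable {a b : ℝ → Fin n → Freq d → ℂ}

lemma HCont.mono (h : HCont τ a) (hστ : σ ≤ τ) : HCont σ a := fun t =>
  tendsto_zero_of_le (fun _ => hsv_mono hστ _) (h t)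

lemma HCont.continuous (h : HCont σ a) (k : Fin n) (ξ : Freq d) : Continuous fun t => a t k ξ :=
  continuous_iff_continuousAt.mpr fun t => tendsto_coeff_of_hsv (h t) k ξ

lemma HCont.add (ha : HCont σ a) (hb : HCont σ b) : HCont σ (fun t => a t + b t) := fun t => by
  refine tendsto_zero_of_le (fun r => ?_) (by simpa using (ha t).add (hb t))
  rw [add_sub_add_comm]
  exact hsv_add_le _ _ _

lemma HCont.sub (ha : HCont σ a) (hb : HCont σ b) : HCont σ (fun t => a t - b t) := fun t => by
  refine tendsto_zero_of_le (fun r => ?_) (by simpa using (ha t).add (hb t))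
  rw [sub_sub_sub_comm]
  exact hsv_sub_le _ _ _

lemma HCont.neg (ha : HCont σ a) : HCont σ (fun t => -a t) := fun t => by
  refine tendsto_zero_of_le (fun r => ?_) (ha t)
  rw [← neg_sub_neg, neg_neg, neg_neg, hsv_sub_comm]

lemma HCont.smul (ha : HCont σ a) (hfin : ∀ t, hsv σ (a t) < ⊤) {c : ℝ → ℂ} (hc : Continuous c) :
    HCont σ (fun t => c t • a t) := fun t => by
  have h1 : Tendsto (fun r => ‖c r‖ₑ * hsv σ (a r - a t)) (𝓝 t) (𝓝 0) := by
    have := ENNReal.Tendsto.mul ((hc.tendsto t).enorm) (Or.inr ENNReal.zero_ne_top) (ha t)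
      (Or.inr enorm_ne_top)
    simpa using this
  have h2 : Tendsto (fun r => hsv σ (a t) * ‖c r - c t‖ₑ) (𝓝 t) (𝓝 0) := by
    refine tendsto_zero_const_mul (hfin t).ne ?_
    have := ((hc.tendsto t).sub_const (c t)).enorm
    simpa using this
  refine tendsto_zero_of_le (fun r => ?_) (by simpa using h1.add h2)
  have : c r • a r - c t • a t = c r • (a r - a t) + (c r - c t) • a t := by
    rw [smul_sub, sub_smul]; abel
  rw [this, mul_comm (hsv σ (a t))]
  refine (hsv_add_le _ _ _).trans_eq ?_
  rw [hsv_smul, hsv_smul]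

lemma HCont.leray {a : ℝ → Fin d → Freq d → ℂ} (ha : HCont σ a) :
    HCont σ (fun t => leray (a t)) := fun t => by
  refine tendsto_zero_of_le (fun r => ?_) (tendsto_zero_const_mul (lerayConst_lt_top (d := d)).ne (ha t))
  rw [← leray_sub]
  exact hsv_leray_le σ _

lemma HCont.negLap (ha : HCont (σ + 2) a) : HCont σ (fun t => negLap (a t)) := fun t => by
  refine tendsto_zero_of_le (fun r => ?_) (ha t)
  rw [← negLap_sub]
  exact hsv_negLap_le σ _

lemma HCont.pres {a : ℝ → Fin d → Freq d → ℂ} (ha : HCont σ a) (t : ℝ) :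
    Tendsto (fun r => hs (σ + 1) (pres (a r) - pres (a t))) (𝓝 t) (𝓝 0) := by
  refine tendsto_zero_of_le (fun r => ?_)
    (tendsto_zero_const_mul (ENNReal.natCast_ne_top d) (ha t))
  rw [← pres_sub]
  exact hs_pres_le σ _

lemma hsv_le_add_hsv_sub (σ : ℝ) (a b : Fin n → Freq d → ℂ) :
    hsv σ a ≤ hsv σ b + hsv σ (a - b) := by
  have := hsv_add_le σ b (a - b)
  rwa [add_sub_cancel] at this

lemma HCont.adv {a : ℝ → Fin d → Freq d → ℂ} (hσ : 0 ≤ σ) (hσd : (d : ℝ) / 2 < σ)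
    (ha : HCont (σ + 1) a) (hfin : ∀ t, hsv (σ + 1) (a t) < ⊤) :
    HCont σ (fun t => adv (a t) (a t)) := fun t => by
  have h1 : Tendsto (fun r => (hsv (σ + 1) (a t) + hsv (σ + 1) (a r - a t) + hsv (σ + 1) (a t)) *
      hsv (σ + 1) (a r - a t)) (𝓝 t) (𝓝 0) := by
    have h2 := (ha t).const_add (hsv (σ + 1) (a t)) |>.add_const (hsv (σ + 1) (a t))
    have := ENNReal.Tendsto.mul h2 (Or.inr ENNReal.zero_ne_top) (ha t)
      (Or.inr (by simp [(hfin t).ne]))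
    simpa using this
  refine tendsto_zero_of_le (fun r => ?_)
    (tendsto_zero_const_mul (advConst_lt_top (n := d) hσd).ne h1)
  refine (hsv_adv_self_sub_le hσ (hfin r) (hfin t)).trans ?_
  gcongr
  exact hsv_le_add_hsv_sub _ _ _

/-! ### Derivatives of the heat flow and of the Duhamel integral -/

lemma hasDerivAt_neg_mul (m t : ℝ) : HasDerivAt (fun t : ℝ => -(m * t)) (-m) t :=
  ((hasDerivAt_id' t).const_mul m).neg.congr_deriv (by rw [mul_one])

lemma hasDerivAt_heat (μ : Freq d → ℝ) (a : Fin n → Freq d → ℂ) (t : ℝ) (k : Fin n) (ξ : Freq d) :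
    HasDerivAt (fun t => heat μ a t k ξ) (-(μ ξ : ℂ) * heat μ a t k ξ) t := by
  have h1 := hasDerivAt_neg_mul (μ ξ) t
  have h2 := (h1.exp.ofReal_comp).mul_const (a k ξ)
  refine h2.congr_deriv ?_
  simp only [heat]
  push_cast
  ring

lemma hasDerivAt_duh {μ : Freq d → ℝ} {g : ℝ → Fin n → Freq d → ℂ}
    (hg : ∀ k ξ, Continuous fun r => g r k ξ) (t : ℝ) (k : Fin n) (ξ : Freq d) :
    HasDerivAt (fun t => duh μ g t k ξ) (-(μ ξ : ℂ) * duh μ g t k ξ + g t k ξ) t := by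
  have h2 : Continuous fun r => (Real.exp (μ ξ * r) : ℂ) * g r k ξ := by
    have := hg k ξ
    fun_prop
  have h3 : HasDerivAt (fun t => ∫ r in (0 : ℝ)..t, (Real.exp (μ ξ * r) : ℂ) * g r k ξ)
      ((Real.exp (μ ξ * t) : ℂ) * g t k ξ) t :=
    intervalIntegral.integral_hasDerivAt_right (h2.intervalIntegrable _ _)
      (h2.stronglyMeasurableAtFilter _ _) h2.continuousAt
  have h4 := hasDerivAt_neg_mul (μ ξ) t
  have h5 := h4.exp.ofReal_comp.mul h3
  simp only [duh_eq]
  refine h5.congr_deriv ?_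
  have h6 : (Real.exp (-(μ ξ * t)) : ℂ) * (Real.exp (μ ξ * t) : ℂ) = 1 := by
    rw [← Complex.ofReal_mul, ← Real.exp_add]; simp
  rw [← mul_assoc ((Real.exp (-(μ ξ * t)) : ℂ)), h6]
  push_cast
  ring

/-- The Duhamel formula. -/
lemma eq_heat_add_duh {μ : Freq d → ℝ} {a g : ℝ → Fin n → Freq d → ℂ}
    (hg : ∀ k ξ, Continuous fun r => g r k ξ)
    (ha : ∀ t, 0 ≤ t → ∀ k ξ, HasDerivWithinAt (fun t => a t k ξ)
      (-(μ ξ : ℂ) * a t k ξ + g t k ξ) (Set.Ici 0) t) {t : ℝ} (ht : 0 ≤ t) :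
    a t = heat μ (a 0) t + duh μ g t := by
  ext k ξ
  let z : ℝ → ℂ := fun t => a t k ξ - (heat μ (a 0) t k ξ + duh μ g t k ξ)
  have hz : ∀ r, 0 ≤ r → HasDerivWithinAt z (-(μ ξ : ℂ) * z r) (Set.Ici 0) r := by
    intro r hr
    refine ((ha r hr k ξ).sub ((hasDerivAt_heat μ (a 0) r k ξ).add
      (hasDerivAt_duh hg r k ξ)).hasDerivWithinAt).congr_deriv ?_
    simp only [z]
    ring
  have he : ∀ r : ℝ, HasDerivAt (fun r : ℝ => (Real.exp (μ ξ * r) : ℂ))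
      ((μ ξ : ℂ) * (Real.exp (μ ξ * r) : ℂ)) r := by
    intro r
    have h4 : HasDerivAt (fun t : ℝ => μ ξ * t) (μ ξ) r := by
      simpa using (hasDerivAt_id' r).const_mul (μ ξ)
    refine h4.exp.ofReal_comp.congr_deriv ?_
    push_cast
    ring
  have hy : ∀ r, 0 ≤ r → HasDerivWithinAt (fun r => (Real.exp (μ ξ * r) : ℂ) * z r) 0
      (Set.Ici 0) r := by
    intro r hr
    refine ((he r).hasDerivWithinAt.mul (hz r hr)).congr_deriv ?_
    ring
  have hconst := constant_of_has_deriv_right_zero (a := 0) (b := t)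
    (f := fun r => (Real.exp (μ ξ * r) : ℂ) * z r)
    (fun r hr => ((hy r hr.1).continuousWithinAt).mono Set.Icc_subset_Ici_self)
    (fun r hr => (hy r hr.1).mono (Set.Ici_subset_Ici.mpr hr.1)) t ⟨ht, le_rfl⟩
  have hz0 : z 0 = 0 := by simp [z, heat, duh]
  simp only [hz0, mul_zero] at hconst
  have hexp : (Real.exp (μ ξ * t) : ℂ) ≠ 0 := by exact_mod_cast (Real.exp_pos _).ne'
  exact sub_eq_zero.mp ((mul_eq_zero.mp hconst).resolve_left hexp)

lemma Herm.heat {μ : Freq d → ℝ} (hμ : ∀ ξ, μ (-ξ) = μ ξ) {a : Fin n → Freq d → ℂ}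
    (ha : ∀ k, Herm (a k)) (t : ℝ) (k : Fin n) : Herm (heat μ a t k) := fun ξ => by
  simp only [NSTorus.heat, hμ, ha k ξ, star_mul', RCLike.star_def, Complex.conj_ofReal]

lemma Herm.duh {μ : Freq d → ℝ} (hμ : ∀ ξ, μ (-ξ) = μ ξ) {g : ℝ → Fin n → Freq d → ℂ}
    (hg : ∀ r k, Herm (g r k)) (t : ℝ) (k : Fin n) : Herm (duh μ g t k) := fun ξ => by
  rw [NSTorus.duh, NSTorus.duh, RCLike.star_def, intervalIntegral, intervalIntegral,
    map_sub, ← integral_conj, ← integral_conj]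
  simp only [hμ, hg _ k ξ, map_mul, Complex.conj_ofReal, RCLike.star_def]

end curves

section weighted_space

variable {d n : ℕ} {σ : ℝ}

/-! ### A Banach space of weighted sequences -/

/-- The weighted sequences. -/
abbrev SeqSpace (d n : ℕ) : Type := lp (fun _ : Fin n × Freq d => ℂ) 2

/-- The unweighted sequence. -/
def unweight (σ : ℝ) (y : SeqSpace d n) (k : Fin n) (ξ : Freq d) : ℂ :=
  ((bracket ξ ^ (-σ) : ℝ) : ℂ) * y (k, ξ)

lemma enorm_weight (σ : ℝ) (ξ : Freq d) : ‖((bracket ξ ^ σ : ℝ) : ℂ)‖ₑ = wt σ ξ := by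
  rw [wt, ← ofReal_norm, Complex.norm_real,
    Real.norm_of_nonneg (Real.rpow_nonneg (bracket_pos ξ).le _)]

lemma enorm_sq_seqSpace (y : SeqSpace d n) : ‖y‖ₑ ^ 2 = ∑' p, ‖y p‖ₑ ^ 2 := by
  have h1 := lp.norm_rpow_eq_tsum (p := 2) (by norm_num) y
  have h2 : Summable fun p => ‖y p‖ ^ 2 := by
    have := (lp.memℓp y).summable (by norm_num)
    simpa using this
  have h3 : ‖y‖ ^ 2 = ∑' p, ‖y p‖ ^ 2 := by simpa using h1
  simp only [← ofReal_norm]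
  rw [← ENNReal.ofReal_pow (norm_nonneg _), h3,
    ENNReal.ofReal_tsum_of_nonneg (fun _ => by positivity) h2]
  congr 1
  ext p
  rw [ENNReal.ofReal_pow (norm_nonneg _)]

/-- This isometry with a complete ℓ² space makes the contraction principle available for curves in
H^σ. -/
lemma hsv_unweight (σ : ℝ) (y : SeqSpace d n) : hsv σ (unweight σ y) = ‖y‖ₑ := by
  have h : hsv σ (unweight σ y) ^ 2 = ‖y‖ₑ ^ 2 := by
    rw [hsv_sq, enorm_sq_seqSpace, ENNReal.tsum_prod', tsum_fintype]
    refine Finset.sum_congr rfl fun k _ => tsum_congr fun ξ => ?_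
    rw [unweight, enorm_mul, enorm_weight, ← mul_assoc, mul_comm (wt σ ξ), wt_neg_mul, one_mul]
  exact le_antisymm (le_of_sq_le_sq_ennreal h.le) (le_of_sq_le_sq_ennreal h.ge)

lemma unweight_sub (σ : ℝ) (y z : SeqSpace d n) :
    unweight σ (y - z) = unweight σ y - unweight σ z := by
  ext k ξ
  simp only [unweight, Pi.sub_apply, lp.coeFn_sub]
  ring

lemma exists_unweight_eq {a : Fin n → Freq d → ℂ} (ha : hsv σ a < ⊤) :
    ∃ y : SeqSpace d n, unweight σ y = a := by
  let b : Fin n × Freq d → ℂ := fun p => ((bracket p.2 ^ σ : ℝ) : ℂ) * a p.1 p.2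
  have hb : ∑' p, ‖b p‖ₑ ^ 2 ≠ ⊤ := by
    have h1 := ENNReal.pow_lt_top (n := 2) ha
    rw [hsv_sq] at h1
    rw [ENNReal.tsum_prod', tsum_fintype]
    simpa only [b, enorm_mul, enorm_weight] using h1.ne
  have hmem : Memℓp b 2 := by
    rw [memℓp_gen_iff (by norm_num)]
    simpa using ENNReal.summable_toReal hb
  refine ⟨⟨b, hmem⟩, ?_⟩
  ext k ξ
  change ((bracket ξ ^ (-σ) : ℝ) : ℂ) * (((bracket ξ ^ σ : ℝ) : ℂ) * a k ξ) = a k ξ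
  rw [← mul_assoc, ← Complex.ofReal_mul, ← Real.rpow_add (bracket_pos ξ), neg_add_cancel,
    Real.rpow_zero, Complex.ofReal_one, one_mul]

lemma continuous_unweight (σ : ℝ) (k : Fin n) (ξ : Freq d) :
    Continuous fun y : SeqSpace d n => unweight σ y k ξ := by
  have h := (lp.uniformContinuous_coe (E := fun _ : Fin n × Freq d => ℂ) (p := 2)).continuous
  exact continuous_const.mul ((continuous_apply (k, ξ)).comp h)

/-- Bounded continuous curves in `H^σ` are bounded continuous functions with values in the space
of weighted sequences. -/
lemma exists_boundedContinuous {a : ℝ → Fin n → Freq d → ℂ} (hc : HCont σ a) {M : ℝ} (hM : 0 ≤ M)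
    (hb : ∀ t, hsv σ (a t) ≤ ENNReal.ofReal M) :
    ∃ V : BoundedContinuousFunction ℝ (SeqSpace d n), (∀ t, unweight σ (V t) = a t) ∧ ‖V‖ ≤ M := by
  choose y hy using fun t => exists_unweight_eq ((hb t).trans_lt ENNReal.ofReal_lt_top)
  have hcont : Continuous y := by
    rw [continuous_iff_continuousAt]
    intro t
    rw [ContinuousAt, tendsto_iff_edist_tendsto_0]
    refine (hc t).congr fun r => ?_
    rw [edist_eq_enorm_sub, ← hsv_unweight σ, unweight_sub, hy, hy]
  have hnorm : ∀ t, ‖y t‖ ≤ M := by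
    intro t
    rw [← ENNReal.ofReal_le_ofReal_iff hM, ofReal_norm, ← hsv_unweight σ, hy]
    exact hb t
  exact ⟨BoundedContinuousFunction.ofNormedAddCommGroup y hcont M hnorm, hy,
    BoundedContinuousFunction.norm_ofNormedAddCommGroup_le _ hM hnorm⟩

end weighted_space

section fixed_point

variable {d : ℕ} {σ α : ℝ}

/-! ### The nonlinear term -/

/-- The projected nonlinear term in the equation of a perturbation `v` of a solution `w`. -/
def pert (w v : Fin d → Freq d → ℂ) : Fin d → Freq d → ℂ :=
  -leray (adv (w + v) (w + v) - adv w w)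

/-- The constant of the estimate of the nonlinear term. -/
def pertConst (d : ℕ) (σ : ℝ) : ℝ≥0∞ := lerayConst d * advConst d d σ

lemma pertConst_lt_top (hσ : (d : ℝ) / 2 < σ) : pertConst d σ < ⊤ :=
  ENNReal.mul_lt_top lerayConst_lt_top (advConst_lt_top hσ)

lemma pert_zero (w : Fin d → Freq d → ℂ) : pert w 0 = 0 := by
  have : leray (0 : Fin d → Freq d → ℂ) = 0 := by simpa using leray_smul 0 (0 : Fin d → Freq d → ℂ)
  rw [pert, add_zero, sub_self, this, neg_zero]

lemma pert_zero_freq (w v : Fin d → Freq d → ℂ) (k : Fin d) : pert w v k 0 = 0 := by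
  simp [pert, leray_zero_freq]

lemma pert_sub (w v₁ v₂ : Fin d → Freq d → ℂ) :
    pert w v₁ - pert w v₂ = -leray (adv (w + v₁) (w + v₁) - adv (w + v₂) (w + v₂)) := by
  rw [pert, pert, neg_sub_neg, ← neg_sub, ← leray_sub, sub_sub_sub_cancel_right]

lemma hsv_pert_sub_le (hσ : 0 ≤ σ) {w v₁ v₂ : Fin d → Freq d → ℂ}
    (hw : hsv (σ + 1) w < ⊤) (h₁ : hsv (σ + 1) v₁ < ⊤) (h₂ : hsv (σ + 1) v₂ < ⊤) :
    hsv σ (pert w v₁ - pert w v₂) ≤ pertConst d σ *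
      ((hsv (σ + 1) w + hsv (σ + 1) v₁ + (hsv (σ + 1) w + hsv (σ + 1) v₂)) *
        hsv (σ + 1) (v₁ - v₂)) := by
  have f₁ := (hsv_add_le (σ + 1) w v₁).trans_lt (ENNReal.add_lt_top.mpr ⟨hw, h₁⟩)
  have f₂ := (hsv_add_le (σ + 1) w v₂).trans_lt (ENNReal.add_lt_top.mpr ⟨hw, h₂⟩)
  have h := hsv_adv_self_sub_le hσ f₁ f₂
  rw [add_sub_add_left_eq_sub] at h
  rw [pert_sub, hsv_neg, pertConst, mul_assoc]
  refine (hsv_leray_le σ _).trans ?_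
  gcongr
  refine h.trans ?_
  gcongr
  · exact hsv_add_le _ _ _
  · exact hsv_add_le _ _ _

lemma hsv_pert_le (hσ : 0 ≤ σ) {w v : Fin d → Freq d → ℂ}
    (hw : hsv (σ + 1) w < ⊤) (h : hsv (σ + 1) v < ⊤) :
    hsv σ (pert w v) ≤ pertConst d σ *
      ((hsv (σ + 1) w + hsv (σ + 1) v + hsv (σ + 1) w) * hsv (σ + 1) v) := by
  have := hsv_pert_sub_le hσ hw h (by rw [hsv_zero]; simp : hsv (σ + 1) (0 : Fin d → Freq d → ℂ) < ⊤)
  simpa [pert_zero, hsv_zero] using this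

lemma HCont.pert {w v : ℝ → Fin d → Freq d → ℂ} (hσ : 0 ≤ σ) (hσd : (d : ℝ) / 2 < σ)
    (hw : HCont (σ + 1) w) (hv : HCont (σ + 1) v) (hwf : ∀ t, hsv (σ + 1) (w t) < ⊤)
    (hvf : ∀ t, hsv (σ + 1) (v t) < ⊤) : HCont σ (fun t => pert (w t) (v t)) :=
  (((hw.add hv).adv hσ hσd fun t => (hsv_add_le _ _ _).trans_lt
    (ENNReal.add_lt_top.mpr ⟨hwf t, hvf t⟩)).sub (hw.adv hσ hσd hwf)).leray.neg

lemma Herm.neg {a : Freq d → ℂ} (ha : Herm a) : Herm (-a) := fun ξ => by simp [ha ξ]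

lemma Herm.pert {w v : Fin d → Freq d → ℂ} (hw : ∀ k, Herm (w k)) (hv : ∀ k, Herm (v k))
    (k : Fin d) : Herm (pert w v k) :=
  (Herm.leray (fun j => (Herm.adv (fun k => (hw k).add (hv k)) (fun k => (hw k).add (hv k)) j).sub
    (Herm.adv hw hw j)) k).neg

/-! ### The weighted nonlinear term -/

/-- The nonlinear term in the equation of `x = e^{α t} v`. -/
def wpert (α : ℝ) (w x : ℝ → Fin d → Freq d → ℂ) (r : ℝ) : Fin d → Freq d → ℂ :=
  (Real.exp (α * r) : ℂ) • pert (w r) ((Real.exp (-(α * r)) : ℂ) • x r)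

lemma enorm_ofReal_exp (r : ℝ) : ‖(Real.exp r : ℂ)‖ₑ = ENNReal.ofReal (Real.exp r) := by
  rw [← ofReal_norm, Complex.norm_real, Real.norm_of_nonneg (Real.exp_pos r).le]

lemma hsv_exp_smul_lt_top {x : Fin d → Freq d → ℂ} (hx : hsv σ x < ⊤) (r : ℝ) :
    hsv σ ((Real.exp r : ℂ) • x) < ⊤ := by
  rw [hsv_smul]
  exact ENNReal.mul_lt_top enorm_lt_top hx

/-- `pert` is Lipschitz in the perturbation. The growing factor e^{αr} is cancelled by the e^{-αr}
in the difference of the arguments, and in the prefactor e^{-αr} ≤ 1 because r ≥ 0. -/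
lemma hsv_wpert_sub_le (hσ : 0 ≤ σ) (hα : 0 ≤ α) {w x y : ℝ → Fin d → Freq d → ℂ} {r : ℝ}
    (hr : 0 ≤ r) (hw : hsv (σ + 1) (w r) < ⊤) (hx : hsv (σ + 1) (x r) < ⊤)
    (hy : hsv (σ + 1) (y r) < ⊤) :
    hsv σ (wpert α w x r - wpert α w y r) ≤ pertConst d σ *
      ((hsv (σ + 1) (w r) + hsv (σ + 1) (x r) + (hsv (σ + 1) (w r) + hsv (σ + 1) (y r))) *
        hsv (σ + 1) (x r - y r)) := by
  have hle : ∀ z : Fin d → Freq d → ℂ,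
      hsv (σ + 1) ((Real.exp (-(α * r)) : ℂ) • z) ≤ hsv (σ + 1) z := fun z => by
    rw [hsv_smul, enorm_ofReal_exp]
    refine mul_le_of_le_one_left zero_le ?_
    rw [← ENNReal.ofReal_one]
    apply ENNReal.ofReal_le_ofReal
    rw [Real.exp_le_one_iff]
    linarith [mul_nonneg hα hr]
  rw [wpert, wpert, ← smul_sub, hsv_smul]
  have h := hsv_pert_sub_le hσ hw (hsv_exp_smul_lt_top hx (-(α * r)))
    (hsv_exp_smul_lt_top hy (-(α * r)))
  rw [← smul_sub, hsv_smul _ _ (x r - y r)] at h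
  have he : ‖(Real.exp (α * r) : ℂ)‖ₑ * ‖(Real.exp (-(α * r)) : ℂ)‖ₑ = 1 := by
    rw [← enorm_mul, ← Complex.ofReal_mul, ← Real.exp_add]
    simp
  calc _ ≤ ‖(Real.exp (α * r) : ℂ)‖ₑ * (pertConst d σ *
      ((hsv (σ + 1) (w r) + hsv (σ + 1) (x r) + (hsv (σ + 1) (w r) + hsv (σ + 1) (y r))) *
        (‖(Real.exp (-(α * r)) : ℂ)‖ₑ * hsv (σ + 1) (x r - y r)))) := by
        gcongr
        refine h.trans ?_
        gcongr
        · exact hle _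
        · exact hle _
    _ = (‖(Real.exp (α * r) : ℂ)‖ₑ * ‖(Real.exp (-(α * r)) : ℂ)‖ₑ) * (pertConst d σ *
      ((hsv (σ + 1) (w r) + hsv (σ + 1) (x r) + (hsv (σ + 1) (w r) + hsv (σ + 1) (y r))) *
        hsv (σ + 1) (x r - y r))) := by ring
    _ = _ := by rw [he, one_mul]

lemma wpert_zero (α : ℝ) (w : ℝ → Fin d → Freq d → ℂ) (r : ℝ) : wpert α w 0 r = 0 := by
  simp [wpert, pert_zero]

lemma wpert_zero_freq (α : ℝ) (w x : ℝ → Fin d → Freq d → ℂ) (r : ℝ) (k : Fin d) :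
    wpert α w x r k 0 = 0 := by
  simp [wpert, pert_zero_freq]

lemma HCont.wpert {w x : ℝ → Fin d → Freq d → ℂ} (hσ : 0 ≤ σ) (hσd : (d : ℝ) / 2 < σ)
    (hw : HCont (σ + 1) w) (hx : HCont (σ + 1) x) (hwf : ∀ t, hsv (σ + 1) (w t) < ⊤)
    (hxf : ∀ t, hsv (σ + 1) (x t) < ⊤) : HCont σ (wpert α w x) := by
  have hv : HCont (σ + 1) fun r => (Real.exp (-(α * r)) : ℂ) • x r :=
    hx.smul hxf (by fun_prop)
  have hvf : ∀ r, hsv (σ + 1) ((Real.exp (-(α * r)) : ℂ) • x r) < ⊤ := fun r =>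
    hsv_exp_smul_lt_top (hxf r) _
  refine (hw.pert hσ hσd hv hwf hvf).smul (fun r => ?_) (by fun_prop)
  refine (hsv_pert_le hσ (hwf r) (hvf r)).trans_lt ?_
  exact ENNReal.mul_lt_top (pertConst_lt_top hσd) (ENNReal.mul_lt_top (ENNReal.add_lt_top.mpr
    ⟨ENNReal.add_lt_top.mpr ⟨hwf r, hvf r⟩, hwf r⟩) (hvf r))

lemma Herm.wpert {w x : ℝ → Fin d → Freq d → ℂ} (hw : ∀ r k, Herm (w r k))
    (hx : ∀ r k, Herm (x r k)) (r : ℝ) (k : Fin d) : Herm (wpert α w x r k) :=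
  (Herm.pert (hw r) (fun k => (hx r k).ofReal_smul _) k).ofReal_smul _

lemma duh_sub {n : ℕ} {μ : Freq d → ℝ} {g h : ℝ → Fin n → Freq d → ℂ}
    (hg : ∀ k ξ, Continuous fun r => g r k ξ) (hh : ∀ k ξ, Continuous fun r => h r k ξ) (t : ℝ) :
    duh μ g t - duh μ h t = duh μ (fun r => g r - h r) t := by
  ext k ξ
  simp only [duh, Pi.sub_apply, mul_sub (Complex.ofReal _)]
  exact (intervalIntegral.integral_sub (μ := volume)
    ((continuous_duh_integrand hg t k ξ).intervalIntegrable _ _)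
    ((continuous_duh_integrand hh t k ξ).intervalIntegrable _ _)).symm

/-! ### Existence of perturbations by a fixed point argument -/

/-- A nonzero integer vector has length at least 1, so subtracting α removes at most the fraction α
of |ξ|². -/
lemma damping_bounds (hα : 0 ≤ α) {ξ : Freq d} (hξ : ξ ≠ 0) :
    (1 - α) * bracket ξ ^ 2 ≤ euclLen ξ ^ 2 - α ∧ 1 - α ≤ euclLen ξ ^ 2 - α := by
  have h1 := one_le_bracket ξ
  rw [bracket_eq_euclLen hξ] at h1 ⊢
  have h2 : 1 ≤ euclLen ξ ^ 2 := one_le_pow₀ h1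
  constructor <;> nlinarith [mul_nonneg hα (sub_nonneg.mpr h2)]

/-- Bounded continuous curves of weighted sequences. -/
abbrev CurveSpace (d : ℕ) : Type := BoundedContinuousFunction ℝ (SeqSpace d d)

/-- Global existence and exponential decay of small perturbations of `w`, on the side of the
Fourier coefficients. -/
theorem exists_perturbation (hσ : (d : ℝ) / 2 < σ) (hα : 0 ≤ α) (hα1 : α < 1)
    {w : ℝ → Fin d → Freq d → ℂ} {v₀ : Fin d → Freq d → ℂ} {b δ : ℝ} (hb : 0 ≤ b) (hδ : 0 ≤ δ)
    (hw : HCont (σ + 1) w) (hwb : ∀ t, hsv (σ + 1) (w t) ≤ ENNReal.ofReal b)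
    (hwH : ∀ t k, Herm (w t k)) (hv₀ : hsv (σ + 1) v₀ ≤ ENNReal.ofReal δ)
    (hv₀0 : ∀ k, v₀ k 0 = 0) (hv₀H : ∀ k, Herm (v₀ k))
    (hsmall : pertConst d σ * ENNReal.ofReal (2 * (b + 2 * δ)) ≤ ENNReal.ofReal ((1 - α) / 2)) :
    ∃ v : ℝ → Fin d → Freq d → ℂ, HCont (σ + 1) v ∧ (∀ t, hsv (σ + 1) (v t) < ⊤) ∧
      (∀ t, 0 ≤ t → hsv (σ + 1) (v t) ≤ ENNReal.ofReal (2 * δ * Real.exp (-(α * t)))) ∧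
      (∀ t k, Herm (v t k)) ∧
      ∀ t, 0 ≤ t → v t = heat (fun ξ => euclLen ξ ^ 2) v₀ t +
        duh (fun ξ => euclLen ξ ^ 2) (fun r => pert (w r) (v r)) t := by
  have hσ0 : 0 ≤ σ := le_trans (by positivity) hσ.le
  have h1α : 0 < 1 - α := by linarith
  -- The fixed point is sought for x = e^{αt} v, whose linear part is damped by |ξ|² − α.
  set μ : Freq d → ℝ := fun ξ => euclLen ξ ^ 2 - α with hμdef
  have hμκ : ∀ ξ : Freq d, ξ ≠ 0 → (1 - α) * bracket ξ ^ 2 ≤ μ ξ := fun ξ hξ =>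
    (damping_bounds hα hξ).1
  have hμm : ∀ ξ : Freq d, ξ ≠ 0 → 1 - α ≤ μ ξ := fun ξ hξ => (damping_bounds hα hξ).2
  have hμ0 : ∀ ξ : Freq d, ξ ≠ 0 → 0 ≤ μ ξ := fun ξ hξ => h1α.le.trans (hμm ξ hξ)
  have hμneg : ∀ ξ : Freq d, μ (-ξ) = μ ξ := fun ξ => by simp [hμdef, euclLen_neg]
  have hwf : ∀ t, hsv (σ + 1) (w t) < ⊤ := fun t => (hwb t).trans_lt ENNReal.ofReal_lt_top
  let X : CurveSpace d → ℝ → Fin d → Freq d → ℂ := fun V t => unweight (σ + 1) (V t)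
  have hX0 : X 0 = 0 := by
    ext t k ξ
    exact mul_zero _
  have hXf : ∀ V t, hsv (σ + 1) (X V t) < ⊤ := fun V t => by
    simp only [X, hsv_unweight]; exact enorm_lt_top
  have hXn : ∀ V t, hsv (σ + 1) (X V t) ≤ ENNReal.ofReal ‖V‖ := fun V t => by
    simp only [X, hsv_unweight]
    rw [← ofReal_norm]
    exact ENNReal.ofReal_le_ofReal (V.norm_coe_le_norm t)
  have hXsub : ∀ V W t, hsv (σ + 1) (X V t - X W t) ≤ ENNReal.ofReal ‖V - W‖ := fun V W t => by
    simp only [X, ← unweight_sub, hsv_unweight]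
    rw [← ofReal_norm]
    exact ENNReal.ofReal_le_ofReal ((V - W).norm_coe_le_norm t)
  have hXc : ∀ V, HCont (σ + 1) (X V) := fun V t => by
    simp only [X, ← unweight_sub, hsv_unweight, ← edist_eq_enorm_sub]
    exact tendsto_iff_edist_tendsto_0.mp (V.continuous.tendsto t)
  have hgc : ∀ V, HCont σ (wpert α w (X V)) := fun V => hw.wpert hσ0 hσ (hXc V) hwf (hXf V)
  have hθ : 1 / (1 - α) * (1 / (1 - α)) ≤ (1 / (1 - α)) ^ 2 := by rw [sq]
  -- In the ball the nonlinear term has Lipschitz constant at most (1−α)/2 by `hsmall`. Smoothing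
  -- with κ = m = 1 − α contributes θ = 1/(1−α), so the product is 1/2.
  have hdiff : ∀ V W : CurveSpace d, ‖V‖ ≤ 2 * δ → ‖W‖ ≤ 2 * δ → ∀ t, 0 ≤ t →
      hsv (σ + 1) (duh μ (wpert α w (X V)) t - duh μ (wpert α w (X W)) t) ≤
        ENNReal.ofReal (1 / 2 * ‖V - W‖) := by
    intro V W hV hW t ht
    rw [duh_sub (hgc V).continuous (hgc W).continuous]
    have := hsv_duh_le (σ := σ) (μ := μ) (g := fun r => wpert α w (X V) r - wpert α w (X W) r)
      (((hgc V).sub (hgc W)).continuous) (fun r k => by simp [wpert_zero_freq]) h1α h1α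
      (by positivity) hθ hμκ hμm ht (M := ENNReal.ofReal ((1 - α) / 2) * ENNReal.ofReal ‖V - W‖)
      (fun r hr => by
        refine (hsv_wpert_sub_le hσ0 hα hr (hwf r) (hXf V r) (hXf W r)).trans ?_
        rw [← mul_assoc]
        refine mul_le_mul' (le_trans ?_ hsmall) (hXsub V W r)
        gcongr
        have e : ENNReal.ofReal (2 * (b + 2 * δ)) = ENNReal.ofReal b + ENNReal.ofReal (2 * δ) +
            (ENNReal.ofReal b + ENNReal.ofReal (2 * δ)) := by
          rw [← ENNReal.ofReal_add hb (by positivity), ← ENNReal.ofReal_add (by positivity)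
            (by positivity)]
          congr 1
          ring
        rw [e]
        have l1 := (hXn V r).trans (ENNReal.ofReal_le_ofReal hV)
        have l2 := (hXn W r).trans (ENNReal.ofReal_le_ofReal hW)
        have l3 := hwb r
        gcongr)
    refine this.trans_eq ?_
    rw [← ENNReal.ofReal_mul (by positivity), ← ENNReal.ofReal_mul (by positivity)]
    congr 1
    field_simp
  -- The map is needed on the whole space in order to be a function; outside the ball only
  -- boundedness of the image is obtained, through some constant M.
  have hmap : ∀ V : CurveSpace d, ∃ W : CurveSpace d, (∀ t, X W t = heat μ v₀ (max t 0) +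
      duh μ (wpert α w (X V)) (max t 0)) ∧ (‖V‖ ≤ 2 * δ → ‖W‖ ≤ 2 * δ) := by
    intro V
    obtain ⟨M, hM0, hM⟩ : ∃ M : ℝ, 0 ≤ M ∧ ∀ r, 0 ≤ r →
        hsv σ (wpert α w (X V) r) ≤ ENNReal.ofReal M := by
      refine ⟨(pertConst d σ * ((ENNReal.ofReal b + ENNReal.ofReal ‖V‖ +
        (ENNReal.ofReal b + 0)) * ENNReal.ofReal ‖V‖)).toReal, ENNReal.toReal_nonneg,
        fun r hr => ?_⟩
      rw [ENNReal.ofReal_toReal (ENNReal.mul_lt_top (pertConst_lt_top hσ) (ENNReal.mul_lt_top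
        (by simp) ENNReal.ofReal_lt_top)).ne]
      have h := hsv_wpert_sub_le (y := 0) hσ0 hα hr (hwf r) (hXf V r) (by simp [hsv_zero])
      rw [wpert_zero, sub_zero, Pi.zero_apply, hsv_zero, sub_zero] at h
      refine h.trans ?_
      have l1 := hXn V r
      have l3 := hwb r
      gcongr
    have hcont : HCont (σ + 1) fun t => heat μ v₀ (max t 0) +
        duh μ (wpert α w (X V)) (max t 0) :=
      HCont.add (fun t => tendsto_heat hv₀0 hμ0 (ne_top_of_le_ne_top ENNReal.ofReal_ne_top hv₀) t)
        (fun t => tendsto_duh (hgc V).continuous (wpert_zero_freq α w _) h1α hμκ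
          ENNReal.ofReal_ne_top hM t)
    have hheat : ∀ t : ℝ, hsv (σ + 1) (heat μ v₀ (max t 0)) ≤ ENNReal.ofReal δ := fun t =>
      (hsv_heat_le hv₀0 hμ0 (le_max_right _ _)).trans hv₀
    have hex : ∀ B : ℝ, 0 ≤ B → (∀ t, 0 ≤ t → hsv (σ + 1) (duh μ (wpert α w (X V)) t) ≤
        ENNReal.ofReal B) → ∃ W : CurveSpace d, (∀ t, X W t = heat μ v₀ (max t 0) +
        duh μ (wpert α w (X V)) (max t 0)) ∧ ‖W‖ ≤ δ + B := fun B hB h =>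
      exists_boundedContinuous hcont (by positivity) fun t => (hsv_add_le _ _ _).trans (by
        rw [ENNReal.ofReal_add hδ hB]
        exact add_le_add (hheat t) (h _ (le_max_right _ _)))
    by_cases hV : ‖V‖ ≤ 2 * δ
    -- Comparison with V = 0, whose Duhamel term vanishes: half of 2δ from the nonlinear term plus δ
    -- from the heat flow gives 2δ again.
    · obtain ⟨W, hW, hWn⟩ := hex δ hδ fun t ht => by
        have h := hdiff V 0 hV (by rw [norm_zero]; positivity) t ht
        have hd0 : duh μ (wpert α w (X 0)) t = 0 := by
          ext k ξ
          simp [duh, hX0, wpert_zero]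
        rw [hd0, sub_zero, sub_zero] at h
        exact h.trans (ENNReal.ofReal_le_ofReal (by linarith))
      exact ⟨W, hW, fun _ => by linarith⟩
    · obtain ⟨W, hW, -⟩ := hex (1 / (1 - α) * M) (by positivity) fun t ht => by
        rw [ENNReal.ofReal_mul (by positivity)]
        exact hsv_duh_le (hgc V).continuous (wpert_zero_freq α w _) h1α h1α
          (by positivity) hθ hμκ hμm ht hM
      exact ⟨W, hW, fun h => absurd h hV⟩
  choose Φ hΦ hΦn using hmap
  -- Hermitian symmetry is a closed condition preserved by the map; imposing it here makes the fixed
  -- point the coefficients of a real field.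
  let S : Set (CurveSpace d) := {V | ‖V‖ ≤ 2 * δ ∧ ∀ t k ξ, X V t k (-ξ) = star (X V t k ξ)}
  have hSclosed : IsClosed S := by
    have hS : S = {V : CurveSpace d | ‖V‖ ≤ 2 * δ} ∩
        ⋂ t, ⋂ k, ⋂ ξ, {V : CurveSpace d | X V t k (-ξ) = star (X V t k ξ)} := by
      ext V
      simp [S]
    rw [hS]
    refine (isClosed_le continuous_norm continuous_const).inter ?_
    refine isClosed_iInter fun t => isClosed_iInter fun k => isClosed_iInter fun ξ => ?_
    have hev : ∀ ξ, Continuous fun V : CurveSpace d => X V t k ξ := fun ξ =>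
      (continuous_unweight (σ + 1) k ξ).comp (continuous_eval_const t)
    exact isClosed_eq (hev _) (hev _).star
  have hSmaps : Set.MapsTo Φ S S := by
    rintro V ⟨hV, hVH⟩
    refine ⟨hΦn V hV, fun t k ξ => ?_⟩
    rw [hΦ V]
    exact (Herm.heat hμneg hv₀H _ k).add (Herm.duh hμneg
      (fun r k => Herm.wpert hwH (fun r k => hVH r k) r k) _ k) ξ
  have hcontr : ContractingWith (1 / 2) (hSmaps.restrict Φ S S) := by
    refine ⟨by norm_num, LipschitzWith.of_dist_le_mul ?_⟩
    rintro ⟨V, hV⟩ ⟨W, hW⟩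
    change dist (Φ V) (Φ W) ≤ _ * dist V W
    rw [dist_eq_norm, dist_eq_norm]
    rw [BoundedContinuousFunction.norm_le (by positivity)]
    intro t
    rw [← ENNReal.ofReal_le_ofReal_iff (by positivity), ofReal_norm, BoundedContinuousFunction.sub_apply,
      ← hsv_unweight (σ + 1), unweight_sub]
    change hsv (σ + 1) (X (Φ V) t - X (Φ W) t) ≤ _
    rw [hΦ, hΦ, add_sub_add_left_eq_sub]
    simpa using hdiff V W hV.1 hW.1 _ (le_max_right t 0)
  have h0S : (0 : CurveSpace d) ∈ S := ⟨by rw [norm_zero]; positivity, fun t k ξ => by simp [hX0]⟩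
  obtain ⟨V, hVS, hVfix, -⟩ := hcontr.exists_fixedPoint' hSclosed.isComplete hSmaps h0S
    (edist_ne_top _ _)
  have hV : ∀ t, 0 ≤ t → X V t = heat μ v₀ t + duh μ (wpert α w (X V)) t := fun t ht => by
    have := hΦ V t
    rwa [hVfix.eq, max_eq_left ht] at this
  -- Removing the weight turns the bound 2δ into exponential decay and restores the damping |ξ|² in
  -- the heat and Duhamel terms.
  refine ⟨fun t => (Real.exp (-(α * t)) : ℂ) • X V t, (hXc V).smul (hXf V) (by fun_prop),
    fun t => hsv_exp_smul_lt_top (hXf V t) _, fun t ht => ?_,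
    fun t k => Herm.ofReal_smul (fun ξ => hVS.2 t k ξ) _, fun t ht => ?_⟩
  · rw [hsv_smul, enorm_ofReal_exp, mul_comm, ENNReal.ofReal_mul (by positivity)]
    gcongr
    exact (hXn V t).trans (ENNReal.ofReal_le_ofReal hVS.1)
  · beta_reduce
    rw [hV t ht]
    ext k ξ
    simp only [Pi.smul_apply, Pi.add_apply, smul_eq_mul, mul_add, heat, duh]
    congr 1
    · rw [← mul_assoc, ← Complex.ofReal_mul, ← Real.exp_add]
      congr 3
      simp only [hμdef]
      ring
    · rw [← intervalIntegral.integral_const_mul]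
      congr 1
      ext r
      simp only [wpert, Pi.smul_apply, smul_eq_mul]
      rw [← mul_assoc, ← mul_assoc, ← Complex.ofReal_mul, ← Complex.ofReal_mul, ← Real.exp_add,
        ← Real.exp_add]
      congr 3
      simp only [hμdef]
      ring

end fixed_point

section navier_stokes

variable {d : ℕ} {σ : ℝ}

/-! ### The Navier-Stokes equation in terms of Fourier coefficients -/

/-- The Fourier coefficients of `u' - Δu + u · ∇u + ∇p`. -/
def nsCoeff (a a' : Fin d → Freq d → ℂ) (c : Freq d → ℂ) (k : Fin d) : Freq d → ℂ :=
  a' k + negLap a k + adv a a k + dcoef k c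

lemma coeff_residual {u u' : L2Vec d d} {p : L2 d} {Du : Fin d → Fin d → L2 d}
    {Lu Dp : Fin d → L2 d} (hDu : ∀ j k, IsPartial j (u k) (Du j k))
    (hLu : ∀ k, IsLaplacian (u k) (Lu k)) (hDp : ∀ k, IsPartial k p (Dp k)) (k : Fin d) :
    Integrable (fun x => u' k x - Lu k x + (∑ j, u j x * Du j k x) + Dp k x) ∧
    coeff (fun x => u' k x - Lu k x + (∑ j, u j x * Du j k x) + Dp k x) =
      nsCoeff (co u) (co u') (coeff p) k := by
  have i1 : Integrable fun x => u' k x - Lu k x := (integrable_L2 _).sub (integrable_L2 _)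
  have i2 : Integrable fun x => ∑ j, u j x * Du j k x :=
    integrable_finsetSum _ fun j _ => integrable_mul_L2 (u j) (Du j k)
  have i3 : Integrable fun x => u' k x - Lu k x + ∑ j, u j x * Du j k x := i1.add i2
  refine ⟨i3.add (integrable_L2 _), ?_⟩
  rw [coeff_add_fun i3 (integrable_L2 _), coeff_add_fun i1 i2,
    coeff_sub_fun (integrable_L2 _) (integrable_L2 _),
    coeff_sum_fun _ fun j _ => integrable_mul_L2 (u j) (Du j k)]
  have e1 : ∀ j, coeff (Du j k) = dcoef j (co u k) := fun j => by
    ext ξ; exact hDu j k ξ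
  have e2 : coeff (Lu k) = -negLap (co u) k := by
    ext ξ
    rw [hLu k ξ, Pi.neg_apply, negLap, co, neg_mul]
  have e3 : coeff (Dp k) = dcoef k (coeff p) := by
    ext ξ; exact hDp k ξ
  simp only [coeff_mul, e1, e2, e3, nsCoeff]
  ext ξ
  simp only [Pi.add_apply, sub_neg_eq_add, Finset.sum_apply, adv, co]

lemma NavierStokesAt.coeff_eq {F : Torus d → EuclideanSpace ℝ (Fin d)} {u u' : L2Vec d d}
    {p : L2 d} (h : NavierStokesAt F u u' p) (k : Fin d) :
    Integrable (fun x => F x k) ∧ coeff (fun x => F x k) = nsCoeff (co u) (co u') (coeff p) k := by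
  obtain ⟨-, Du, Lu, Dp, hDu, hLu, hDp, hF⟩ := h
  obtain ⟨h1, h2⟩ := coeff_residual (u' := u') hDu hLu hDp k
  exact ⟨h1.congr (hF k), by rw [← h2]; exact (coeff_congr (hF k)).symm⟩

/-- The space derivatives are built from their coefficients. The residual contains products of L²
functions and is only integrable, so the equation follows from uniqueness of coefficients in L¹. -/
lemma navierStokesAt_of_coeff {F : Torus d → EuclideanSpace ℝ (Fin d)} {u u' : L2Vec d d}
    {p : L2 d} (hdiv : DivFree u) (hu : hsv 2 (co u) < ⊤) (hp : hs 1 (coeff p) < ⊤)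
    (hF : ∀ k, Integrable (fun x => F x k))
    (h : ∀ k, coeff (fun x => F x k) = nsCoeff (co u) (co u') (coeff p) k) :
    NavierStokesAt F u u' p := by
  have hu1 : ∀ k, hs 1 (coeff (u k)) < ⊤ := fun k =>
    ((hs_mono one_le_two _).trans (hs_le_hsv 2 (co u) k)).trans_lt hu
  choose Du hDu using fun j k => exists_coeff_eq (hs_zero_dcoef_lt_top (hu1 k) j)
    ((herm_coeff (u k)).dcoef j)
  have hL : hsv 0 (-negLap (co u)) < ⊤ := by
    rw [hsv_neg]
    refine (hsv_negLap_le 0 _).trans_lt ?_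
    rwa [zero_add]
  obtain ⟨Lu, hLu⟩ := exists_co_eq hL fun k =>
    (Herm.negLap (fun j => herm_coeff (u j)) k).neg
  choose Dp hDp using fun k => exists_coeff_eq (hs_zero_dcoef_lt_top hp k)
    ((herm_coeff p).dcoef k)
  have pDu : ∀ j k, IsPartial j (u k) (Du j k) := fun j k ξ => congrFun (hDu j k) ξ
  have pLu : ∀ k, IsLaplacian (u k) (Lu k) := fun k ξ => by
    have := congrFun (congrFun hLu k) ξ
    rw [co] at this
    rw [this, neg_mul]
    rfl
  have pDp : ∀ k, IsPartial k p (Dp k) := fun k ξ => congrFun (hDp k) ξ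
  refine ⟨hdiv, Du, Lu, Dp, pDu, pLu, pDp, fun k => ?_⟩
  obtain ⟨h1, h2⟩ := coeff_residual (u' := u') pDu pLu pDp k
  have h3 := ae_eq_zero_of_coeff (h1.sub (hF k)) fun ξ => by
    have : coeff ((fun x => u' k x - Lu k x + (∑ j, u j x * Du j k x) + Dp k x) -
        fun x => F x k) = 0 := by
      rw [← sub_self (coeff fun x => F x k)]
      nth_rewrite 1 [h k]
      rw [← h2]
      exact coeff_sub_fun h1 (hF k)
    rw [this, Pi.zero_apply]
  filter_upwards [h3] with x hx
  exact sub_eq_zero.mp hx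

lemma divFree_iff {u : L2Vec d d} : DivFree u ↔ ∀ ξ : Freq d, ∑ j, (ξ j : ℂ) * co u j ξ = 0 := by
  refine forall_congr' fun ξ => ?_
  simp only [mul_assoc, ← Finset.mul_sum]
  rw [mul_eq_zero, or_iff_right Complex.I_ne_zero]
  rfl

lemma adv_zero_freq_of_div {a : Fin d → Freq d → ℂ} (ha : hsv 1 a < ⊤)
    (hdiv : ∀ ξ : Freq d, ∑ j, (ξ j : ℂ) * a j ξ = 0) (k : Fin d) : adv a a k 0 = 0 := by
  refine adv_zero_freq ((hsv_mono zero_le_one a).trans_lt ha) ha (fun ξ => ?_) k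
  simp only [mul_assoc, ← Finset.mul_sum, hdiv ξ, mul_zero]

lemma leray_eq_add_grad_pres {N : Fin d → Freq d → ℂ} (h0 : ∀ k, N k 0 = 0) (k : Fin d) :
    leray N k = N k + dcoef k (pres N) := by
  ext ξ
  by_cases hξ : ξ = 0
  · subst hξ
    simp [leray, dcoef, h0]
  · simp only [leray, pres, dcoef, if_neg hξ, Pi.add_apply]
    have hI := Complex.I_mul_I
    linear_combination (-(ξ k : ℂ) * (∑ j, (ξ j : ℂ) * N j ξ) / ((euclLen ξ ^ 2 : ℝ) : ℂ)) * hI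

/-- Elimination of the pressure. -/
lemma pressure_elimination {D Z N : Fin d → Freq d → ℂ} {c : Freq d → ℂ}
    (h : ∀ k, D k + negLap Z k + N k + dcoef k c = 0)
    (hD : ∀ ξ : Freq d, ∑ j, (ξ j : ℂ) * D j ξ = 0) (hZ : ∀ ξ : Freq d, ∑ j, (ξ j : ℂ) * Z j ξ = 0)
    (hN : ∀ k, N k 0 = 0) :
    (∀ ξ ≠ 0, c ξ = pres N ξ) ∧ ∀ k, D k = -negLap Z k - leray N k := by
  have hc : ∀ ξ ≠ 0, c ξ = pres N ξ := by
    intro ξ hξ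
    have hp : ((euclLen ξ ^ 2 : ℝ) : ℂ) ≠ 0 := by
      have := euclLen_pos hξ
      exact_mod_cast (by positivity : euclLen ξ ^ 2 ≠ 0)
    -- Divergence of the equation: D and Z drop out, leaving ξ·N + i|ξ|² c = 0, which determines c
    -- off the origin.
    have h1 : ∑ k, (ξ k : ℂ) * (D k + negLap Z k + N k + dcoef k c) ξ = 0 :=
      Finset.sum_eq_zero fun k _ => by rw [h k, Pi.zero_apply, mul_zero]
    have h2 : ∑ k, (ξ k : ℂ) * (D k + negLap Z k + N k + dcoef k c) ξ =
        ∑ k, (ξ k : ℂ) * D k ξ + ((euclLen ξ ^ 2 : ℝ) : ℂ) * ∑ k, (ξ k : ℂ) * Z k ξ +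
          ∑ k, (ξ k : ℂ) * N k ξ + (∑ k, (ξ k : ℂ) * (ξ k : ℂ)) * (Complex.I * c ξ) := by
      rw [Finset.mul_sum, Finset.sum_mul, ← Finset.sum_add_distrib, ← Finset.sum_add_distrib,
        ← Finset.sum_add_distrib]
      refine Finset.sum_congr rfl fun k _ => ?_
      simp only [Pi.add_apply, negLap, dcoef]
      ring
    rw [h2, hD, hZ, sum_coord_mul_coord, mul_zero, zero_add, zero_add] at h1
    rw [pres, if_neg hξ, eq_div_iff hp]
    linear_combination (-Complex.I) * h1 + (c ξ * ((euclLen ξ ^ 2 : ℝ) : ℂ)) * Complex.I_mul_I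
  refine ⟨hc, fun k => ?_⟩
  have h1 : dcoef k c = dcoef k (pres N) := by
    ext ξ
    by_cases hξ : ξ = 0
    · subst hξ; simp [dcoef]
    · rw [dcoef, dcoef, hc ξ hξ]
  have h2 := h k
  rw [h1] at h2
  rw [leray_eq_add_grad_pres hN, ← sub_eq_zero, ← h2]
  abel

/-! ### Uniqueness -/

/-- Two bounded solutions with the same initial value coincide, on the side of the Fourier
coefficients. -/
theorem eq_of_projected_equation (hσ : (d : ℝ) / 2 < σ) {y u : ℝ → Fin d → Freq d → ℂ}
    (hy : HCont (σ + 1) y) (hu : HCont (σ + 1) u) {M : ℝ≥0∞} (hM : M < ⊤)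
    (hyM : ∀ t, hsv (σ + 1) (y t) ≤ M) (huM : ∀ t, hsv (σ + 1) (u t) ≤ M) (h0 : y 0 = u 0)
    (hd : ∀ t, 0 ≤ t → ∀ k ξ, HasDerivWithinAt (fun t => (y t - u t) k ξ)
      (-negLap (y t - u t) k ξ - leray (adv (y t) (y t) - adv (u t) (u t)) k ξ) (Set.Ici 0) t) :
    ∀ t, 0 ≤ t → y t = u t := by
  have hσ0 : 0 ≤ σ := le_trans (by positivity) hσ.le
  have hyf : ∀ t, hsv (σ + 1) (y t) < ⊤ := fun t => (hyM t).trans_lt hM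
  have huf : ∀ t, hsv (σ + 1) (u t) < ⊤ := fun t => (huM t).trans_lt hM
  set L : ℝ≥0∞ := lerayConst d * (advConst d d σ * (M + M)) with hL
  have hLt : L < ⊤ := ENNReal.mul_lt_top lerayConst_lt_top
    (ENNReal.mul_lt_top (advConst_lt_top hσ) (ENNReal.add_lt_top.mpr ⟨hM, hM⟩))
  -- With β = m² − 1 the damping |ξ|² + β is at least m² for ξ ≠ 0 and at least ⟨ξ⟩², so smoothing
  -- holds with κ = 1 and θ = 1/m. Then m ≥ 2L gives the factor L/m ≤ 1/2, and m ≥ 1 gives β ≥ 0.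
  set m : ℝ := max 1 (2 * L.toReal) with hm
  have hm1 : 1 ≤ m := le_max_left _ _
  have hm0 : 0 < m := by linarith
  set β : ℝ := m ^ 2 - 1 with hβ
  have hβ0 : 0 ≤ β := by nlinarith
  let x : ℝ → Fin d → Freq d → ℂ := fun t => (Real.exp (-(β * t)) : ℂ) • (y t - u t)
  let N : ℝ → Fin d → Freq d → ℂ := fun t => -leray (adv (y t) (y t) - adv (u t) (u t))
  let g : ℝ → Fin d → Freq d → ℂ := fun t => (Real.exp (-(β * t)) : ℂ) • N t
  have hNle : ∀ t, hsv σ (N t) ≤ L * hsv (σ + 1) (y t - u t) := by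
    intro t
    simp only [N]
    rw [hsv_neg, hL, mul_assoc, mul_assoc]
    refine (hsv_leray_le σ _).trans ?_
    gcongr
    refine (hsv_adv_self_sub_le hσ0 (hyf t) (huf t)).trans ?_
    gcongr
    · exact hyM t
    · exact huM t
  have hzf : ∀ t, hsv (σ + 1) (y t - u t) ≤ M + M := fun t =>
    (hsv_sub_le _ _ _).trans (add_le_add (hyM t) (huM t))
  have hMM : M + M < ⊤ := ENNReal.add_lt_top.mpr ⟨hM, hM⟩
  have hNc : HCont σ N := ((hy.adv hσ0 hσ hyf).sub (hu.adv hσ0 hσ huf)).leray.neg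
  have hgc : HCont σ g := hNc.smul (fun t => (hNle t).trans_lt
    (ENNReal.mul_lt_top hLt ((hzf t).trans_lt hMM))) (by fun_prop)
  have hx : ∀ t, 0 ≤ t → x t = duh (fun ξ : Freq d => euclLen ξ ^ 2 + β) g t := by
    intro t ht
    have := eq_heat_add_duh (μ := fun ξ : Freq d => euclLen ξ ^ 2 + β) (a := x) (g := g)
      hgc.continuous (fun t ht k ξ => by
        have he : HasDerivAt (fun t : ℝ => (Real.exp (-(β * t)) : ℂ))
            (-(β : ℂ) * (Real.exp (-(β * t)) : ℂ)) t := by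
          refine (hasDerivAt_neg_mul β t).exp.ofReal_comp.congr_deriv ?_
          push_cast
          ring
        refine (he.hasDerivWithinAt.mul (hd t ht k ξ)).congr_deriv ?_
        simp only [x, g, N, Pi.smul_apply, Pi.neg_apply, smul_eq_mul, negLap]
        push_cast
        ring) ht
    rw [this]
    have hx0 : x 0 = 0 := by simp [x, h0]
    ext k ξ
    simp [heat, hx0]
  -- S is finite since both solutions are bounded; S ≤ S/2 then forces S = 0.
  set S : ℝ≥0∞ := ⨆ t : Set.Ici (0 : ℝ), hsv (σ + 1) (x t) with hS
  have hxle : ∀ t, 0 ≤ t → hsv (σ + 1) (x t) ≤ S := fun t ht =>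
    le_iSup (fun t : Set.Ici (0 : ℝ) => hsv (σ + 1) (x t)) ⟨t, ht⟩
  have hSt : S < ⊤ := by
    refine lt_of_le_of_lt (iSup_le ?_) hMM
    rintro ⟨t, ht⟩
    simp only [x]
    rw [hsv_smul, enorm_ofReal_exp]
    refine le_trans (mul_le_of_le_one_left zero_le ?_) (hzf t)
    rw [← ENNReal.ofReal_one]
    apply ENNReal.ofReal_le_ofReal
    rw [Real.exp_le_one_iff]
    linarith [mul_nonneg hβ0 (Set.mem_Ici.mp ht)]
  have hgle : ∀ t, 0 ≤ t → hsv σ (g t) ≤ L * S := fun t ht => by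
    have h1 := hxle t ht
    simp only [x, g] at h1 ⊢
    rw [hsv_smul] at h1 ⊢
    calc _ ≤ ‖(Real.exp (-(β * t)) : ℂ)‖ₑ * (L * hsv (σ + 1) (y t - u t)) := by
          gcongr; exact hNle t
      _ = L * (‖(Real.exp (-(β * t)) : ℂ)‖ₑ * hsv (σ + 1) (y t - u t)) := by ring
      _ ≤ _ := by gcongr
  have hSle : S ≤ ENNReal.ofReal (1 / 2) * S := by
    refine iSup_le ?_
    rintro ⟨t, ht⟩
    rw [hx t ht]
    refine (hsv_duh_le (θ := 1 / m) (κ := 1) (m := m ^ 2) hgc.continuous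
      (fun r k => by simp [g, N, leray_zero_freq]) one_pos (by positivity) (by positivity)
      (le_of_eq (by field_simp)) (fun ξ hξ => ?_) (fun ξ hξ => ?_) ht hgle).trans ?_
    · rw [bracket_eq_euclLen hξ]; linarith
    · have h1 := one_le_bracket ξ
      rw [bracket_eq_euclLen hξ] at h1
      have := one_le_pow₀ (n := 2) h1
      linarith
    · rw [← mul_assoc]
      gcongr
      rw [← ENNReal.ofReal_toReal hLt.ne, ← ENNReal.ofReal_mul (by positivity)]
      apply ENNReal.ofReal_le_ofReal
      rw [one_div_mul_eq_div, div_le_iff₀ hm0]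
      linarith [le_max_right 1 (2 * L.toReal)]
  have hS0 : S = 0 := by
    by_contra hne
    have h2 : ENNReal.ofReal (1 / 2) * S < 1 * S := by
      refine ENNReal.mul_lt_mul_left hne hSt.ne ?_
      rw [← ENNReal.ofReal_one]
      exact (ENNReal.ofReal_lt_ofReal_iff one_pos).mpr (by norm_num)
    rw [one_mul] at h2
    exact absurd hSle (not_le.mpr h2)
  intro t ht
  have h1 : hsv (σ + 1) (x t) = 0 := le_antisymm (hS0 ▸ hxle t ht) zero_le
  have h2 := eq_zero_of_hsv_eq_zero h1
  have h3 : (Real.exp (-(β * t)) : ℂ) ≠ 0 := by exact_mod_cast (Real.exp_pos _).ne'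
  exact sub_eq_zero.mp ((smul_eq_zero.mp h2).resolve_left h3)

end navier_stokes

section solutions

variable {d : ℕ} {σ : ℝ}

/-! ### Uniqueness of global classical solutions -/

lemma hasDerivWithinAt_sum_coord {u u' : ℝ → L2Vec d d}
    (h : DerivativeIn (sobolevNormVec σ) (Set.Ici 0) u u') {t : ℝ} (ht : 0 ≤ t) (ξ : Freq d) :
    HasDerivWithinAt (fun t => ∑ j, (ξ j : ℂ) * co (u t) j ξ)
      (∑ j, (ξ j : ℂ) * co (u' t) j ξ) (Set.Ici 0) t :=
  HasDerivWithinAt.fun_sum fun j _ => (hasDerivWithinAt_co h (Set.mem_Ici.mpr ht) j ξ).const_mul _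

lemma sum_coord_derivative_eq_zero {u u' : ℝ → L2Vec d d}
    (h : DerivativeIn (sobolevNormVec σ) (Set.Ici 0) u u') (hdiv : ∀ t, 0 ≤ t → DivFree (u t))
    {t : ℝ} (ht : 0 ≤ t) (ξ : Freq d) : ∑ j, (ξ j : ℂ) * co (u' t) j ξ = 0 := by
  have h1 := hasDerivWithinAt_sum_coord h ht ξ
  have h2 : HasDerivWithinAt (fun t => ∑ j, (ξ j : ℂ) * co (u t) j ξ) 0 (Set.Ici 0) t :=
    (hasDerivWithinAt_const t _ (0 : ℂ)).congr (fun r hr => divFree_iff.mp (hdiv r hr) ξ)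
      (divFree_iff.mp (hdiv t ht) ξ)
  exact (uniqueDiffOn_Ici (0 : ℝ) t ht).eq_deriv _ h1 h2

/-- `HCont` refers to all of ℝ; curves on the half-line are extended by their initial value. -/
lemma hCont_max_zero {a : ℝ → Fin d → Freq d → ℂ}
    (h : ∀ t ∈ Set.Ici (0 : ℝ), Tendsto (fun r => hsv σ (a r - a t)) (𝓝[Set.Ici 0] t) (𝓝 0)) :
    HCont σ (fun t => a (max t 0)) := fun t => by
  refine (h (max t 0) (Set.mem_Ici.mpr (le_max_right _ _))).comp ?_
  exact tendsto_nhdsWithin_iff.mpr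
    ⟨(continuous_id.max continuous_const).tendsto t, Eventually.of_forall fun r => Set.mem_Ici.mpr (le_max_right _ _)⟩

variable {F : ℝ → Torus d → EuclideanSpace ℝ (Fin d)}

/-- The equation of the difference of two solutions, in terms of Fourier coefficients. -/
lemma NavierStokesAt.difference {F : Torus d → EuclideanSpace ℝ (Fin d)} {u u' v v' : L2Vec d d}
    {p q : L2 d} (hu : NavierStokesAt F u u' p) (hv : NavierStokesAt F v v' q) (k : Fin d) :
    (co v' - co u') k + negLap (co v - co u) k + (adv (co v) (co v) - adv (co u) (co u)) k +
      dcoef k (coeff q - coeff p) = 0 := by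
  have h1 := (hu.coeff_eq k).2
  rw [(hv.coeff_eq k).2] at h1
  rw [nsCoeff, nsCoeff] at h1
  rw [negLap_sub, dcoef_sub, Pi.sub_apply, Pi.sub_apply, Pi.sub_apply, ← sub_eq_zero.mpr h1]
  abel

/-- The force cancels in the difference of two solutions, and `pressure_elimination` leaves the
projected equation of the velocities. Once these agree, the pressures agree at ξ ≠ 0 because the
difference of the advection terms is zero, and at ξ = 0 by the normalisation of the mean. -/
theorem IsGlobalClassicalSolution.unique (hσ : (d : ℝ) / 2 < σ) {u₀ : L2Vec d d}
    {u u' v v' : ℝ → L2Vec d d} {p q : ℝ → L2 d}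
    (hu : IsGlobalClassicalSolution (σ + 1) F u₀ u u' p)
    (hv : IsGlobalClassicalSolution (σ + 1) F u₀ v v' q) {t : ℝ} (ht : 0 ≤ t) :
    v t = u t ∧ q t = p t := by
  have hσ0 : 0 ≤ σ := le_trans (by positivity) hσ.le
  have hfin : ∀ {v v' : ℝ → L2Vec d d} {q : ℝ → L2 d},
      IsGlobalClassicalSolution (σ + 1) F u₀ v v' q → ∃ M : ℝ≥0, ∀ t, 0 ≤ t →
        hsv (σ + 1) (co (v t)) ≤ M := fun h => by
    obtain ⟨M, hM⟩ := h.regular.1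
    exact ⟨M, fun t ht => by rw [← sobolevNormVec_eq]; exact hM t ht⟩
  obtain ⟨M₁, hM₁⟩ := hfin hu
  obtain ⟨M₂, hM₂⟩ := hfin hv
  have hdu : ∀ t, 0 ≤ t → ∀ ξ : Freq d, ∑ j, (ξ j : ℂ) * co (u t) j ξ = 0 := fun t ht =>
    divFree_iff.mp (hu.solves.2 t ht).1
  have hdv : ∀ t, 0 ≤ t → ∀ ξ : Freq d, ∑ j, (ξ j : ℂ) * co (v t) j ξ = 0 := fun t ht =>
    divFree_iff.mp (hv.solves.2 t ht).1
  have helim : ∀ t, 0 ≤ t →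
      (∀ ξ ≠ 0, (coeff (q t) - coeff (p t)) ξ =
        pres (adv (co (v t)) (co (v t)) - adv (co (u t)) (co (u t))) ξ) ∧
      ∀ k, (co (v' t) - co (u' t)) k = -negLap (co (v t) - co (u t)) k -
        leray (adv (co (v t)) (co (v t)) - adv (co (u t)) (co (u t))) k := by
    intro t ht
    refine pressure_elimination (fun k => (hu.solves.2 t ht).difference (hv.solves.2 t ht) k)
      (fun ξ => ?_) (fun ξ => ?_) fun k => ?_
    · simp only [Pi.sub_apply, mul_sub, Finset.sum_sub_distrib]
      rw [sum_coord_derivative_eq_zero hv.solves.1 (fun t ht => (hv.solves.2 t ht).1) ht,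
        sum_coord_derivative_eq_zero hu.solves.1 (fun t ht => (hu.solves.2 t ht).1) ht, sub_zero]
    · simp only [Pi.sub_apply, mul_sub, Finset.sum_sub_distrib]
      rw [hdv t ht, hdu t ht, sub_zero]
    · have f : ∀ {a : Fin d → Freq d → ℂ} {M : ℝ≥0}, hsv (σ + 1) a ≤ M → hsv 1 a < ⊤ :=
        fun h => ((hsv_mono (by linarith) _).trans h).trans_lt ENNReal.coe_lt_top
      rw [Pi.sub_apply, Pi.sub_apply, adv_zero_freq_of_div (f (hM₂ t ht)) (hdv t ht),
        adv_zero_freq_of_div (f (hM₁ t ht)) (hdu t ht), sub_zero]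
  have hco : ∀ t, 0 ≤ t → co (v t) = co (u t) := by
    intro t ht
    have hyc := hCont_max_zero (a := fun t => co (v t)) (continuousIn_iff.mp hv.regular.2)
    have huc := hCont_max_zero (a := fun t => co (u t)) (continuousIn_iff.mp hu.regular.2)
    have h := eq_of_projected_equation hσ hyc huc (M := ((max M₁ M₂ : ℝ≥0) : ℝ≥0∞))
      ENNReal.coe_lt_top
      (fun t => (hM₂ _ (le_max_right _ _)).trans (by exact_mod_cast le_max_right _ _))
      (fun t => (hM₁ _ (le_max_right _ _)).trans (by exact_mod_cast le_max_left _ _))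
      (by simp only [max_self, hu.initial, hv.initial]) (fun t ht k ξ => ?_) t ht
    · simpa only [max_eq_left ht] using h
    · have h1 := (hasDerivWithinAt_co hv.solves.1 (Set.mem_Ici.mpr ht) k ξ).sub
        (hasDerivWithinAt_co hu.solves.1 (Set.mem_Ici.mpr ht) k ξ)
      have h2 := congrFun ((helim t ht).2 k) ξ
      simp only [max_eq_left ht]
      refine (h1.congr_deriv h2).congr (fun r hr => ?_) ?_
      · simp only [max_eq_left (Set.mem_Ici.mp hr)]
        rfl
      · simp only [max_eq_left ht]
        rfl
  refine ⟨co_injective (hco t ht), coeff_injective ?_⟩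
  ext ξ
  rw [← sub_eq_zero]
  by_cases hξ : ξ = 0
  · subst hξ
    dsimp only
    rw [(coeff_zero_freq_eq_zero_iff _).mpr (hv.mean_pressure t ht),
      (coeff_zero_freq_eq_zero_iff _).mpr (hu.mean_pressure t ht), sub_zero]
  · have h := (helim t ht).1 ξ hξ
    rw [hco t ht, sub_self, pres, if_neg hξ] at h
    simpa using h

end solutions

section mild

variable {d : ℕ} {σ : ℝ}

/-! ### Properties of mild solutions -/

lemma sum_coord_heat_add_duh {μ : Freq d → ℝ} {a : Fin d → Freq d → ℂ}
    {g : ℝ → Fin d → Freq d → ℂ} (ha : ∀ ξ : Freq d, ∑ j, (ξ j : ℂ) * a j ξ = 0)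
    (hg : ∀ r, ∀ ξ : Freq d, ∑ j, (ξ j : ℂ) * g r j ξ = 0)
    (hc : ∀ k ξ, Continuous fun r => g r k ξ) (t : ℝ) (ξ : Freq d) :
    ∑ j, (ξ j : ℂ) * (heat μ a t + duh μ g t) j ξ = 0 := by
  have h1 : ∑ j, (ξ j : ℂ) * heat μ a t j ξ = 0 := by
    simp only [heat, mul_left_comm (ξ _ : ℂ), ← Finset.mul_sum, ha ξ, mul_zero]
  have h2 : ∑ j, (ξ j : ℂ) * duh μ g t j ξ = 0 := by
    simp only [duh, ← intervalIntegral.integral_const_mul]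
    rw [← intervalIntegral.integral_finsetSum fun j _ =>
      ((continuous_duh_integrand hc t j ξ).const_mul (ξ j : ℂ)).intervalIntegrable _ _]
    simp only [mul_left_comm (ξ _ : ℂ), ← Finset.mul_sum, hg _ ξ, mul_zero,
      intervalIntegral.integral_zero]
  simp only [Pi.add_apply, mul_add, Finset.sum_add_distrib, h1, h2, add_zero]

lemma sum_coord_pert (w v : Fin d → Freq d → ℂ) (ξ : Freq d) :
    ∑ j, (ξ j : ℂ) * pert w v j ξ = 0 := by
  simp only [pert, Pi.neg_apply, mul_neg, Finset.sum_neg_distrib, sum_coord_mul_leray, neg_zero]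

/-- The integrated form of the equation, which is what `tendsto_difference_quotient` requires. -/
lemma sub_eq_integral_of_mild {v g : ℝ → Fin d → Freq d → ℂ} {v₀ : Fin d → Freq d → ℂ}
    (hv : ∀ k ξ, Continuous fun r => v r k ξ) (hg : ∀ k ξ, Continuous fun r => g r k ξ)
    (h : ∀ t, 0 ≤ t → v t = heat (fun ξ => euclLen ξ ^ 2) v₀ t + duh (fun ξ => euclLen ξ ^ 2) g t)
    {t r : ℝ} (ht : 0 ≤ t) (hr : 0 ≤ r) (k : Fin d) (ξ : Freq d) :
    v r k ξ - v t k ξ = ∫ q in t..r, (-negLap (v q) + g q) k ξ := by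
  set m : ℝ → ℂ := fun t => (heat (fun ξ => euclLen ξ ^ 2) v₀ t +
    duh (fun ξ => euclLen ξ ^ 2) g t) k ξ with hm
  have hpos : ∀ q ∈ Set.uIcc t r, 0 ≤ q := fun q hq => (le_min ht hr).trans hq.1
  have hd : ∀ q ∈ Set.uIcc t r, HasDerivAt m ((-negLap (v q) + g q) k ξ) q := fun q hq => by
    refine ((hasDerivAt_heat _ v₀ q k ξ).add (hasDerivAt_duh hg q k ξ)).congr_deriv ?_
    simp only [Pi.add_apply, Pi.neg_apply, negLap, h q (hpos q hq)]
    ring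
  have hc : Continuous fun q => (-negLap (v q) + g q) k ξ := by
    have h1 := hv k ξ
    have h2 := hg k ξ
    simp only [Pi.add_apply, Pi.neg_apply, negLap]
    fun_prop
  rw [intervalIntegral.integral_eq_sub_of_hasDerivAt hd (hc.intervalIntegrable _ _), h r hr, h t ht]

/-! ### Time derivative and pressure of a perturbation -/

/-- The time derivative of the perturbation `v` of a solution `w`. -/
def pertDeriv (w v : Fin d → Freq d → ℂ) : Fin d → Freq d → ℂ := -negLap v + pert w v

/-- The difference of the pressures of `w + v` and of `w`. -/
def pertPres (w v : Fin d → Freq d → ℂ) : Freq d → ℂ :=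
  pres (adv (w + v) (w + v) - adv w w)

lemma pertPres_zero_freq (w v : Fin d → Freq d → ℂ) : pertPres w v 0 = 0 := if_pos rfl

/-- Leray projection amounts to adding the gradient of `pres`, provided that the mean vanishes; for
the advection terms this is the role of the divergence conditions. -/
lemma pertDeriv_equation {w v : Fin d → Freq d → ℂ} (hw : hsv 1 w < ⊤) (hv : hsv 1 v < ⊤)
    (hdw : ∀ ξ : Freq d, ∑ j, (ξ j : ℂ) * w j ξ = 0)
    (hdv : ∀ ξ : Freq d, ∑ j, (ξ j : ℂ) * v j ξ = 0) (k : Fin d) :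
    pertDeriv w v k + negLap v k + (adv (w + v) (w + v) - adv w w) k +
      dcoef k (pertPres w v) = 0 := by
  have h0 : ∀ k, (adv (w + v) (w + v) - adv w w) k 0 = 0 := fun k => by
    rw [Pi.sub_apply, Pi.sub_apply, adv_zero_freq_of_div hw hdw,
      adv_zero_freq_of_div ((hsv_add_le _ _ _).trans_lt (ENNReal.add_lt_top.mpr ⟨hw, hv⟩))
        fun ξ => by
          simp only [Pi.add_apply, mul_add, Finset.sum_add_distrib, hdw ξ, hdv ξ, add_zero],
      sub_zero]
  have h1 := leray_eq_add_grad_pres h0 k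
  rw [pertDeriv, pertPres, pert, Pi.add_apply, Pi.neg_apply, Pi.neg_apply, h1]
  abel

/-- Perturbed and unperturbed fields see the same force, so the force never has to be estimated. -/
lemma nsCoeff_add {w w' v : Fin d → Freq d → ℂ} {c : Freq d → ℂ} (hw : hsv 1 w < ⊤)
    (hv : hsv 1 v < ⊤) (hdw : ∀ ξ : Freq d, ∑ j, (ξ j : ℂ) * w j ξ = 0)
    (hdv : ∀ ξ : Freq d, ∑ j, (ξ j : ℂ) * v j ξ = 0) (k : Fin d) :
    nsCoeff (w + v) (w' + pertDeriv w v) (c + pertPres w v) k = nsCoeff w w' c k := by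
  have h := pertDeriv_equation hw hv hdw hdv k
  have h1 : negLap (w + v) k = negLap w k + negLap v k := by
    ext ξ; simp only [negLap, Pi.add_apply]; ring
  have h2 : dcoef k (c + pertPres w v) = dcoef k c + dcoef k (pertPres w v) := by
    ext ξ; simp only [dcoef, Pi.add_apply]; ring
  rw [nsCoeff, nsCoeff, h1, h2, Pi.add_apply, ← sub_eq_zero, ← h, Pi.sub_apply]
  abel

lemma Herm.pertDeriv {w v : Fin d → Freq d → ℂ} (hw : ∀ k, Herm (w k)) (hv : ∀ k, Herm (v k))
    (k : Fin d) : Herm (pertDeriv w v k) :=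
  (Herm.negLap hv k).neg.add (Herm.pert hw hv k)

lemma Herm.pertPres {w v : Fin d → Freq d → ℂ} (hw : ∀ k, Herm (w k)) (hv : ∀ k, Herm (v k)) :
    Herm (pertPres w v) :=
  Herm.pres fun j => (Herm.adv (fun k => (hw k).add (hv k)) (fun k => (hw k).add (hv k)) j).sub
    (Herm.adv hw hw j)

lemma hsv_pertDeriv_le {w v : Fin d → Freq d → ℂ} :
    hsv (σ - 1) (pertDeriv w v) ≤ hsv (σ + 1) v + hsv σ (pert w v) := by
  refine (hsv_add_le _ _ _).trans (add_le_add ?_ (hsv_mono (by linarith) _))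
  rw [hsv_neg]
  refine (hsv_negLap_le _ _).trans_eq ?_
  congr 1
  ring

lemma HCont.pertDeriv {w v : ℝ → Fin d → Freq d → ℂ} (hσ : 0 ≤ σ) (hσd : (d : ℝ) / 2 < σ)
    (hw : HCont (σ + 1) w) (hv : HCont (σ + 1) v) (hwf : ∀ t, hsv (σ + 1) (w t) < ⊤)
    (hvf : ∀ t, hsv (σ + 1) (v t) < ⊤) : HCont (σ - 1) (fun t => pertDeriv (w t) (v t)) := by
  have h1 : HCont (σ - 1 + 2) v := by convert hv using 1; ring
  exact h1.negLap.neg.add ((hw.pert hσ hσd hv hwf hvf).mono (by linarith))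

lemma HCont.pertPres {w v : ℝ → Fin d → Freq d → ℂ} (hσ : 0 ≤ σ) (hσd : (d : ℝ) / 2 < σ)
    (hw : HCont (σ + 1) w) (hv : HCont (σ + 1) v) (hwf : ∀ t, hsv (σ + 1) (w t) < ⊤)
    (hvf : ∀ t, hsv (σ + 1) (v t) < ⊤) (t : ℝ) :
    Tendsto (fun r => hs (σ + 1) (pertPres (w r) (v r) - pertPres (w t) (v t))) (𝓝 t) (𝓝 0) :=
  (((hw.add hv).adv hσ hσd fun t => (hsv_add_le _ _ _).trans_lt
    (ENNReal.add_lt_top.mpr ⟨hwf t, hvf t⟩)).sub (hw.adv hσ hσd hwf)).pres t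

lemma hs_pertPres_le (hσ : 0 ≤ σ) {w v : Fin d → Freq d → ℂ}
    (hw : hsv (σ + 1) w < ⊤) (hv : hsv (σ + 1) v < ⊤) :
    hs (σ + 1) (pertPres w v) ≤ d * (advConst d d σ *
      ((hsv (σ + 1) w + hsv (σ + 1) v + hsv (σ + 1) w) * hsv (σ + 1) v)) := by
  refine (hs_pres_le σ _).trans ?_
  gcongr
  have h := hsv_adv_self_sub_le hσ
    ((hsv_add_le _ _ _).trans_lt (ENNReal.add_lt_top.mpr ⟨hw, hv⟩)) hw
  rw [add_sub_cancel_left] at h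
  refine h.trans ?_
  gcongr
  exact hsv_add_le _ _ _

end mild

section existence

variable {d ν : ℕ} {σ : ℝ}

/-! ### Existence of the global solution -/

lemma boundedContinuousIn_of_hCont {u : ℝ → L2Vec d d} (hc : HCont σ fun t => co (u t))
    {M : ℝ≥0∞} (hM : M < ⊤) (hu : ∀ t, 0 ≤ t → hsv σ (co (u t)) ≤ M) :
    BoundedContinuousIn (sobolevNormVec σ) (Set.Ici 0) u :=
  ⟨⟨M.toNNReal, fun t ht => by
      rw [ENNReal.coe_toNNReal hM.ne, sobolevNormVec_eq]
      exact hu t ht⟩,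
    continuousIn_iff.mpr fun t _ => (hc t).mono_left nhdsWithin_le_nhds⟩

lemma BoundedContinuousIn.mono {τ : ℝ} (hτ : τ ≤ σ) {I : Set ℝ} {u : ℝ → L2Vec d d}
    (h : BoundedContinuousIn (sobolevNormVec σ) I u) :
    BoundedContinuousIn (sobolevNormVec τ) I u := by
  have hle : ∀ v : L2Vec d d, sobolevNormVec τ v ≤ sobolevNormVec σ v := fun v => by
    rw [sobolevNormVec_eq, sobolevNormVec_eq]
    exact hsv_mono hτ _
  obtain ⟨⟨M, hM⟩, hc⟩ := h
  exact ⟨⟨M, fun t ht => (hle _).trans (hM t ht)⟩,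
    fun t ht => tendsto_zero_of_le (fun _ => hle _) (hc t ht)⟩

lemma DerivativeIn.add {I : Set ℝ} {u u' v v' : ℝ → L2Vec d d}
    (hu : DerivativeIn (sobolevNormVec σ) I u u') (hv : DerivativeIn (sobolevNormVec σ) I v v') :
    DerivativeIn (sobolevNormVec σ) I (fun t => u t + v t) (fun t => u' t + v' t) := by
  intro t ht
  refine tendsto_zero_of_le (fun r => ?_) (by simpa using (hu t ht).add (hv t ht))
  rw [add_sub_add_comm, smul_add, add_sub_add_comm]
  simp only [sobolevNormVec_eq]
  rw [co_add]
  exact hsv_add_le _ _ _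

lemma DerivativeIn.mono_set {V : Type*} [AddCommGroup V] [Module ℝ V] {N : V → ℝ≥0∞} {I J : Set ℝ}
    (hIJ : I ⊆ J) {u u' : ℝ → V} (h : DerivativeIn N J u u') : DerivativeIn N I u u' :=
  fun t ht => (h t (hIJ ht)).mono_left (nhdsWithin_mono _ (Set.sdiff_subset_sdiff_left hIJ))

/-- The solution is the quasi-periodic one plus functions with coefficients v, `pertDeriv` and
`pertPres`, so the decay estimates concern these three alone. The pressure bound is quadratic in δ,
as the nonlinearity is. -/
theorem exists_stable_solution (hd : 2 ≤ d) (hσ : (d : ℝ) / 2 < σ) {α K ε δ : ℝ} (hα : 0 ≤ α)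
    (hα1 : α < 1) (hK : 0 ≤ K) (hδ : 0 ≤ δ) (hεδ : ε ≤ δ)
    {f : Torus ν × Torus d → EuclideanSpace ℝ (Fin d)} {ω : Fin ν → ℝ} {U : Torus ν → L2Vec d d}
    {P : Torus ν → L2 d} {uω' : ℝ → L2Vec d d}
    (hQ : IsQuasiPeriodicSolution (σ + 1) ε K f ω U P uω') {u₀ : L2Vec d d} (hdiv : DivFree u₀)
    (hu₀ : sobolevNormVec (σ + 1) (u₀ - U 0) ≤ ENNReal.ofReal δ)
    (hmean : ∀ k, ∫ x, (u₀ k x - U 0 k x) = 0)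
    (hsmall : pertConst d σ * ENNReal.ofReal (2 * (K * δ + 2 * δ)) ≤
      ENNReal.ofReal ((1 - α) / 2)) :
    ∃ (u u' : ℝ → L2Vec d d) (p : ℝ → L2 d),
      IsGlobalClassicalSolution (σ + 1) (force ε f ω) u₀ u u' p ∧
      ∀ t, 0 ≤ t → (∀ k, ∫ x, (u t k x - U (flow ω t) k x) = 0) ∧
        sobolevNormVec (σ + 1) (u t - U (flow ω t)) ≤
          ENNReal.ofReal (2 * δ * Real.exp (-(α * t))) ∧
        sobolevNormVec (σ + 1 - 2) (u' t - uω' t) ≤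
          ENNReal.ofReal (4 * δ * Real.exp (-(α * t))) ∧
        sobolevNorm (σ + 1) (p t - P (flow ω t)) ≤ d * (advConst d d σ *
          ENNReal.ofReal (2 * (K * δ + 2 * δ) * (2 * δ * Real.exp (-(α * t))))) := by
  have hσ1 : 1 ≤ σ := by
    have : (2 : ℝ) ≤ d := by exact_mod_cast hd
    linarith
  have hσ0 : 0 ≤ σ := by linarith
  have hσ2 : σ + 1 - 2 = σ - 1 := by ring
  obtain ⟨dU, hU⟩ := hQ.regular
  have hsol := hQ.solves.2
  set w : ℝ → Fin d → Freq d → ℂ := fun t => co (U (flow ω t)) with hw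
  have hwc : HCont (σ + 1) w := tendsto_flow hU.cont ω
  have hwb : ∀ t, hsv (σ + 1) (w t) ≤ ENNReal.ofReal (K * δ) := fun t => by
    rw [hw, ← sobolevNormVec_eq]
    refine (hU.bound _).trans (ENNReal.ofReal_le_ofReal ?_)
    gcongr
  have hwf : ∀ t, hsv (σ + 1) (w t) < ⊤ := fun t => (hwb t).trans_lt ENNReal.ofReal_lt_top
  have hwH : ∀ t k, Herm (w t k) := fun t k => herm_coeff _
  have hwd : ∀ t, ∀ ξ : Freq d, ∑ j, (ξ j : ℂ) * w t j ξ = 0 := fun t =>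
    divFree_iff.mp (hsol t trivial).1
  set v₀ : Fin d → Freq d → ℂ := co (u₀ - U 0) with hv₀
  have hv₀d : ∀ ξ : Freq d, ∑ j, (ξ j : ℂ) * v₀ j ξ = 0 := fun ξ => by
    have h := hwd 0 ξ
    simp only [hw, flow_zero] at h
    simp only [hv₀, co_sub, Pi.sub_apply, mul_sub, Finset.sum_sub_distrib, h,
      divFree_iff.mp hdiv ξ, sub_zero]
  obtain ⟨v, hvc, hvf, hvb, hvH, hv⟩ := exists_perturbation hσ hα hα1 (b := K * δ) (δ := δ)
    (mul_nonneg hK hδ) hδ hwc hwb hwH (v₀ := v₀) (by rw [hv₀, ← sobolevNormVec_eq]; exact hu₀)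
    (fun k => by
      have h := (coeff_zero_freq_eq_zero_iff _).mpr (hmean k)
      rw [coeff_sub_fun (integrable_L2 _) (integrable_L2 _)] at h
      rw [hv₀, co_sub]
      exact h) (fun k => herm_coeff _) hsmall
  have hgc : HCont σ fun t => pert (w t) (v t) := hwc.pert hσ0 hσ hvc hwf hvf
  have hv0 : v 0 = v₀ := by
    rw [hv 0 le_rfl]
    ext k ξ
    simp [heat, duh]
  have hvz : ∀ t, 0 ≤ t → ∀ k, v t k 0 = 0 := fun t ht k => by
    rw [hv t ht, Pi.add_apply, Pi.add_apply, duh_zero_freq fun r k => pert_zero_freq _ _ k, heat,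
      ← hv0]
    have h := (coeff_zero_freq_eq_zero_iff _).mpr (hmean k)
    rw [coeff_sub_fun (integrable_L2 _) (integrable_L2 _)] at h
    rw [hv0, hv₀, co_sub, show (co u₀ - co (U 0)) k 0 = 0 from h, mul_zero, zero_add]
  have hvd : ∀ t, 0 ≤ t → ∀ ξ : Freq d, ∑ j, (ξ j : ℂ) * v t j ξ = 0 := fun t ht ξ => by
    rw [hv t ht]
    exact sum_coord_heat_add_duh hv₀d (fun r => sum_coord_pert _ _) hgc.continuous t ξ
  have hexp : ∀ {B : ℝ}, 0 ≤ B → ∀ t, 0 ≤ t → B * Real.exp (-(α * t)) ≤ B := fun hB t ht =>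
    mul_le_of_le_one_right hB (Real.exp_le_one_iff.mpr (neg_nonpos.mpr (mul_nonneg hα ht)))
  have hvδ : ∀ t, 0 ≤ t → hsv (σ + 1) (v t) ≤ ENNReal.ofReal (2 * δ) := fun t ht =>
    (hvb t ht).trans (ENNReal.ofReal_le_ofReal (hexp (by positivity) t ht))
  have hsum : ∀ t, 0 ≤ t → hsv (σ + 1) (w t) + hsv (σ + 1) (v t) + hsv (σ + 1) (w t) ≤
      ENNReal.ofReal (2 * (K * δ + 2 * δ)) := fun t ht => by
    refine (add_le_add (add_le_add (hwb t) (hvδ t ht)) (hwb t)).trans ?_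
    have := mul_nonneg hK hδ
    rw [← ENNReal.ofReal_add this (by positivity), ← ENNReal.ofReal_add (by positivity) this]
    apply ENNReal.ofReal_le_ofReal
    linarith
  -- By smallness the nonlinear part of the time derivative is no larger than the bound for its
  -- Laplacian part: 2δ + 2δ is the 4δ of the statement.
  have hpert : ∀ t, 0 ≤ t → hsv σ (pert (w t) (v t)) ≤ hsv (σ + 1) (v t) := fun t ht => by
    refine (hsv_pert_le hσ0 (hwf t) (hvf t)).trans ?_
    rw [← mul_assoc]
    refine mul_le_of_le_one_left zero_le ?_
    calc _ ≤ pertConst d σ * ENNReal.ofReal (2 * (K * δ + 2 * δ)) := by gcongr; exact hsum t ht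
      _ ≤ ENNReal.ofReal ((1 - α) / 2) := hsmall
      _ ≤ ENNReal.ofReal 1 := ENNReal.ofReal_le_ofReal (by linarith)
      _ = 1 := ENNReal.ofReal_one
  have hDb : ∀ t, 0 ≤ t → hsv (σ - 1) (pertDeriv (w t) (v t)) ≤
      ENNReal.ofReal (4 * δ * Real.exp (-(α * t))) := fun t ht => by
    refine hsv_pertDeriv_le.trans ((add_le_add_right (hpert t ht) _).trans
      ((add_le_add (hvb t ht) (hvb t ht)).trans_eq ?_))
    rw [← ENNReal.ofReal_add (by positivity) (by positivity)]
    congr 1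
    ring
  have hDf : ∀ t, hsv (σ - 1) (pertDeriv (w t) (v t)) < ⊤ := fun t =>
    hsv_pertDeriv_le.trans_lt (ENNReal.add_lt_top.mpr ⟨hvf t,
      (hsv_pert_le hσ0 (hwf t) (hvf t)).trans_lt (ENNReal.mul_lt_top (pertConst_lt_top hσ)
        (ENNReal.mul_lt_top (ENNReal.add_lt_top.mpr
          ⟨ENNReal.add_lt_top.mpr ⟨hwf t, hvf t⟩, hwf t⟩) (hvf t)))⟩)
  have hDc := HCont.pertDeriv hσ0 hσ hwc hvc hwf hvf
  have hPf : ∀ t, hs (σ + 1) (pertPres (w t) (v t)) < ⊤ := fun t =>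
    (hs_pertPres_le hσ0 (hwf t) (hvf t)).trans_lt (ENNReal.mul_lt_top (ENNReal.natCast_lt_top d)
      (ENNReal.mul_lt_top (advConst_lt_top hσ) (ENNReal.mul_lt_top (ENNReal.add_lt_top.mpr
          ⟨ENNReal.add_lt_top.mpr ⟨hwf t, hvf t⟩, hwf t⟩) (hvf t))))
  have hPb : ∀ t, 0 ≤ t → hs (σ + 1) (pertPres (w t) (v t)) ≤ d * (advConst d d σ *
      ENNReal.ofReal (2 * (K * δ + 2 * δ) * (2 * δ * Real.exp (-(α * t))))) := fun t ht => by
    refine (hs_pertPres_le hσ0 (hwf t) (hvf t)).trans ?_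
    rw [ENNReal.ofReal_mul (by positivity)]
    gcongr
    · exact hsum t ht
    · exact hvb t ht
  choose z hz using fun t => exists_co_eq ((hsv_mono (by linarith) _).trans_lt (hvf t)) (hvH t)
  choose z' hz' using fun t => exists_co_eq ((hsv_mono (by linarith) _).trans_lt (hDf t))
    (Herm.pertDeriv (hwH t) (hvH t))
  choose q hq using fun t => exists_coeff_eq ((hs_mono (by linarith) _).trans_lt (hPf t))
    (Herm.pertPres (hwH t) (hvH t))
  have hco : ∀ t, co (U (flow ω t) + z t) = w t + v t := fun t => by rw [co_add, hz]
  have hco' : ∀ t, co (uω' t + z' t) = co (uω' t) + pertDeriv (w t) (v t) := fun t => by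
    rw [co_add, hz']
  have hcp : ∀ t, coeff ⇑(P (flow ω t) + q t) =
      coeff (P (flow ω t)) + pertPres (w t) (v t) := fun t => by rw [coeff_add, hq]
  have hreg : BoundedContinuousIn (sobolevNormVec (σ + 1)) (Set.Ici 0)
      (fun t => U (flow ω t) + z t) := by
    refine boundedContinuousIn_of_hCont (by simpa only [hco] using hwc.add hvc)
      (M := ENNReal.ofReal (K * δ) + ENNReal.ofReal (2 * δ))
      (ENNReal.add_lt_top.mpr ⟨ENNReal.ofReal_lt_top, ENNReal.ofReal_lt_top⟩) fun t ht => ?_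
    rw [hco]
    exact (hsv_add_le _ _ _).trans (add_le_add (hwb t) (hvδ t ht))
  have hPωb : ∀ t, hs (σ + 1) (coeff (P (flow ω t))) ≤ ENNReal.ofReal (K * ε) := fun t => by
    rw [← sobolevNorm_eq]
    exact hQ.bound_pressure _
  have hpb : ∀ t, hs (σ + 1) (coeff ⇑(P (flow ω t) + q t)) ≤
      ENNReal.ofReal (K * ε) + hs (σ + 1) (pertPres (w t) (v t)) := fun t => by
    rw [hcp]
    exact (hs_add_le _ _ _).trans (add_le_add_left (hPωb t) _)
  refine ⟨fun t => U (flow ω t) + z t, fun t => uω' t + z' t, fun t => P (flow ω t) + q t,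
    ⟨?_, hreg, hreg.mono (by linarith), ?_, ?_, fun t ht => ?_, ?_, fun t ht => ?_⟩,
    fun t ht => ⟨fun k => ?_, ?_, ?_, ?_⟩⟩
  · apply co_injective
    rw [hco, hv0, hv₀, co_sub]
    simp only [hw, flow_zero, add_sub_cancel]
  · rw [hσ2]
    -- The bound on the derivative of the quasi-periodic solution grows with ω, but it enters only
    -- the boundedness of u', not the decay estimates.
    have hc : HCont (σ + 1) fun t => co (uω' t) := tendsto_derivative_flow hU hQ.solves.1
    refine boundedContinuousIn_of_hCont
      (by simpa only [hco'] using (hc.mono (by linarith)).add hDc)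
      (M := ∑ i, ‖(ω i : ℂ)‖ₑ * ENNReal.ofReal (K * ε) + ENNReal.ofReal (4 * δ)) ?_
      fun t ht => ?_
    · exact ENNReal.add_lt_top.mpr ⟨ENNReal.sum_lt_top.mpr fun i _ =>
        ENNReal.mul_lt_top enorm_lt_top ENNReal.ofReal_lt_top, ENNReal.ofReal_lt_top⟩
    · rw [hco']
      refine (hsv_add_le _ _ _).trans (add_le_add
        ((hsv_mono (by linarith) _).trans (hsv_derivative_flow_le hU hQ.solves.1 t))
        ((hDb t ht).trans (ENNReal.ofReal_le_ofReal (hexp (by positivity) t ht))))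
  · have hM : (d : ℝ≥0∞) * (advConst d d σ *
        ENNReal.ofReal (2 * (K * δ + 2 * δ) * (2 * δ))) < ⊤ :=
      ENNReal.mul_lt_top (ENNReal.natCast_lt_top d)
        (ENNReal.mul_lt_top (advConst_lt_top hσ) ENNReal.ofReal_lt_top)
    refine ⟨⟨(ENNReal.ofReal (K * ε) + d * (advConst d d σ *
        ENNReal.ofReal (2 * (K * δ + 2 * δ) * (2 * δ)))).toNNReal, fun t ht => ?_⟩,
      fun t _ => ?_⟩
    · rw [ENNReal.coe_toNNReal (ENNReal.add_lt_top.mpr ⟨ENNReal.ofReal_lt_top, hM⟩).ne,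
        sobolevNorm_eq]
      refine (hpb t).trans (add_le_add_right ((hPb t ht).trans ?_) _)
      gcongr d * (advConst d d σ * ENNReal.ofReal (_ * ?_))
      exact hexp (by positivity) t ht
    · have h1 := hQ.cont_pressure (flow ω t) trivial
      rw [nhdsWithin_univ] at h1
      have h2 := (h1.comp (continuous_flow ω).continuousAt).add
        (HCont.pertPres hσ0 hσ hwc hvc hwf hvf t)
      rw [add_zero] at h2
      refine (tendsto_zero_of_le (fun r => ?_) h2).mono_left nhdsWithin_le_nhds
      simp only [Function.comp, sobolevNorm_eq]
      rw [coeff_sub, coeff_sub, hcp, hcp, add_sub_add_comm]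
      exact hs_add_le _ _ _
  · rw [← coeff_zero_freq_eq_zero_iff, hcp, Pi.add_apply, pertPres_zero_freq, add_zero,
      coeff_zero_freq_eq_zero_iff]
    exact hQ.mean_pressure _
  · refine (hQ.solves.1.mono_set (Set.subset_univ _)).add fun t ht => ?_
    simp only [sobolevNormVec_eq, co_sub, co_smul, hz, hz', hσ2]
    exact tendsto_difference_quotient hDc.continuous ht
      (fun r hr k ξ => sub_eq_integral_of_mild hvc.continuous hgc.continuous hv ht hr k ξ)
      ((hDc t).mono_left nhdsWithin_le_nhds)
  · refine navierStokesAt_of_coeff (divFree_iff.mpr fun ξ => ?_) ?_ ?_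
      (fun k => ((hsol t trivial).coeff_eq k).1) fun k => ?_
    · rw [hco]
      simp only [Pi.add_apply, mul_add, Finset.sum_add_distrib, hwd t ξ, hvd t ht ξ, add_zero]
    · rw [hco]
      refine (hsv_mono (by linarith : (2 : ℝ) ≤ σ + 1) _).trans_lt ((hsv_add_le _ _ _).trans_lt
        (ENNReal.add_lt_top.mpr ⟨hwf t, hvf t⟩))
    · exact (hs_mono (by linarith : (1 : ℝ) ≤ σ + 1) _).trans_lt ((hpb t).trans_lt
        (ENNReal.add_lt_top.mpr ⟨ENNReal.ofReal_lt_top, hPf t⟩))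
    · rw [((hsol t trivial).coeff_eq k).2, hco, hco', hcp]
      exact (nsCoeff_add ((hsv_mono (by linarith) _).trans_lt (hwf t))
        ((hsv_mono (by linarith) _).trans_lt (hvf t)) (hwd t) (hvd t ht) k).symm
  · rw [← coeff_zero_freq_eq_zero_iff, coeff_sub_fun (integrable_L2 _) (integrable_L2 _)]
    have h := congrFun (congrFun (hco t) k) 0
    rw [Pi.add_apply, Pi.add_apply, hvz t ht k, add_zero] at h
    exact sub_eq_zero.mpr h
  · rw [sobolevNormVec_eq, add_sub_cancel_left, hz]
    exact hvb t ht
  · rw [sobolevNormVec_eq, add_sub_cancel_left, hz', hσ2]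
    exact hDb t ht
  · rw [sobolevNorm_eq, add_sub_cancel_left, hq]
    exact hPb t ht

end existence

end NSTorus

end

/-! ### Choice of the constants and conclusion -/

theorem theorem1p2 (d ν : ℕ) (hd : 2 ≤ d) (α : ℝ) (hα : α ∈ Set.Ioo (0 : ℝ) 1)
    (s : ℝ) (hs : (d : ℝ) / 2 + 1 < s)
    (N : ℕ) (hN : 3 * (ν : ℝ) / 2 + s + 2 < (N : ℝ))
    (f : NSTorus.Torus ν × NSTorus.Torus d → EuclideanSpace ℝ (Fin d))
    (hf : NSTorus.IsCN N f) (hf0 : ∫ z, f z = 0) (K : ℝ) (hK : 0 < K) :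
    ∃ δ₀ ∈ Set.Ioo (0 : ℝ) 1, ∃ C : ℝ, 0 < C ∧
      ∀ ω : Fin ν → ℝ, (NSTorus.Diophantine ω ∨ ∀ φ, ∫ x, f (φ, x) = 0) →
      ∀ δ ∈ Set.Ioc (0 : ℝ) δ₀, ∀ ε ∈ Set.Ioc (0 : ℝ) δ,
      ∀ (U : NSTorus.Torus ν → NSTorus.L2Vec d d) (P : NSTorus.Torus ν → NSTorus.L2 d)
        (uω' : ℝ → NSTorus.L2Vec d d),
        NSTorus.IsQuasiPeriodicSolution s ε K f ω U P uω' →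
      ∀ u₀ : NSTorus.L2Vec d d,
        NSTorus.sobolevNormVec s u₀ < ⊤ →
        NSTorus.DivFree u₀ →
        NSTorus.sobolevNormVec s (u₀ - U 0) ≤ ENNReal.ofReal δ →
        (∀ k, ∫ x, (u₀ k x - U 0 k x) = 0) →
      ∃ (u u' : ℝ → NSTorus.L2Vec d d) (p : ℝ → NSTorus.L2 d),
        NSTorus.IsGlobalClassicalSolution s (NSTorus.force ε f ω) u₀ u u' p ∧
        (∀ t : ℝ, 0 ≤ t →
          (∀ k, ∫ x, (u t k x - U (NSTorus.flow ω t) k x) = 0) ∧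
          NSTorus.sobolevNormVec s (u t - U (NSTorus.flow ω t)) ≤
            ENNReal.ofReal (C * δ * Real.exp (-α * t)) ∧
          NSTorus.sobolevNormVec (s - 2) (u' t - uω' t) ≤
            ENNReal.ofReal (C * δ * Real.exp (-α * t)) ∧
          NSTorus.sobolevNorm s (p t - P (NSTorus.flow ω t)) ≤
            ENNReal.ofReal (C * δ * Real.exp (-α * t))) ∧
        (∀ (v v' : ℝ → NSTorus.L2Vec d d) (q : ℝ → NSTorus.L2 d),
          NSTorus.IsGlobalClassicalSolution s (NSTorus.force ε f ω) u₀ v v' q →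
          ∀ t : ℝ, 0 ≤ t → v t = u t ∧ q t = p t) := by
  obtain ⟨σ, rfl⟩ : ∃ σ, s = σ + 1 := ⟨s - 1, by ring⟩
  have hσ : (d : ℝ) / 2 < σ := by linarith
  obtain ⟨hα0, hα1⟩ := hα
  set B : ℝ := (NSTorus.pertConst d σ).toReal with hB
  set A : ℝ := (NSTorus.advConst d d σ).toReal with hA
  have hB0 : 0 ≤ B := ENNReal.toReal_nonneg
  have hA0 : 0 ≤ A := ENNReal.toReal_nonneg
  have hBe : NSTorus.pertConst d σ = ENNReal.ofReal B :=
    (ENNReal.ofReal_toReal (NSTorus.pertConst_lt_top hσ).ne).symm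
  have hAe : NSTorus.advConst d d σ = ENNReal.ofReal A :=
    (ENNReal.ofReal_toReal (NSTorus.advConst_lt_top hσ).ne).symm
  -- The smallness condition reads 2B(K+2)δ ≤ (1−α)/2, whence δ₀ = (1−α)/(2L). The summand 1 gives L
  -- ≥ 1, so that δ₀ is well defined and less than 1 whatever B is.
  set L : ℝ := 2 * B * (K + 2) + 1 with hL
  have hL1 : 1 ≤ L := by
    have : 0 ≤ 2 * B * (K + 2) := by positivity
    linarith
  have hδ₀ : 0 < (1 - α) / 2 / L := by
    have : 0 < 1 - α := by linarith
    positivity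
  -- In C the 4 covers the velocity (2) and its time derivative (4); the other summand covers the
  -- pressure, one of whose two factors δ is bounded by 1.
  refine ⟨(1 - α) / 2 / L, ⟨hδ₀, ?_⟩, 4 + d * (A * (2 * (K + 2) * 2)), by positivity, ?_⟩
  · rw [div_lt_one (by linarith)]
    linarith
  intro ω _ δ hδ ε hε U P uω' hQ u₀ _ hdiv hu₀ hmean
  have hδ0 : 0 < δ := hδ.1
  have hδL : δ * L ≤ (1 - α) / 2 := (le_div_iff₀ (by linarith)).mp hδ.2
  have hδ1 : δ ≤ 1 := by
    have : δ * 1 ≤ δ * L := by gcongr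
    linarith
  have hsmall : NSTorus.pertConst d σ * ENNReal.ofReal (2 * (K * δ + 2 * δ)) ≤
      ENNReal.ofReal ((1 - α) / 2) := by
    rw [hBe, ← ENNReal.ofReal_mul hB0]
    apply ENNReal.ofReal_le_ofReal
    calc B * (2 * (K * δ + 2 * δ)) = δ * (2 * B * (K + 2)) := by ring
      _ ≤ δ * L := by gcongr; linarith
      _ ≤ _ := hδL
  obtain ⟨u, u', p, hsol, hest⟩ := NSTorus.exists_stable_solution hd hσ hα0.le hα1 hK.le hδ0.le
    hε.2 hQ hdiv hu₀ hmean hsmall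
  refine ⟨u, u', p, hsol, fun t ht => ?_, fun v v' q hv t ht => hsol.unique hσ hv ht⟩
  obtain ⟨h1, h2, h3, h4⟩ := hest t ht
  rw [neg_mul]
  have hC : 0 ≤ d * (A * (2 * (K + 2) * 2)) := by positivity
  refine ⟨h1, h2.trans (ENNReal.ofReal_le_ofReal ?_), h3.trans (ENNReal.ofReal_le_ofReal ?_),
    h4.trans ?_⟩
  · gcongr
    linarith
  · gcongr
    linarith
  · rw [hAe, ← ENNReal.ofReal_natCast, ← ENNReal.ofReal_mul hA0, ← ENNReal.ofReal_mul (by positivity)]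
    apply ENNReal.ofReal_le_ofReal
    calc d * (A * (2 * (K * δ + 2 * δ) * (2 * δ * Real.exp (-(α * t)))))
        = δ * (d * (A * (2 * (K + 2) * 2)) * δ * Real.exp (-(α * t))) := by ring
      _ ≤ 1 * ((4 + d * (A * (2 * (K + 2) * 2))) * δ * Real.exp (-(α * t))) := by
          gcongr
          linarith
      _ = _ := one_mul _
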